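/- Let $\mathbb F=\mathbb Z/2$. Let $\widetilde{\mathcal A}$ be the extended torus algebra over $\mathbb F$: the path algebra (paths composed from left to right) of the quiver with vertices $\iota_0,\iota_1$ and arrows $\rho_1,\rho_3\colon\iota_0\to\iota_1$, $\rho_2,\rho_0\colon\iota_1\to\iota_0$, modulo the relations $\rho_i\rho_{i-1}=0$ (indices mod $4$) and $\rho_0\rho_1\rho_2\rho_3\rho_0=0$. Put $\rho_{ij\cdots k}=\rho_i\rho_j\cdots\rho_k$ and $U=\rho_{1230}+\rho_{2301}+\rho_{3012}+\rho_{0123}$. The torus algebra is $\mathcal A=\widetilde{\mathcal A}/(\rho_0)$, and $\mathcal I=\mathbb F\iota_0\oplus\mathbb F\iota_1$. A type D structure over $\mathcal A$ is a finite-dimensional $\mathcal I$-module $V=\iota_0V\oplus\iota_1V$ with an $\mathcal I$-linear map $\delta\colon V\to\mathcal A\otimes_{\mathcal I}V$ such that the $\mathcal A$-linear map $\partial(a\otimes x)=a\cdot\delta(x)$ on $N=\mathcal A\otimes_{\mathcal I}V$ satisfies $\partial^2=0$. An extended type D structure is the same over $\widetilde{\mathcal A}$, with the condition $\tilde\partial^2(1\otimes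 x)=U\otimes x$ for all $x\in V$. A type D structure $N$ is extendable if there is an extended type D structure $\widetilde N$ such that $\mathcal A\otimes_{\widetilde{\mathcal A}}\widetilde N\cong N$ as differential $\mathcal A$-modules. Let $T=(\mathbb R^2\setminus\mathbb Z^2)/\mathbb Z^2$ be the punctured torus, and let $\alpha,\beta\subset T$ be the images of the $y$-axis and the $x$-axis, which cut $T$ into a square with its corners removed. Number the sides of the square clockwise: $0$ (right), $1$ (bottom), $2$ (left), $3$ (top). A decorated curve $(\gamma,k,A)$ consists of a smooth immersion $\gamma\colon S^1\to T$, an integer $k\ge1$ and a matrix $A\in GL_k(\mathbb F)$ (a local system of rank $k$ on $\gamma$), where $\gamma$ is in reduced position: it is transverse to $\alpha\cup\beta$, it meets $\alpha\cup\beta$, and each arc into which $\alpha\cup\beta$ cuts it is an embedded arc that connects two different sides of the square. The type D structure $N(\gamma,k,A)$ is defined as follows. Number the crossings of $\gamma$ with $\alpha\cup\beta$ cyclically along $\gamma$ by $s\in\mathbb Z/n$. The generators are $x_{s,a}$ with $s\in\mathbb Z/n$ and $1\le a\le k$; the generator $x_{s,a}$ lies in $\iota_0V$ if crossing $s$ is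 on $\alpha$, and in $\iota_1V$ if it is on $\beta$. Let the arc from crossing $s$ to crossing $s+1$ enter the square through side $p$ and leave it through side $q$, and put $\Phi_s=A$ if $s=n-1$ and $\Phi_s=I_k$ otherwise. If $p<q$, this arc contributes $\sum_b(\Phi_s)_{ab}\,\rho_{p+1}\cdots\rho_q\otimes x_{s+1,b}$ to $\delta(x_{s,a})$ for each $a$. If $p>q$, it contributes $\sum_b(\Phi_s^{-1})_{ab}\,\rho_{q+1}\cdots\rho_p\otimes x_{s,b}$ to $\delta(x_{s+1,a})$ for each $a$. The map $\delta$ is the sum of all these contributions, and it does satisfy $\partial^2=0$. **Theorem.** Every extendable type D structure over $\mathcal A$ is represented by a finite collection of immersed curves in the punctured torus decorated with local systems: for every extendable type D structure $N$ over $\mathcal A$ there are $m\ge0$ and decorated curves $(\gamma_1,k_1,A_1),\dots,(\gamma_m,k_m,A_m)$ such that $N$ is homotopy equivalent, as a differential $\mathcal A$-module, to $\bigoplus_{i=1}^m N(\gamma_i,k_i,A_i)$. -/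

import Mathlib

open scoped TensorProduct ContDiff

universe u v

/-! ## The extended torus algebra and the torus algebra -/

namespace TorusAlg

/-- Generators of the extended torus algebra: two idempotents `ι₀, ι₁` and four arrows
`ρ₀, ρ₁, ρ₂, ρ₃` (indices in `Fin 4`, added modulo `4`). -/
inductive Gen where
  | idem (i : Fin 2)
  | arrow (i : Fin 4)

/-- The four sides of the square obtained by cutting the torus along `α ∪ β`, listed clockwise:
`0` right, `1` bottom, `2` left, `3` top. The left and right sides are glued to `α`, which carries
the idempotent `ι₀`; the bottom and top sides are glued to `β`, which carries `ι₁`. -/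
def sideIdem : Fin 4 → Fin 2 := ![0, 1, 0, 1]

/-- The arrow `ρ i` starts at the idempotent of side `i - 1` (so `ρ₁, ρ₃` start at `ι₀`, and
`ρ₀, ρ₂` start at `ι₁`) and ends at the idempotent of side `i`. -/
def src (i : Fin 4) : Fin 2 := sideIdem (i - 1)

/-- See `src`. -/
def tgt (i : Fin 4) : Fin 2 := sideIdem i

/-- The free algebra over the field with two elements on the generators. -/
abbrev FreeAlg := FreeAlgebra (ZMod 2) Gen

/-- The idempotent generators of the free algebra. -/
def freeIdem (i : Fin 2) : FreeAlg := FreeAlgebra.ι (ZMod 2) (Gen.idem i)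

/-- The arrow generators of the free algebra. -/
def freeArrow (i : Fin 4) : FreeAlg := FreeAlgebra.ι (ZMod 2) (Gen.arrow i)

/-- Defining relations of the extended torus algebra: those of the path algebra of the quiver with
vertices `ι₀, ι₁` and arrows `ρ₁, ρ₃ : ι₀ → ι₁`, `ρ₂, ρ₀ : ι₁ → ι₀` (paths are composed from left to
right), together with `ρ_i ρ_{i-1} = 0` for `i` modulo `4`, and `ρ₀ ρ₁ ρ₂ ρ₃ ρ₀ = 0`. -/
inductive ExtRel : FreeAlg → FreeAlg → Prop
  | idem_self (i : Fin 2) : ExtRel (freeIdem i * freeIdem i) (freeIdem i)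
  | idem_ne (i j : Fin 2) (h : i ≠ j) : ExtRel (freeIdem i * freeIdem j) 0
  | idem_sum : ExtRel (freeIdem 0 + freeIdem 1) 1
  | src_arrow (i : Fin 4) : ExtRel (freeIdem (src i) * freeArrow i) (freeArrow i)
  | arrow_tgt (i : Fin 4) : ExtRel (freeArrow i * freeIdem (tgt i)) (freeArrow i)
  | back (i : Fin 4) : ExtRel (freeArrow i * freeArrow (i - 1)) 0
  | long : ExtRel (freeArrow 0 * freeArrow 1 * freeArrow 2 * freeArrow 3 * freeArrow 0) 0

end TorusAlg

open TorusAlg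

/-- The extended torus algebra `Ã`. -/
def ExtAlg : Type := RingQuot ExtRel

noncomputable instance : Ring ExtAlg := inferInstanceAs (Ring (RingQuot ExtRel))
noncomputable instance : Algebra (ZMod 2) ExtAlg := inferInstanceAs (Algebra (ZMod 2) (RingQuot ExtRel))

namespace ExtAlg

/-- The quotient map from the free algebra. -/
noncomputable def mk : FreeAlg →ₐ[ZMod 2] ExtAlg := RingQuot.mkAlgHom (ZMod 2) ExtRel

/-- The idempotents `ι₀, ι₁`. -/
noncomputable def idem (i : Fin 2) : ExtAlg := mk (freeIdem i)

/-- The arrows `ρ₀, ρ₁, ρ₂, ρ₃`. -/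
noncomputable def rho (i : Fin 4) : ExtAlg := mk (freeArrow i)

/-- The central element `U = ρ₁₂₃₀ + ρ₂₃₀₁ + ρ₃₀₁₂ + ρ₀₁₂₃`. -/
noncomputable def U : ExtAlg :=
  rho 1 * rho 2 * rho 3 * rho 0 + rho 2 * rho 3 * rho 0 * rho 1 +
    rho 3 * rho 0 * rho 1 * rho 2 + rho 0 * rho 1 * rho 2 * rho 3

lemma mk_rel {a b : FreeAlg} (h : ExtRel a b) : mk a = mk b :=
  RingQuot.mkAlgHom_rel (ZMod 2) h

lemma idem_self (i : Fin 2) : idem i * idem i = idem i := by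
  simpa [idem] using mk_rel (ExtRel.idem_self i)

lemma idem_ne {i j : Fin 2} (h : i ≠ j) : idem i * idem j = 0 := by
  simpa [idem] using mk_rel (ExtRel.idem_ne i j h)

lemma idem_sum : idem 0 + idem 1 = 1 := by
  simpa [idem] using mk_rel ExtRel.idem_sum

lemma src_rho (i : Fin 4) : idem (src i) * rho i = rho i := by
  simpa [idem, rho] using mk_rel (ExtRel.src_arrow i)

lemma rho_tgt (i : Fin 4) : rho i * idem (tgt i) = rho i := by
  simpa [idem, rho] using mk_rel (ExtRel.arrow_tgt i)

lemma rho_back (i : Fin 4) : rho i * rho (i - 1) = 0 := by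
  simpa [rho] using mk_rel (ExtRel.back i)

end ExtAlg

/-- The relation `ρ₀ = 0` on the extended torus algebra. -/
def KillRhoZero (a b : ExtAlg) : Prop := a = ExtAlg.rho 0 ∧ b = 0

/-- The torus algebra `A`, the quotient of `Ã` by the two-sided ideal generated by `ρ₀`. -/
def TorAlg : Type := RingQuot KillRhoZero

noncomputable instance : Ring TorAlg := inferInstanceAs (Ring (RingQuot KillRhoZero))
noncomputable instance : Algebra (ZMod 2) TorAlg :=
  inferInstanceAs (Algebra (ZMod 2) (RingQuot KillRhoZero))

/-- The quotient map `Ã → A`. -/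
noncomputable def toTorAlg : ExtAlg →ₐ[ZMod 2] TorAlg := RingQuot.mkAlgHom (ZMod 2) KillRhoZero

lemma toTorAlg_rho_zero : toTorAlg (ExtAlg.rho 0) = 0 := by
  have h : KillRhoZero (ExtAlg.rho 0) 0 := ⟨rfl, rfl⟩
  exact (RingQuot.mkAlgHom_rel (ZMod 2) h).trans (map_zero _)

lemma toTorAlg_U : toTorAlg ExtAlg.U = 0 := by
  simp [ExtAlg.U, toTorAlg_rho_zero]

/-! ## Type D structures -/

/-- The ring of idempotents, with basis `ι₀, ι₁` over the field with two elements. -/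
abbrev IdemRing := Fin 2 → ZMod 2

/-- A ring which contains (an image of) the ring of idempotents. -/
class OverIdem (B : Type) [Ring B] where
  /-- The structure map from the ring of idempotents. -/
  incl : IdemRing →+* B

noncomputable instance : OverIdem ExtAlg where
  incl :=
    { toFun := fun s => s 0 • ExtAlg.idem 0 + s 1 • ExtAlg.idem 1
      map_one' := by simp [ExtAlg.idem_sum]
      map_zero' := by simp
      map_add' := fun s t => by simp only [Pi.add_apply, add_smul]; abel
      map_mul' := fun s t => by
        simp [mul_add, add_mul, smul_smul, ExtAlg.idem_self,
          ExtAlg.idem_ne (show (0 : Fin 2) ≠ 1 by decide),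
          ExtAlg.idem_ne (show (1 : Fin 2) ≠ 0 by decide), mul_comm] }

noncomputable instance : OverIdem TorAlg where
  incl := (toTorAlg : ExtAlg →+* TorAlg).comp OverIdem.incl

section TypeD

variable {B : Type} [Ring B] [OverIdem B]

/-- `B` as a module over the (commutative) ring of idempotents, by multiplication on the right.
With this structure, `B ⊗[IdemRing] V` is the tensor product over the idempotents of the
right module `B` and the left module `V`, and it is a left `B`-module through
`a • (b ⊗ x) = (a b) ⊗ x`. -/
noncomputable instance instModuleRight : Module IdemRing B where
  smul s b := b * OverIdem.incl s
  one_smul b := by change b * OverIdem.incl 1 = b; simp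
  mul_smul s t b := by
    change b * OverIdem.incl (s * t) = b * OverIdem.incl t * OverIdem.incl s
    rw [mul_comm s t, map_mul, mul_assoc]
  smul_zero s := by change (0 : B) * OverIdem.incl s = 0; simp
  smul_add s a b := by
    change (a + b) * OverIdem.incl s = a * OverIdem.incl s + b * OverIdem.incl s
    rw [add_mul]
  add_smul s t b := by
    change b * OverIdem.incl (s + t) = b * OverIdem.incl s + b * OverIdem.incl t
    rw [map_add, mul_add]
  zero_smul b := by change b * OverIdem.incl 0 = 0; simp

lemma right_smul_def (s : IdemRing) (b : B) : s • b = b * OverIdem.incl s := rfl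

instance instSMulCommRight : SMulCommClass IdemRing B B where
  smul_comm s a b := by simp [right_smul_def, mul_assoc]

instance instSMulCommLeft : SMulCommClass B IdemRing B := SMulCommClass.symm _ _ _

/-- The `B`-linear map `∂ (a ⊗ x) = a • δ x` attached to a map `δ : V → B ⊗ V` which is linear
over the idempotents, these acting on `B ⊗ V` from the left. -/
noncomputable def boundary {V : Type u} [AddCommGroup V] [Module IdemRing V]
    (δ : V →+ B ⊗[IdemRing] V)
    (hδ : ∀ (s : IdemRing) (x : V), δ (s • x) = (OverIdem.incl s : B) • δ x) :
    B ⊗[IdemRing] V →ₗ[B] B ⊗[IdemRing] V :=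
  let F : B ⊗[IdemRing] V →+ B ⊗[IdemRing] V := TensorProduct.liftAddHom
      (AddMonoidHom.mk' (fun a : B => (DistribSMul.toAddMonoidHom (B ⊗[IdemRing] V) a).comp δ)
        (fun a b => by ext x; simp [add_smul]))
      (fun s a x => by simp [right_smul_def, mul_smul, hδ])
  { toFun := F
    map_add' := map_add F
    map_smul' := fun a y => by
      induction y using TensorProduct.induction_on with
      | zero => simp
      | tmul b x => simp [F, TensorProduct.smul_tmul', mul_smul]
      | add y z hy hz =>
        simp only [RingHom.id_apply] at hy hz ⊢
        simp only [smul_add, map_add, hy, hz] }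

lemma boundary_tmul {V : Type u} [AddCommGroup V] [Module IdemRing V]
    (δ : V →+ B ⊗[IdemRing] V)
    (hδ : ∀ (s : IdemRing) (x : V), δ (s • x) = (OverIdem.incl s : B) • δ x) (a : B) (x : V) :
    boundary δ hδ (a ⊗ₜ x) = a • δ x := by
  simp [boundary]

end TypeD

/-- A (finitely generated) type D structure over `B` with curvature `c`: a finite-dimensional module
`V = ι₀V ⊕ ι₁V` over the ring of idempotents, and a map `δ : V → B ⊗ V` over the idempotents such
that the map `∂ (a ⊗ x) = a • δ x` on `B ⊗ V` satisfies `∂² x = c x` for all `x` in `V`. -/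
structure CurvedTypeD (B : Type) [Ring B] [OverIdem B] (c : B) where
  V : Type u
  [addCommGroup : AddCommGroup V]
  [module : Module IdemRing V]
  [finite : Module.Finite IdemRing V]
  δ : V →+ B ⊗[IdemRing] V
  δ_smul : ∀ (s : IdemRing) (x : V), δ (s • x) = (OverIdem.incl s : B) • δ x
  sq : ∀ x : V, boundary δ δ_smul (boundary δ δ_smul (1 ⊗ₜ x)) = c • ((1 : B) ⊗ₜ[IdemRing] x)

attribute [instance] CurvedTypeD.addCommGroup CurvedTypeD.module CurvedTypeD.finite

namespace CurvedTypeD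

variable {B : Type} [Ring B] [OverIdem B] {c : B}

/-- The associated left `B`-module `B ⊗ V`. -/
abbrev Mod (N : CurvedTypeD.{u} B c) : Type u := B ⊗[IdemRing] N.V

/-- The map `∂` on the associated module. -/
noncomputable def d (N : CurvedTypeD.{u} B c) : N.Mod →ₗ[B] N.Mod := boundary N.δ N.δ_smul

end CurvedTypeD

/-- Type D structures over the torus algebra. -/
abbrev TypeD := CurvedTypeD.{u} TorAlg 0

/-- Extended type D structures: the same over the extended torus algebra, with `∂² = U`. -/
abbrev ExtTypeD := CurvedTypeD.{u} ExtAlg ExtAlg.U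

/-- The map `Ã ⊗ V → A ⊗ V` induced by the quotient map `Ã → A`. -/
noncomputable def reduceMod (V : Type u) [AddCommGroup V] [Module IdemRing V] :
    ExtAlg ⊗[IdemRing] V →ₗ[IdemRing] TorAlg ⊗[IdemRing] V :=
  LinearMap.rTensor V
    { toFun := toTorAlg
      map_add' := map_add toTorAlg
      map_smul' := fun _ b => map_mul toTorAlg b _ }

lemma reduceMod_tmul (V : Type u) [AddCommGroup V] [Module IdemRing V] (a : ExtAlg) (x : V) :
    reduceMod V (a ⊗ₜ x) = toTorAlg a ⊗ₜ x := rfl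

lemma reduceMod_smul (V : Type u) [AddCommGroup V] [Module IdemRing V] (a : ExtAlg)
    (y : ExtAlg ⊗[IdemRing] V) : reduceMod V (a • y) = toTorAlg a • reduceMod V y := by
  induction y using TensorProduct.induction_on with
  | zero => simp
  | tmul b x => simp [TensorProduct.smul_tmul', reduceMod_tmul]
  | add y z hy hz => simp only [smul_add, map_add, hy, hz]

/-- The underlying type D structure `A ⊗_Ã Ñ` of an extended type D structure `Ñ`, obtained by
setting `ρ₀ = 0` in the structure map. -/
noncomputable def ExtTypeD.underlying (N : ExtTypeD.{u}) : TypeD.{u} where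
  V := N.V
  δ := (reduceMod N.V).toAddMonoidHom.comp N.δ
  δ_smul s x := by
    change reduceMod N.V (N.δ (s • x)) = _
    rw [N.δ_smul, reduceMod_smul]
    rfl
  sq x := by
    have hsm : ∀ (s : IdemRing) (x : N.V), ((reduceMod N.V).toAddMonoidHom.comp N.δ) (s • x) =
        (OverIdem.incl s : TorAlg) • ((reduceMod N.V).toAddMonoidHom.comp N.δ) x := by
      intro s x
      change reduceMod N.V (N.δ (s • x)) = _
      rw [N.δ_smul, reduceMod_smul]
      rfl
    have key : ∀ y : ExtAlg ⊗[IdemRing] N.V,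
        boundary (B := TorAlg) ((reduceMod N.V).toAddMonoidHom.comp N.δ)
          hsm (reduceMod N.V y) = reduceMod N.V (boundary N.δ N.δ_smul y) := by
      intro y
      induction y using TensorProduct.induction_on with
      | zero => simp
      | tmul a z =>
        rw [reduceMod_tmul, boundary_tmul, boundary_tmul, reduceMod_smul]
        rfl
      | add y z hy hz => simp only [map_add, hy, hz]
    have h1 : ((1 : TorAlg) ⊗ₜ[IdemRing] x) = reduceMod N.V ((1 : ExtAlg) ⊗ₜ x) := by
      rw [reduceMod_tmul, map_one]
    rw [h1, key, key, N.sq, reduceMod_smul, toTorAlg_U]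

namespace TypeD

/-- Isomorphism of differential modules over the torus algebra. -/
def Isomorphic (N N' : TypeD.{u}) : Prop :=
  ∃ e : N.Mod ≃ₗ[TorAlg] N'.Mod, ∀ y, e (N.d y) = N'.d (e y)

/-- `N` is extendable if it has an extension `Ñ`, that is, an extended type D structure whose
underlying differential module `A ⊗_Ã Ñ` is isomorphic to that of `N`. -/
def Extendable (N : TypeD.{u}) : Prop :=
  ∃ E : ExtTypeD.{u}, Isomorphic (ExtTypeD.underlying E) N

/-- Homotopy equivalence of the associated differential modules over the torus algebra
(there are no signs, since the coefficients have characteristic two). -/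
def HomotopyEquivalent (N : TypeD.{u}) (N' : TypeD.{v}) : Prop :=
  ∃ (f : N.Mod →ₗ[TorAlg] N'.Mod) (g : N'.Mod →ₗ[TorAlg] N.Mod)
    (h : N.Mod →ₗ[TorAlg] N.Mod) (h' : N'.Mod →ₗ[TorAlg] N'.Mod),
    f ∘ₗ N.d = N'.d ∘ₗ f ∧ g ∘ₗ N'.d = N.d ∘ₗ g ∧
    g ∘ₗ f - LinearMap.id = N.d ∘ₗ h + h ∘ₗ N.d ∧
    f ∘ₗ g - LinearMap.id = N'.d ∘ₗ h' + h' ∘ₗ N'.d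

end TypeD

/-! ## Type D structures with a chosen homogeneous basis -/

namespace TorAlg

/-- The idempotents `ι₀, ι₁` of the torus algebra. -/
noncomputable def idem (i : Fin 2) : TorAlg := toTorAlg (ExtAlg.idem i)

/-- The elements `ρ₁, ρ₂, ρ₃` (and `ρ₀ = 0`) of the torus algebra. -/
noncomputable def rho (i : Fin 4) : TorAlg := toTorAlg (ExtAlg.rho i)

lemma idem_mul_self (i : Fin 2) : idem i * idem i = idem i := by
  simp [idem, ← map_mul, ExtAlg.idem_self]

lemma src_rho (i : Fin 4) : idem (src i) * rho i = rho i := by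
  simp [idem, rho, ← map_mul, ExtAlg.src_rho]

lemma rho_back (i : Fin 4) : rho i * rho (i - 1) = 0 := by
  simp [rho, ← map_mul, ExtAlg.rho_back]

lemma incl_mul_idem (s : IdemRing) (i : Fin 2) :
    (OverIdem.incl s : TorAlg) * idem i = s i • idem i := by
  have h : (OverIdem.incl s : ExtAlg) * ExtAlg.idem i = s i • ExtAlg.idem i := by
    change (s 0 • ExtAlg.idem 0 + s 1 • ExtAlg.idem 1) * ExtAlg.idem i = _
    fin_cases i
    · simp [add_mul, ExtAlg.idem_self, ExtAlg.idem_ne (show (1 : Fin 2) ≠ 0 by decide)]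
    · simp [add_mul, ExtAlg.idem_self, ExtAlg.idem_ne (show (0 : Fin 2) ≠ 1 by decide)]
  change toTorAlg (OverIdem.incl s) * toTorAlg (ExtAlg.idem i) = s i • toTorAlg (ExtAlg.idem i)
  rw [← map_mul, h, map_smul]

/-- The element of the torus algebra given by the clockwise path from side `p` to side `q` of the
square which does not pass the top right corner: `ρ_{p+1} ⋯ ρ_q` if `p < q` (sides are numbered
`0` right, `1` bottom, `2` left, `3` top). It is set to zero if there is no such nonconstant path. -/
noncomputable def chord : Fin 4 → Fin 4 → TorAlg
  | 0, 1 => rho 1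
  | 1, 2 => rho 2
  | 2, 3 => rho 3
  | 0, 2 => rho 1 * rho 2
  | 1, 3 => rho 2 * rho 3
  | 0, 3 => rho 1 * rho 2 * rho 3
  | _, _ => 0

lemma idem_mul_chord (p q : Fin 4) : idem (sideIdem p) * chord p q = chord p q := by
  have h1 : idem 0 * rho 1 = rho 1 := src_rho 1
  have h2 : idem 1 * rho 2 = rho 2 := src_rho 2
  have h3 : idem 0 * rho 3 = rho 3 := src_rho 3
  fin_cases p <;> fin_cases q <;> simp [chord, sideIdem, ← mul_assoc, h1, h2, h3]

lemma chord_mul_chord (p q r : Fin 4) : chord p q * chord (q + 2) r = 0 := by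
  have h2 : rho 2 * rho 1 = 0 := rho_back 2
  have h3 : rho 3 * rho 2 = 0 := rho_back 3
  have h2' : ∀ a, rho 2 * (rho 1 * a) = 0 := fun a => by rw [← mul_assoc, h2, zero_mul]
  have h3' : ∀ a, rho 3 * (rho 2 * a) = 0 := fun a => by rw [← mul_assoc, h3, zero_mul]
  fin_cases p <;> fin_cases q <;> fin_cases r <;> simp [chord, mul_assoc, h2, h3, h2', h3']

lemma chord_mul_rev (p q : Fin 4) : chord p q * chord q p = 0 := by
  fin_cases p <;> fin_cases q <;> simp [chord]

end TorAlg

/-- The vector space with basis `G`, each basis element `g` lying in the summand of the idempotent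
`idem g`. -/
def GenSpace {G : Type} (_idem : G → Fin 2) : Type := G → ZMod 2

section GenSpace

variable {G : Type} (idem : G → Fin 2)

instance : AddCommGroup (GenSpace idem) := inferInstanceAs (AddCommGroup (G → ZMod 2))

instance [Finite G] : Finite (GenSpace idem) := inferInstanceAs (Finite (G → ZMod 2))

instance : Module IdemRing (GenSpace idem) where
  smul s f := fun g => s (idem g) * f g
  one_smul f := funext fun g => one_mul (f g)
  mul_smul s t f := funext fun g => mul_assoc (s (idem g)) (t (idem g)) (f g)
  smul_zero s := funext fun g => mul_zero (s (idem g))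
  smul_add s f f' := funext fun g => mul_add (s (idem g)) (f g) (f' g)
  add_smul s t f := funext fun g => add_mul (s (idem g)) (t (idem g)) (f g)
  zero_smul f := funext fun g => zero_mul (f g)

/-- The basis elements. -/
def GenSpace.basis [DecidableEq G] (g : G) : GenSpace idem := (Pi.single g 1 : G → ZMod 2)

end GenSpace

namespace TypeD

variable {G : Type} [Fintype G] [DecidableEq G]

/-- The map `x_g ↦ ∑ h, D g h ⊗ x_h`, extended linearly. -/
noncomputable def matrixMap (idem : G → Fin 2) (D : Matrix G G TorAlg) :
    GenSpace idem →+ TorAlg ⊗[IdemRing] GenSpace idem :=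
  AddMonoidHom.mk' (fun f => ∑ g, ∑ h, (f g • D g h) ⊗ₜ GenSpace.basis idem h) (fun f f' => by
    simp only [← Finset.sum_add_distrib]
    refine Finset.sum_congr rfl fun g _ => Finset.sum_congr rfl fun h _ => ?_
    rw [← TensorProduct.add_tmul, ← add_smul]
    rfl)

lemma matrixMap_apply (idem : G → Fin 2) (D : Matrix G G TorAlg) (f : GenSpace idem) :
    matrixMap idem D f = ∑ g, ∑ h, (f g • D g h) ⊗ₜ GenSpace.basis idem h := rfl

lemma matrixMap_basis (idem : G → Fin 2) (D : Matrix G G TorAlg) (g : G) :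
    matrixMap idem D (GenSpace.basis idem g) = ∑ h, D g h ⊗ₜ GenSpace.basis idem h := by
  rw [matrixMap_apply, Finset.sum_eq_single g]
  · simp [GenSpace.basis]
  · intro b _ hb
    have h0 : (GenSpace.basis idem g) b = (0 : ZMod 2) := Pi.single_eq_of_ne hb _
    simp [h0]
  · simp

lemma matrixMap_smul (idem : G → Fin 2) (D : Matrix G G TorAlg)
    (hD : ∀ g h, TorAlg.idem (idem g) * D g h = D g h) (s : IdemRing) (f : GenSpace idem) :
    matrixMap idem D (s • f) = (OverIdem.incl s : TorAlg) • matrixMap idem D f := by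
  simp only [matrixMap_apply, Finset.smul_sum, TensorProduct.smul_tmul', smul_eq_mul]
  refine Finset.sum_congr rfl fun g _ => Finset.sum_congr rfl fun h _ => ?_
  congr 1
  change (s (idem g) * f g) • D g h = _
  rw [mul_smul_comm, ← hD g h, ← mul_assoc, TorAlg.incl_mul_idem, smul_mul_assoc, smul_smul,
    mul_comm]

/-- The type D structure with homogeneous basis `x_g` (`g : G`), where `x_g` has idempotent
`idem g`, and structure map `δ x_g = ∑ h, D g h ⊗ x_h`. -/
noncomputable def ofMatrix (idem : G → Fin 2) (D : Matrix G G TorAlg)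
    (hD : ∀ g h, TorAlg.idem (idem g) * D g h = D g h) (hsq : D * D = 0) : TypeD.{0} where
  V := GenSpace idem
  δ := matrixMap idem D
  δ_smul := matrixMap_smul idem D hD
  sq f := by
    rw [boundary_tmul, one_smul, zero_smul, matrixMap_apply]
    simp only [map_sum, boundary_tmul, matrixMap_basis, Finset.smul_sum,
      TensorProduct.smul_tmul', smul_eq_mul, smul_mul_assoc]
    refine Finset.sum_eq_zero fun g _ => ?_
    rw [Finset.sum_comm]
    refine Finset.sum_eq_zero fun k _ => ?_
    rw [← TensorProduct.sum_tmul, ← Finset.smul_sum]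
    have h : ∑ i, D g i * D i k = 0 := congrFun (congrFun hsq g) k
    rw [h, smul_zero, TensorProduct.zero_tmul]

end TypeD

/-! ## Immersed curves with local systems -/

/-- An immersed closed curve `S¹ = ℝ/ℤ → T` in the punctured torus `T = (ℝ² ∖ ℤ²)/ℤ²`, given by a
lift `ℝ → ℝ² ∖ ℤ²`. -/
structure ImmersedCurve where
  lift : ℝ → ℝ × ℝ
  smooth : ContDiff ℝ ∞ lift
  immersed : ∀ t, deriv lift t ≠ 0
  closed : ∃ a b : ℤ, ∀ t, lift (t + 1) = lift t + ((a : ℝ), (b : ℝ))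
  avoids_puncture : ∀ (t : ℝ) (a b : ℤ), lift t ≠ ((a : ℝ), (b : ℝ))

namespace ImmersedCurve

/-- At time `t` the curve lies on `α ∪ β`. Here `α` and `β` are the images of the `y`-axis and of
the `x`-axis, so that their preimages in the plane are `ℤ × ℝ` and `ℝ × ℤ`. -/
def OnGrid (γ : ImmersedCurve) (t : ℝ) : Prop :=
  (∃ a : ℤ, (γ.lift t).1 = a) ∨ (∃ b : ℤ, (γ.lift t).2 = b)

/-- At time `t` the curve crosses `α ∪ β` transversely, leaving a unit square through the given
side: `0` right, `1` bottom, `2` left, `3` top. It enters the next square through the opposite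
side. -/
def LeavesThrough (γ : ImmersedCurve) (t : ℝ) : Fin 4 → Prop
  | 0 => (∃ a : ℤ, (γ.lift t).1 = a) ∧ 0 < (deriv γ.lift t).1
  | 1 => (∃ b : ℤ, (γ.lift t).2 = b) ∧ (deriv γ.lift t).2 < 0
  | 2 => (∃ a : ℤ, (γ.lift t).1 = a) ∧ (deriv γ.lift t).1 < 0
  | 3 => (∃ b : ℤ, (γ.lift t).2 = b) ∧ 0 < (deriv γ.lift t).2

end ImmersedCurve

/-- An immersed closed curve in the punctured torus, in reduced position with respect to `α ∪ β`,
together with a local system of positive dimension over the field with two elements.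

Reduced position: the curve is transverse to `α ∪ β`, it meets `α ∪ β`, and each of the arcs into
which `α ∪ β` cuts it is an embedded arc connecting different sides of the square. The arc number
`s` runs from crossing `s` to crossing `s + 1`; crossings are numbered by integers on the lift, and
modulo `len` on the closed curve. -/
structure DecoratedCurve where
  curve : ImmersedCurve
  /-- The number of crossings with `α ∪ β`. -/
  len : ℕ
  [len_ne_zero : NeZero len]
  /-- The times of the crossings. -/
  time : ℤ → ℝ
  time_strictMono : StrictMono time
  time_periodic : ∀ s, time (s + len) = time s + 1
  time_range : ∀ t, curve.OnGrid t ↔ t ∈ Set.range time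
  /-- The side of the square through which the curve leaves at each crossing. -/
  side : ZMod len → Fin 4
  leaves : ∀ s : ℤ, curve.LeavesThrough (time s) (side (s : ZMod len))
  embedded : ∀ s : ℤ, Set.InjOn curve.lift (Set.Icc (time s) (time (s + 1)))
  reduced : ∀ s, side (s + 1) ≠ side s + 2
  /-- The dimension of the local system. -/
  dim : ℕ
  dim_pos : 0 < dim
  /-- The monodromy of the local system. -/
  monodromy : GL (Fin dim) (ZMod 2)

attribute [instance] DecoratedCurve.len_ne_zero

namespace DecoratedCurve

variable (C : DecoratedCurve)

/-- Generators: one for each crossing and each basis element of the local system. -/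
abbrev Gens : Type := ZMod C.len × Fin C.dim

/-- A generator has idempotent `ι₀` if the crossing is with `α` and `ι₁` if it is with `β`. -/
def idem (g : C.Gens) : Fin 2 := sideIdem (C.side g.1)

/-- The side of the square through which arc `s` enters. -/
def enter (s : ZMod C.len) : Fin 4 := C.side s + 2

/-- The side of the square through which arc `s` exits. -/
def exit (s : ZMod C.len) : Fin 4 := C.side (s + 1)

/-- Parallel transport along arc `s`: the monodromy is concentrated on the last arc. -/
def transport (s : ZMod C.len) : GL (Fin C.dim) (ZMod 2) := if s + 1 = 0 then C.monodromy else 1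

/-- The coefficients of the structure map. Arc `s` connects crossing `s` to crossing `s + 1`. If the
clockwise path along the sides of the square that avoids the top right corner leads from the side
where the arc enters to the side where it exits, the arc contributes that path as a coefficient
from crossing `s` to crossing `s + 1`, together with the transport along the arc. Otherwise it
contributes the path in the other direction, from crossing `s + 1` to crossing `s`, together with
the inverse of the transport. (One of the two chords below is zero for each arc.) -/
noncomputable def coeff : Matrix C.Gens C.Gens TorAlg := fun g h =>
  (if h.1 = g.1 + 1 then
    (C.transport g.1 : Matrix (Fin C.dim) (Fin C.dim) (ZMod 2)) g.2 h.2 •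
      TorAlg.chord (C.enter g.1) (C.exit g.1) else 0) +
  (if g.1 = h.1 + 1 then
    ((C.transport h.1)⁻¹ : Matrix (Fin C.dim) (Fin C.dim) (ZMod 2)) g.2 h.2 •
      TorAlg.chord (C.exit h.1) (C.enter h.1) else 0)

lemma sideIdem_add_two (p : Fin 4) : sideIdem (p + 2) = sideIdem p := by
  fin_cases p <;> rfl

lemma idem_mul_coeff (g h : C.Gens) : TorAlg.idem (C.idem g) * C.coeff g h = C.coeff g h := by
  have h1 : TorAlg.idem (C.idem g) * TorAlg.chord (C.enter g.1) (C.exit g.1) =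
      TorAlg.chord (C.enter g.1) (C.exit g.1) := by
    rw [idem, ← sideIdem_add_two]
    exact TorAlg.idem_mul_chord _ _
  unfold coeff
  rw [mul_add]
  congr 1
  · split_ifs <;> simp [h1]
  · split_ifs with hg
    · have h2 : C.idem g = sideIdem (C.exit h.1) := by rw [idem, hg, exit]
      rw [h2, mul_smul_comm, TorAlg.idem_mul_chord]
    · simp

lemma coeff_mul_coeff (g h k : C.Gens) : C.coeff g h * C.coeff h k = 0 := by
  unfold coeff
  rw [add_mul, mul_add, mul_add]
  have hFF : ∀ s : ZMod C.len, TorAlg.chord (C.enter s) (C.exit s) *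
      TorAlg.chord (C.enter (s + 1)) (C.exit (s + 1)) = 0 := fun s =>
    TorAlg.chord_mul_chord _ _ _
  have hBB : ∀ s : ZMod C.len, TorAlg.chord (C.exit (s + 1)) (C.enter (s + 1)) *
      TorAlg.chord (C.exit s) (C.enter s) = 0 := fun s => by
    have h2 : C.exit s = C.enter (s + 1) + 2 := by
      simp only [exit, enter, add_assoc]
      exact (add_zero _).symm
    rw [h2]
    exact TorAlg.chord_mul_chord _ _ _
  have e1 : ∀ (P Q : Prop) [Decidable P] [Decidable Q] (a b : ZMod 2) (x y : TorAlg),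
      (P → Q → x * y = 0) → (if P then a • x else 0) * (if Q then b • y else 0) = 0 := by
    intro P Q _ _ a b x y hxy
    split_ifs with hP hQ
    · rw [smul_mul_smul_comm, hxy hP hQ, smul_zero]
    all_goals simp
  have t1 := e1 (h.1 = g.1 + 1) (k.1 = h.1 + 1)
  have t2 := e1 (h.1 = g.1 + 1) (h.1 = k.1 + 1)
  have t3 := e1 (g.1 = h.1 + 1) (k.1 = h.1 + 1)
  have t4 := e1 (g.1 = h.1 + 1) (h.1 = k.1 + 1)
  rw [t1, t2, t3, t4]
  · simp
  · intro hP hQ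
    rw [hQ]
    exact hBB _
  · intro _ _
    exact TorAlg.chord_mul_rev _ _
  · intro hP hQ
    have hgk : g.1 = k.1 := add_right_cancel (hP.symm.trans hQ)
    rw [hgk]
    exact TorAlg.chord_mul_rev _ _
  · intro hP _
    rw [hP]
    exact hFF _

end DecoratedCurve

/-- The type D structure of a finite collection of immersed curves with local systems: the direct
sum of the type D structures of the individual decorated curves. -/
noncomputable def curvesTypeD {m : ℕ} (C : Fin m → DecoratedCurve) : TypeD.{0} :=
  TypeD.ofMatrix (G := Σ i, (C i).Gens) (fun g => (C g.1).idem g.2)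
    (Matrix.blockDiagonal' fun i => (C i).coeff)
    (fun g h => by
      obtain ⟨i, g⟩ := g
      obtain ⟨j, h⟩ := h
      by_cases hij : i = j
      · subst hij
        rw [Matrix.blockDiagonal'_apply_eq]
        exact (C i).idem_mul_coeff g h
      · rw [Matrix.blockDiagonal'_apply_ne _ _ _ hij, mul_zero])
    (by
      rw [← Matrix.blockDiagonal'_mul]
      have h : (fun i => (C i).coeff * (C i).coeff) = 0 := by
        funext i
        ext g k
        exact Finset.sum_eq_zero fun h _ => (C i).coeff_mul_coeff g h k
      rw [h]
      exact Matrix.blockDiagonal'_zero)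

/-!
Extendable type D structures over the torus algebra come from immersed curves.

The torus algebra acts faithfully on row vectors indexed by the four sides of the square: the chord
from side `p` to side `q > p` is the matrix unit `(p, q)`. A type D structure on `V` therefore
induces a differential on the space `V_0 ⊕ V_1 ⊕ V_2 ⊕ V_3` of row vectors, where `V_p` is the part
of `V` at the idempotent of side `p`, and this differential respects the filtration by the sides.
The extended torus algebra acts on two copies of the sides, and `U` maps the first copy identically
to the second. Reading `∂² = U` in this representation shows that the complex of row vectors of an
extendable structure is acyclic: the part of the extension that passes the top right corner once is
a contracting homotopy (`ExtTypeD.acyclic_underlying`). Acyclicity survives the cancellation of the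
part of `δ` without arrows (`TypeD.exists_reduced`), after which the differential strictly increases
the filtration.

Such a filtered complex is governed by linear relations between its graded pieces: for `p < q`, the
leading term in degree `p` of a vector is related to the leading term of its boundary in degree `q`.
Acyclicity says exactly that, at each side, the domains and kernels of the relations towards the
other three sides form a complete flag (`FilteredComplex.crossRel_flag`). Since opposite sides carry
the same space, relations can be composed along words in the sides of the square, that is, along
paths in the torus cut open along `α ∪ β`. The rank of the relation of a word is the sum of the
ranks of its one-letter extensions, on either side (`SideSystem.stationaryWeight_wordRank`). As the
ranks are bounded, there are only finitely many bi-infinite words all of whose finite subwords have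
nonzero rank (`StationaryWeight.exists_stable_length`), and these are therefore periodic. Going once around a periodic word gives an automorphism
of its graded piece; it lifts to vectors which are related exactly along the word
(`SideSystem.StableDepth.exists_periodic_lift`). No word is a translate of its reverse, so one can
choose one word from each pair of mutually reverse ones, and the lifted vectors then form a basis of
`V` (`SideSystem.exists_bands`).

Each periodic word is realised by an immersed curve in reduced position (`exists_immersedCurve`).
Lifting the relations along the arcs to chains that are related exactly by the differential gives
elements of `A ⊗ V` on which `∂` acts as on the generators of the type D structure of the curves.
Their leading terms form a basis of `V`, so the resulting map is an isomorphism
(`TypeD.exists_curves`).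
-/

/-! ### Stationary weights on words -/

section StationaryWords

variable {α : Type*}

/-- The window of length `n` at position `s` of a bi-infinite word. -/
def window (d : ℤ → α) : ℤ → ℕ → List α
  | _, 0 => []
  | s, n + 1 => d s :: window d (s + 1) n

lemma window_succ (d : ℤ → α) (s : ℤ) (n : ℕ) :
    window d s (n + 1) = d s :: window d (s + 1) n := rfl

@[simp] lemma length_window (d : ℤ → α) (s : ℤ) (n : ℕ) : (window d s n).length = n := by
  induction n generalizing s with
  | zero => rfl
  | succ n ih => simp [window, ih]

lemma window_add (d : ℤ → α) (s : ℤ) (m n : ℕ) :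
    window d s (m + n) = window d s m ++ window d (s + m) n := by
  induction m generalizing s with
  | zero => simp [window]
  | succ m ih =>
    have h : m + 1 + n = (m + n) + 1 := by ring
    rw [h, window_succ, window_succ, ih, List.cons_append]
    congr 3
    push_cast
    ring

lemma window_succ_last (d : ℤ → α) (s : ℤ) (n : ℕ) :
    window d s (n + 1) = window d s n ++ [d (s + n)] := by
  rw [window_add]
  rfl

lemma window_shift (d : ℤ → α) (c s : ℤ) (n : ℕ) :
    window (fun i => d (i + c)) s n = window d (s + c) n := by
  induction n generalizing s with
  | zero => rfl
  | succ n ih =>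
    rw [window_succ, window_succ, ih]
    congr 2
    ring

/-- The window at position `s` of a word that is reversed and relabelled by `τ`. -/
lemma window_reverse (τ : α → α) (d : ℤ → α) (s : ℤ) (n : ℕ) :
    window (fun i => τ (d (-i))) s n = ((window d (1 - s - n) n).reverse).map τ := by
  induction n generalizing s with
  | zero => rfl
  | succ n ih =>
    have h1 : (1 : ℤ) - (s + 1) - n = 1 - s - (n + 1 : ℕ) := by push_cast; ring
    have h2 : (1 : ℤ) - s - (n + 1 : ℕ) + n = -s := by push_cast; ring
    rw [window_succ, ih, window_succ_last, h1, h2]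
    simp

variable [Fintype α]

/-- A weight on finite words is stationary if the weight of a word is the sum of the weights of its
one-letter extensions, on either side. -/
structure StationaryWeight (f : List α → ℕ) : Prop where
  right : ∀ w, f w = ∑ a, f (w ++ [a])
  left : ∀ w, f w = ∑ a, f (a :: w)

/-- The bi-infinite words all of whose windows have positive weight. -/
def wordSupport (f : List α → ℕ) : Set (ℤ → α) := {d | ∀ s n, 0 < f (window d s n)}

namespace StationaryWeight

variable {f : List α → ℕ} (hf : StationaryWeight f)
include hf

lemma le_cons (a : α) (w : List α) : f (a :: w) ≤ f w := by
  rw [hf.left w]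
  exact Finset.single_le_sum (f := fun a => f (a :: w)) (fun _ _ => Nat.zero_le _)
    (Finset.mem_univ a)

lemma le_snoc (a : α) (w : List α) : f (w ++ [a]) ≤ f w := by
  rw [hf.right w]
  exact Finset.single_le_sum (f := fun a => f (w ++ [a])) (fun _ _ => Nat.zero_le _)
    (Finset.mem_univ a)

lemma le_append_left (u w : List α) : f (u ++ w) ≤ f w := by
  induction u with
  | nil => simp
  | cons a u ih => exact (hf.le_cons a _).trans ih

lemma le_append_right (w u : List α) : f (w ++ u) ≤ f w := by
  induction u using List.reverseRecOn with
  | nil => simp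
  | append_singleton u a ih =>
    rw [← List.append_assoc]
    exact (hf.le_snoc a _).trans ih

lemma exists_cons {w : List α} (hw : 0 < f w) : ∃ a, 0 < f (a :: w) := by
  by_contra! h
  rw [hf.left w, Finset.sum_eq_zero fun a _ => Nat.le_zero.1 (h a)] at hw
  exact absurd hw (lt_irrefl 0)

lemma exists_snoc {w : List α} (hw : 0 < f w) : ∃ a, 0 < f (w ++ [a]) := by
  by_contra! h
  rw [hf.right w, Finset.sum_eq_zero fun a _ => Nat.le_zero.1 (h a)] at hw
  exact absurd hw (lt_irrefl 0)

end StationaryWeight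

variable [DecidableEq α]

variable (α) in
/-- All words of length `n`. -/
def wordsOfLength : ℕ → Finset (List α)
  | 0 => {[]}
  | n + 1 => (Finset.univ ×ˢ wordsOfLength n).image fun p : α × List α => p.1 :: p.2

lemma mem_wordsOfLength {n : ℕ} {w : List α} : w ∈ wordsOfLength α n ↔ w.length = n := by
  induction n generalizing w with
  | zero => simp [wordsOfLength]
  | succ n ih =>
    cases w with
    | nil => simp [wordsOfLength]
    | cons a w => simp [wordsOfLength, ih]

lemma sum_wordsOfLength_succ (g : List α → ℕ) (n : ℕ) :
    ∑ w ∈ wordsOfLength α (n + 1), g w = ∑ w ∈ wordsOfLength α n, ∑ a, g (a :: w) := by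
  rw [wordsOfLength, Finset.sum_image, Finset.sum_product_right]
  rintro ⟨a, w⟩ _ ⟨b, w'⟩ _ h
  simpa using h

/-- The words of length `n` with positive weight. -/
def positiveWords (f : List α → ℕ) (n : ℕ) : Finset (List α) :=
  (wordsOfLength α n).filter fun w => 0 < f w

lemma mem_positiveWords {f : List α → ℕ} {n : ℕ} {w : List α} :
    w ∈ positiveWords f n ↔ w.length = n ∧ 0 < f w := by
  simp [positiveWords, mem_wordsOfLength]

namespace StationaryWeight

variable {f : List α → ℕ} (hf : StationaryWeight f)
include hf

lemma sum_words (n : ℕ) : ∑ w ∈ wordsOfLength α n, f w = f [] := by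
  induction n with
  | zero => simp [wordsOfLength]
  | succ n ih =>
    rw [sum_wordsOfLength_succ, ← ih]
    exact Finset.sum_congr rfl fun w _ => (hf.left w).symm

lemma card_positiveWords_le (n : ℕ) : (positiveWords f n).card ≤ f [] := by
  rw [← hf.sum_words n, Finset.card_eq_sum_ones, positiveWords, Finset.sum_filter]
  refine Finset.sum_le_sum fun w _ => ?_
  split_ifs with h
  · exact h
  · exact Nat.zero_le _

lemma surjOn_tail (n : ℕ) : ∀ w ∈ positiveWords f n, ∃ v, ∃ (_ : v ∈ positiveWords f (n + 1)),
    v.tail = w := by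
  intro w hw
  rw [mem_positiveWords] at hw
  obtain ⟨a, ha⟩ := hf.exists_cons hw.2
  exact ⟨a :: w, mem_positiveWords.2 ⟨by simp [hw.1], ha⟩, rfl⟩

lemma surjOn_dropLast (n : ℕ) : ∀ w ∈ positiveWords f n, ∃ v, ∃ (_ : v ∈ positiveWords f (n + 1)),
    v.dropLast = w := by
  intro w hw
  rw [mem_positiveWords] at hw
  obtain ⟨a, ha⟩ := hf.exists_snoc hw.2
  exact ⟨w ++ [a], mem_positiveWords.2 ⟨by simp [hw.1], ha⟩, by simp⟩

lemma card_mono : Monotone fun n => (positiveWords f n).card := by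
  refine monotone_nat_of_le_succ fun n => ?_
  refine Finset.card_le_card_of_surjOn List.tail fun w hw => ?_
  obtain ⟨v, hv, h⟩ := hf.surjOn_tail n w hw
  exact ⟨v, hv, h⟩

/-- The number of words of length `n` with positive weight is bounded and nondecreasing, hence
eventually constant. From then on words of positive weight extend uniquely on both sides. -/
lemma exists_unique_extension : ∃ N, 0 < N ∧ ∀ w : List α, N ≤ w.length →
    (∀ a b, 0 < f (a :: w) → 0 < f (b :: w) → a = b) ∧
    (∀ a b, 0 < f (w ++ [a]) → 0 < f (w ++ [b]) → a = b) := by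
  obtain ⟨N, hN⟩ : ∃ N, ∀ n, N ≤ n → (positiveWords f N).card = (positiveWords f n).card := by
    have hbdd : BddAbove (Set.range fun n => (positiveWords f n).card) :=
      ⟨f [], by rintro _ ⟨n, rfl⟩; exact hf.card_positiveWords_le n⟩
    obtain ⟨N, hN⟩ := Nat.sSup_mem (Set.range_nonempty _) hbdd
    refine ⟨N, fun n hn => le_antisymm (hf.card_mono hn) ?_⟩
    exact (le_csSup hbdd ⟨n, rfl⟩).trans_eq hN.symm
  refine ⟨N + 1, Nat.succ_pos _, fun w hw => ?_⟩
  have hc : (positiveWords f (w.length + 1)).card ≤ (positiveWords f w.length).card := by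
    rw [← hN w.length (by omega), ← hN (w.length + 1) (by omega)]
  constructor
  · intro a b ha hb
    have hmem : ∀ a, 0 < f (a :: w) → a :: w ∈ positiveWords f (w.length + 1) := fun a ha =>
      mem_positiveWords.2 ⟨by simp, ha⟩
    have h := Finset.inj_on_of_surj_on_of_card_le (s := positiveWords f (w.length + 1))
      (t := positiveWords f w.length) (fun v _ => v.tail)
      (fun v hv => by
        rw [mem_positiveWords] at hv ⊢
        refine ⟨by simp [hv.1], ?_⟩
        cases v with
        | nil => simp at hv
        | cons c v => exact hv.2.trans_le (hf.le_cons c v))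
      (hf.surjOn_tail _) hc (hmem a ha) (hmem b hb) rfl
    simpa using h
  · intro a b ha hb
    have hmem : ∀ a, 0 < f (w ++ [a]) → w ++ [a] ∈ positiveWords f (w.length + 1) := fun a ha =>
      mem_positiveWords.2 ⟨by simp, ha⟩
    have h := Finset.inj_on_of_surj_on_of_card_le (s := positiveWords f (w.length + 1))
      (t := positiveWords f w.length) (fun v _ => v.dropLast)
      (fun v hv => by
        rw [mem_positiveWords] at hv ⊢
        refine ⟨by simp [hv.1], ?_⟩
        induction v using List.reverseRecOn with
        | nil => simp at hv
        | append_singleton v c _ =>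
          rw [List.dropLast_concat]
          exact hv.2.trans_le (hf.le_snoc c v))
      (hf.surjOn_dropLast _) hc (hmem a ha) (hmem b hb) (by simp)
    simpa using h

/-- Words of positive weight and sufficient length extend uniquely to bi-infinite words of positive
weight: appending a letter and dropping the first one permutes the finitely many words of a given
large length, and iterating this permutation gives the bi-infinite word. -/
theorem exists_stable_length : ∃ N, 0 < N ∧
    (∀ d ∈ wordSupport f, ∀ s n, N ≤ n → f (window d s n) = f (window d 0 N)) ∧
    (∀ w : List α, w.length = N → 0 < f w → ∃ d ∈ wordSupport f, window d 0 N = w) ∧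
    (∀ d ∈ wordSupport f, ∀ d' ∈ wordSupport f, window d 0 N = window d' 0 N → d = d') := by
  obtain ⟨N, hN0, hN⟩ := hf.exists_unique_extension
  have hleft : ∀ d ∈ wordSupport f, ∀ s n, N ≤ n →
      f (window d (s + 1) n) = f (window d s (n + 1)) := by
    intro d hd s n hn
    rw [hf.left, window_succ]
    refine Finset.sum_eq_single (d s) (fun b _ hb => ?_) (by simp)
    by_contra hb0
    refine hb (((hN _ (by simpa using hn)).1 b (d s) (Nat.pos_of_ne_zero hb0) ?_))
    exact hd s (n + 1)
  have hright : ∀ d ∈ wordSupport f, ∀ s n, N ≤ n →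
      f (window d s n) = f (window d s (n + 1)) := by
    intro d hd s n hn
    rw [hf.right, window_succ_last]
    refine Finset.sum_eq_single (d (s + n)) (fun b _ hb => ?_) (by simp)
    by_contra hb0
    refine hb (((hN _ (by simpa using hn)).2 b _ (Nat.pos_of_ne_zero hb0) ?_))
    rw [← window_succ_last]
    exact hd s (n + 1)
  have hshift : ∀ d ∈ wordSupport f, ∀ s, f (window d s N) = f (window d 0 N) := by
    intro d hd s
    have h1 : ∀ s, f (window d (s + 1) N) = f (window d s N) := fun s => by
      rw [hleft d hd s N le_rfl, ← hright d hd s N le_rfl]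
    induction s using Int.induction_on with
    | zero => rfl
    | succ i ih => rw [h1, ih]
    | pred i ih => rw [← ih, ← h1]; congr 2; ring
  -- The successor of a positive word of length `N`.
  let Ω := {w : List α // w ∈ positiveWords f N}
  have hnx : ∀ w : Ω, ∃ a, 0 < f (w.1 ++ [a]) := fun w =>
    hf.exists_snoc (mem_positiveWords.1 w.2).2
  choose nx hnx using hnx
  have hlen : ∀ w : Ω, w.1.length = N := fun w => (mem_positiveWords.1 w.2).1
  have hne : ∀ w : Ω, w.1 ≠ [] := fun w h => by have := hlen w; simp [h] at this; omega
  have hcons : ∀ w : Ω, w.1 = w.1.head (hne w) :: w.1.tail := fun w =>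
    (List.cons_head_tail (hne w)).symm
  have hpos' : ∀ w : Ω, 0 < f (w.1.tail ++ [nx w]) := fun w => by
    have h := hnx w
    rw [hcons w, List.cons_append] at h
    exact h.trans_le (hf.le_cons _ _)
  let next : Ω → Ω := fun w => ⟨w.1.tail ++ [nx w], mem_positiveWords.2
    ⟨by have := hlen w; simp [this]; omega, hpos' w⟩⟩
  have hnext_inj : Function.Injective next := by
    intro w w' h
    have h1 : w.1.tail ++ [nx w] = w'.1.tail ++ [nx w'] := congrArg Subtype.val h
    have h2 := hnx w
    have h3 := hnx w'
    rw [hcons w, List.cons_append] at h2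
    rw [hcons w', List.cons_append, ← h1] at h3
    have h4 := (hN (w.1.tail ++ [nx w]) (by have := hlen w; simp [this]; omega)).1 _ _ h2 h3
    refine Subtype.ext ?_
    rw [hcons w, hcons w', h4]
    congr 1
    exact (List.append_inj' h1 rfl).1
  let σ : Equiv.Perm Ω := Equiv.ofBijective next (Finite.injective_iff_bijective.1 hnext_inj)
  have hσ : ∀ w, (σ w).1 = w.1.tail ++ [nx w] := fun w => rfl
  let word : Ω → ℤ → α := fun w s => ((σ ^ s) w).1.head (hne _)
  have hσs : ∀ (s : ℤ) (w : Ω), (σ ^ (s + 1)) w = σ ((σ ^ s) w) := fun s w => by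
    rw [add_comm, zpow_add, zpow_one, Equiv.Perm.mul_apply]
  have hwin : ∀ (w : Ω) (n : ℕ) (s : ℤ), n ≤ N →
      window (word w) s n = ((σ ^ s) w).1.take n := by
    intro w n
    induction n with
    | zero => simp [window]
    | succ n ih =>
      intro s hn
      rw [window_succ, ih (s + 1) (by omega), hσs, hσ]
      conv_rhs => rw [hcons ((σ ^ s) w)]
      rw [List.take_succ_cons, List.take_append_of_le_length]
      have := hlen ((σ ^ s) w)
      simp [this]
      omega
  have hwinN : ∀ (w : Ω) (s : ℤ), window (word w) s N = ((σ ^ s) w).1 := fun w s => by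
    rw [hwin w N s le_rfl, List.take_of_length_le (hlen _).le]
  have hlast : ∀ (w : Ω) (s : ℤ), word w (s + N) = nx ((σ ^ s) w) := by
    intro w s
    have h1 := window_succ (word w) s N
    rw [window_succ_last, hwinN, hwinN, hσs, hσ] at h1
    conv_lhs at h1 => rw [hcons ((σ ^ s) w), List.cons_append]
    have h2 := (List.cons_eq_cons.1 h1).2
    simpa using h2
  have hmem : ∀ w : Ω, word w ∈ wordSupport f := by
    intro w s n
    have key : ∀ j, 0 < f (window (word w) s (N + j)) := by
      intro j
      induction j with
      | zero =>
        rw [add_zero, hwinN]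
        exact (mem_positiveWords.1 ((σ ^ s) w).2).2
      | succ j ih =>
        obtain ⟨a, ha⟩ := hf.exists_snoc ih
        have hja : 0 < f (window (word w) (s + j) N ++ [a]) := by
          rw [add_comm N j, window_add, List.append_assoc] at ha
          exact ha.trans_le (hf.le_append_left _ _)
        have haa : a = word w (s + (N + j : ℕ)) := by
          have h3 := hlast w (s + j)
          have h4 : s + (N + j : ℕ) = s + j + N := by push_cast; ring
          rw [h4, h3]
          refine (hN _ (by simp)).2 _ _ hja ?_
          rw [hwinN]
          exact hnx _
        rw [← add_assoc, window_succ_last, ← haa]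
        exact ha
    have h := key n
    rw [add_comm, window_add] at h
    exact h.trans_le (hf.le_append_right _ _)
  refine ⟨N, hN0, ?_, ?_, ?_⟩
  · intro d hd s n hn
    obtain ⟨j, rfl⟩ := Nat.exists_eq_add_of_le hn
    rw [← hshift d hd s]
    clear hn
    induction j with
    | zero => rfl
    | succ j ih => rw [← ih, ← add_assoc, ← hright d hd s _ (by omega)]
  · intro w hw hfw
    refine ⟨word ⟨w, mem_positiveWords.2 ⟨hw, hfw⟩⟩, hmem _, ?_⟩
    rw [hwinN]
    rfl
  · have hd_eq : ∀ d (hd : d ∈ wordSupport f),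
        d = word ⟨window d 0 N, mem_positiveWords.2 ⟨by simp, hd 0 N⟩⟩ := by
      intro d hd
      have hpow : ∀ s : ℤ, ((σ ^ s) ⟨window d 0 N, mem_positiveWords.2 ⟨by simp, hd 0 N⟩⟩ : Ω) =
          ⟨window d s N, mem_positiveWords.2 ⟨by simp, hd s N⟩⟩ := by
        have hone : ∀ s : ℤ, σ ⟨window d s N, mem_positiveWords.2 ⟨by simp, hd s N⟩⟩ =
            ⟨window d (s + 1) N, mem_positiveWords.2 ⟨by simp, hd (s + 1) N⟩⟩ := by
          intro s
          refine Subtype.ext ?_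
          rw [hσ]
          have h1 : nx ⟨window d s N, mem_positiveWords.2 ⟨by simp, hd s N⟩⟩ = d (s + N) := by
            refine (hN (window d s N) (by simp)).2 _ _
              (hnx ⟨window d s N, mem_positiveWords.2 ⟨by simp, hd s N⟩⟩) ?_
            rw [← window_succ_last]
            exact hd s _
          simp only [h1]
          obtain ⟨M, rfl⟩ : ∃ M, N = M + 1 := ⟨N - 1, by omega⟩
          rw [window_succ, List.tail_cons, window_succ_last]
          congr 3
          push_cast
          ring
        intro s
        induction s using Int.induction_on with
        | zero => simp
        | succ i ih => rw [hσs, ih, hone]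
        | pred i ih =>
          apply σ.injective
          rw [hone, ← hσs, show (-(i : ℤ) - 1 + 1) = -i by ring, ih]
      funext s
      obtain ⟨M, rfl⟩ : ∃ M, N = M + 1 := ⟨N - 1, by omega⟩
      simp only [word, hpow]
      rfl
    intro d hd d' hd' h
    rw [hd_eq d hd, hd_eq d' hd']
    simp only [h]

end StationaryWeight

end StationaryWords

/-! ### Linear relations -/

section LinearRelations

variable {k V : Type*} [Field k] [AddCommGroup V] [Module k V]

/-- The composite of linear relations, the first one being applied first. -/
def relComp (R S : Submodule k (V × V)) : Submodule k (V × V) where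
  carrier := {z | ∃ y, (z.1, y) ∈ R ∧ (y, z.2) ∈ S}
  zero_mem' := ⟨0, R.zero_mem, S.zero_mem⟩
  add_mem' := by
    rintro a b ⟨y, h1, h2⟩ ⟨y', h1', h2'⟩
    exact ⟨y + y', R.add_mem h1 h1', S.add_mem h2 h2'⟩
  smul_mem' := by
    rintro c a ⟨y, h1, h2⟩
    exact ⟨c • y, R.smul_mem c h1, S.smul_mem c h2⟩

/-- The converse of a linear relation. -/
def relInv (R : Submodule k (V × V)) : Submodule k (V × V) :=
  R.comap (LinearEquiv.prodComm k V V).toLinearMap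

/-- The preimage of a subspace under a linear relation. -/
def relPre (R : Submodule k (V × V)) (Y : Submodule k V) : Submodule k V where
  carrier := {x | ∃ y ∈ Y, (x, y) ∈ R}
  zero_mem' := ⟨0, Y.zero_mem, R.zero_mem⟩
  add_mem' := by
    rintro a b ⟨y, h1, h2⟩ ⟨y', h1', h2'⟩
    exact ⟨y + y', Y.add_mem h1 h1', R.add_mem h2 h2'⟩
  smul_mem' := by
    rintro c a ⟨y, h1, h2⟩
    exact ⟨c • y, Y.smul_mem c h1, R.smul_mem c h2⟩

/-- The domain of a linear relation. -/
def relDom (R : Submodule k (V × V)) : Submodule k V := relPre R ⊤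

/-- The kernel of a linear relation. -/
def relKer (R : Submodule k (V × V)) : Submodule k V := relPre R ⊥

/-- The identity relation of a subspace. -/
def relDiag (E : Submodule k V) : Submodule k (V × V) where
  carrier := {z | z.1 = z.2 ∧ z.1 ∈ E}
  zero_mem' := ⟨rfl, E.zero_mem⟩
  add_mem' := by
    rintro a b ⟨h1, h2⟩ ⟨h1', h2'⟩
    exact ⟨by simp [h1, h1'], E.add_mem h2 h2'⟩
  smul_mem' := by
    rintro c a ⟨h1, h2⟩
    exact ⟨by simp [h1], E.smul_mem c h2⟩

/-- The rank of a linear relation, that is, of the isomorphism which it induces between a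
subquotient of the source and a subquotient of the target. -/
noncomputable def relRank (R : Submodule k (V × V)) : ℕ :=
  Module.finrank k (relDom R) - Module.finrank k (relKer R)

variable {R S T : Submodule k (V × V)} {x y z : V}

lemma mem_relComp : (x, z) ∈ relComp R S ↔ ∃ y, (x, y) ∈ R ∧ (y, z) ∈ S := Iff.rfl

lemma mem_relInv : (x, y) ∈ relInv R ↔ (y, x) ∈ R := Iff.rfl

lemma mem_relPre {Y : Submodule k V} : x ∈ relPre R Y ↔ ∃ y ∈ Y, (x, y) ∈ R := Iff.rfl

lemma mem_relDom : x ∈ relDom R ↔ ∃ y, (x, y) ∈ R := by simp [relDom, mem_relPre]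

lemma mem_relKer : x ∈ relKer R ↔ (x, 0) ∈ R := by simp [relKer, mem_relPre]

lemma mem_relDiag {E : Submodule k V} : (x, y) ∈ relDiag E ↔ x = y ∧ x ∈ E := Iff.rfl

lemma relKer_le_relDom (R : Submodule k (V × V)) : relKer R ≤ relDom R :=
  fun _ ⟨y, _, h⟩ => ⟨y, trivial, h⟩

lemma relComp_assoc (R S T : Submodule k (V × V)) :
    relComp (relComp R S) T = relComp R (relComp S T) := by
  ext ⟨x, z⟩
  simp only [mem_relComp]
  constructor
  · rintro ⟨y, ⟨w, h1, h2⟩, h3⟩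
    exact ⟨w, h1, y, h2, h3⟩
  · rintro ⟨w, h1, y, h2, h3⟩
    exact ⟨y, ⟨w, h1, h2⟩, h3⟩

lemma relInv_relComp (R S : Submodule k (V × V)) :
    relInv (relComp R S) = relComp (relInv S) (relInv R) := by
  ext ⟨x, z⟩
  simp only [mem_relInv, mem_relComp]
  exact exists_congr fun y => and_comm

lemma relInv_relInv (R : Submodule k (V × V)) : relInv (relInv R) = R := rfl

lemma relInv_relDiag (E : Submodule k V) : relInv (relDiag E) = relDiag E := by
  ext ⟨x, y⟩
  simp only [mem_relInv, mem_relDiag]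
  constructor <;> rintro ⟨rfl, h⟩ <;> exact ⟨rfl, h⟩

lemma relDom_relComp (R S : Submodule k (V × V)) : relDom (relComp R S) = relPre R (relDom S) := by
  ext x
  simp only [mem_relDom, mem_relComp, mem_relPre]
  constructor
  · rintro ⟨z, y, h1, h2⟩
    exact ⟨y, ⟨z, h2⟩, h1⟩
  · rintro ⟨y, ⟨z, h2⟩, h1⟩
    exact ⟨z, y, h1, h2⟩

lemma relKer_relComp (R S : Submodule k (V × V)) : relKer (relComp R S) = relPre R (relKer S) := by
  ext x
  simp only [mem_relKer, mem_relComp, mem_relPre]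
  exact exists_congr fun y => and_comm

lemma relPre_mono (R : Submodule k (V × V)) {Y Z : Submodule k V} (h : Y ≤ Z) :
    relPre R Y ≤ relPre R Z := fun _ ⟨y, hy, hxy⟩ => ⟨y, h hy, hxy⟩

lemma relPre_eq_relDom {E : Submodule k V} (h : relDom (relInv R) ≤ E) :
    relPre R E = relDom R := by
  ext x
  rw [mem_relPre, mem_relDom]
  exact ⟨fun ⟨y, _, hy⟩ => ⟨y, hy⟩, fun ⟨y, hy⟩ => ⟨y, h (mem_relDom.2 ⟨x, hy⟩), hy⟩⟩

lemma relRank_relDiag (E : Submodule k V) : relRank (relDiag E) = Module.finrank k E := by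
  have h1 : relDom (relDiag E) = E := by
    ext x
    simp [mem_relDom, mem_relDiag]
  have h2 : relKer (relDiag E) = ⊥ := by
    ext x
    rw [mem_relKer, mem_relDiag, Submodule.mem_bot]
    constructor
    · exact fun h => h.1
    · rintro rfl
      exact ⟨rfl, E.zero_mem⟩
  rw [relRank, h1, h2]
  simp

lemma relRank_bot : relRank (⊥ : Submodule k (V × V)) = 0 := by
  have h1 : relDom (⊥ : Submodule k (V × V)) = ⊥ := by
    ext x
    simp only [mem_relDom, Submodule.mem_bot]
    constructor
    · rintro ⟨y, h⟩
      exact congrArg Prod.fst h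
    · rintro rfl
      exact ⟨0, rfl⟩
  rw [relRank, h1]
  simp

variable [FiniteDimensional k V]

lemma finrank_relDom_add (R : Submodule k (V × V)) :
    Module.finrank k (relDom R) + Module.finrank k (relKer (relInv R)) = Module.finrank k R := by
  let p : R →ₗ[k] V := (LinearMap.fst k V V).comp R.subtype
  have h := LinearMap.finrank_range_add_finrank_ker p
  have h1 : LinearMap.range p = relDom R := by
    ext x
    rw [mem_relDom, LinearMap.mem_range]
    constructor
    · rintro ⟨⟨⟨a, b⟩, hab⟩, rfl⟩
      exact ⟨b, hab⟩
    · rintro ⟨b, hab⟩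
      exact ⟨⟨⟨x, b⟩, hab⟩, rfl⟩
  have h2 : Module.finrank k (LinearMap.ker p) = Module.finrank k (relKer (relInv R)) := by
    let q : LinearMap.ker p →ₗ[k] V :=
      (LinearMap.snd k V V).comp (R.subtype.comp (LinearMap.ker p).subtype)
    have hq : Function.Injective q := by
      rintro ⟨⟨⟨a, b⟩, hab⟩, ha⟩ ⟨⟨⟨a', b'⟩, hab'⟩, ha'⟩ h
      have e1 : a = 0 := ha
      have e2 : a' = 0 := ha'
      have e3 : b = b' := h
      subst e1 e2 e3
      rfl
    have hr : LinearMap.range q = relKer (relInv R) := by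
      ext y
      rw [mem_relKer, mem_relInv, LinearMap.mem_range]
      constructor
      · rintro ⟨⟨⟨⟨a, b⟩, hab⟩, ha⟩, rfl⟩
        have e1 : a = 0 := ha
        subst e1
        exact hab
      · intro hy
        exact ⟨⟨⟨⟨0, y⟩, hy⟩, rfl⟩, rfl⟩
    rw [← hr, LinearMap.finrank_range_of_inj hq]
  rw [h1, h2] at h
  exact h

lemma relRank_relInv (R : Submodule k (V × V)) : relRank (relInv R) = relRank R := by
  have h1 := finrank_relDom_add R
  have h2 := finrank_relDom_add (relInv R)
  have h3 : Module.finrank k (relInv R) = Module.finrank k R :=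
    LinearEquiv.finrank_eq (LinearEquiv.ofSubmodule' (LinearEquiv.prodComm k V V) R)
  have h4 : relInv (relInv R) = R := rfl
  rw [h4, h3] at h2
  have h5 := Submodule.finrank_mono (relKer_le_relDom R)
  have h6 := Submodule.finrank_mono (relKer_le_relDom (relInv R))
  unfold relRank
  omega

/-- A composite of the same rank as the second factor meets the same graded piece: see
`relDom_le_of_relRank_eq`. -/
lemma relPre_eq_of_relRank_eq (h : relRank (relComp R S) = relRank R) :
    relPre R (relKer S) = relKer R ∧ relPre R (relDom S) = relDom R := by
  have h1 : relKer R ≤ relPre R (relKer S) := relPre_mono R bot_le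
  have h2 : relPre R (relDom S) ≤ relDom R := relPre_mono R le_top
  have h3 : relPre R (relKer S) ≤ relPre R (relDom S) := relPre_mono R (relKer_le_relDom S)
  have e1 := Submodule.finrank_mono h1
  have e2 := Submodule.finrank_mono h2
  have e3 := Submodule.finrank_mono h3
  unfold relRank at h
  rw [relDom_relComp, relKer_relComp] at h
  constructor
  · exact (Submodule.eq_of_le_of_finrank_le h1 (by omega)).symm
  · exact Submodule.eq_of_le_of_finrank_le h2 (by omega)

end LinearRelations

/-! ### Systems of relations between the sides of the square -/

/-- The linear algebra underlying an extendable type D structure: a subspace `E p` for each side of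
the square, equal for opposite sides, and for each pair `p ≠ q + 2` a relation `S p q` between the
generators at the crossings where a curve leaves a square through `p` and the generators at the
crossings where it leaves the next square through `q` (having entered that square through `p + 2`).
For a given `p` the domains and kernels of these relations form a complete flag of `E p`, in the
order `q = p + 1, p, p + 3`. -/
structure SideSystem (k V : Type*) [Field k] [AddCommGroup V] [Module k V] where
  E : Fin 4 → Submodule k V
  S : Fin 4 → Fin 4 → Submodule k (V × V)
  E_add_two : ∀ p, E (p + 2) = E p
  inv_S : ∀ p q, relInv (S p q) = S (q + 2) (p + 2)
  S_opposite : ∀ p, S p (p + 2) = ⊥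
  ker_first : ∀ p, relKer (S p (p + 1)) = ⊥
  ker_second : ∀ p, relKer (S p p) = relDom (S p (p + 1))
  ker_third : ∀ p, relKer (S p (p + 3)) = relDom (S p p)
  dom_third : ∀ p, relDom (S p (p + 3)) = E p

namespace SideSystem

variable {k V : Type*} [Field k] [AddCommGroup V] [Module k V] (X : SideSystem k V)

lemma side_cases : ∀ p q : Fin 4, q = p + 1 ∨ q = p ∨ q = p + 3 ∨ q = p + 2 := by
  decide

lemma dom_le (p q : Fin 4) : relDom (X.S p q) ≤ X.E p := by
  have h3 := (X.dom_third p).le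
  have h2 := (X.ker_third p).symm.le.trans ((relKer_le_relDom _).trans h3)
  have h1 := (X.ker_second p).symm.le.trans ((relKer_le_relDom _).trans h2)
  obtain rfl | rfl | rfl | rfl := side_cases p q
  · exact h1
  · exact h2
  · exact h3
  · rw [S_opposite]
    rintro x ⟨y, _, h⟩
    have hx : x = 0 := congrArg Prod.fst h
    rw [hx]
    exact zero_mem _

lemma add_two_add_two (p : Fin 4) : p + 2 + 2 = p := by
  revert p; decide

lemma ran_le (p q : Fin 4) : relDom (relInv (X.S p q)) ≤ X.E q := by
  rw [X.inv_S, ← X.E_add_two q]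
  exact X.dom_le _ _

/-- The relation of a word: the composite of the relations of its consecutive letters. -/
def rel : List (Fin 4) → Submodule k (V × V)
  | [] => ⊥
  | [p] => relDiag (X.E p)
  | p :: q :: l => relComp (X.S p q) (rel (q :: l))

lemma relComp_diag {R : Submodule k (V × V)} {E : Submodule k V} (h : relDom (relInv R) ≤ E) :
    relComp R (relDiag E) = R := by
  ext ⟨x, z⟩
  simp only [mem_relComp, mem_relDiag]
  constructor
  · rintro ⟨y, h1, rfl, _⟩
    exact h1
  · intro h1
    exact ⟨z, h1, rfl, h (mem_relDom.2 ⟨x, h1⟩)⟩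

lemma diag_relComp {R : Submodule k (V × V)} {E : Submodule k V} (h : relDom R ≤ E) :
    relComp (relDiag E) R = R := by
  ext ⟨x, z⟩
  simp only [mem_relComp, mem_relDiag]
  constructor
  · rintro ⟨y, ⟨rfl, _⟩, h1⟩
    exact h1
  · intro h1
    exact ⟨x, ⟨rfl, h (mem_relDom.2 ⟨z, h1⟩)⟩, h1⟩

lemma rel_pair (p q : Fin 4) : X.rel [p, q] = X.S p q := relComp_diag (X.ran_le p q)

lemma dom_rel_le (p : Fin 4) (l : List (Fin 4)) : relDom (X.rel (p :: l)) ≤ X.E p := by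
  cases l with
  | nil =>
    intro x hx
    obtain ⟨y, hy⟩ := mem_relDom.1 hx
    exact hy.2
  | cons q l =>
    rw [rel, relDom_relComp]
    exact (relPre_mono _ le_top).trans (X.dom_le p q)

lemma rel_append (l : List (Fin 4)) (p : Fin 4) (l' : List (Fin 4)) :
    X.rel (l ++ p :: l') = relComp (X.rel (l ++ [p])) (X.rel (p :: l')) := by
  induction l with
  | nil => exact (diag_relComp (X.dom_rel_le p l')).symm
  | cons q l ih =>
    cases l with
    | nil =>
      change relComp (X.S q p) (X.rel (p :: l')) = relComp (X.rel [q, p]) _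
      rw [X.rel_pair]
    | cons r l =>
      change relComp (X.S q r) (X.rel (r :: l ++ p :: l')) =
        relComp (relComp (X.S q r) (X.rel (r :: l ++ [p]))) _
      rw [ih, relComp_assoc]

/-- The reverse of a word: the same path traversed backwards. -/
def revWord (w : List (Fin 4)) : List (Fin 4) := w.reverse.map (· + 2)

lemma rel_revWord (w : List (Fin 4)) : X.rel (revWord w) = relInv (X.rel w) := by
  induction w with
  | nil =>
    change (⊥ : Submodule k (V × V)) = relInv ⊥
    ext ⟨x, y⟩
    rw [mem_relInv, Submodule.mem_bot, Submodule.mem_bot, Prod.mk_eq_zero, Prod.mk_eq_zero,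
      and_comm]
  | cons p l ih =>
    cases l with
    | nil =>
      change relDiag (X.E (p + 2)) = relInv (relDiag (X.E p))
      rw [relInv_relDiag, X.E_add_two]
    | cons q l =>
      have h : revWord (p :: q :: l) = (l.reverse.map (· + 2)) ++ (q + 2) :: [p + 2] := by
        simp [revWord]
      have h' : (l.reverse.map (· + 2)) ++ [q + 2] = revWord (q :: l) := by simp [revWord]
      rw [h, X.rel_append, h', ih, X.rel_pair, ← X.inv_S, rel, relInv_relComp]

lemma ran_rel_le (l : List (Fin 4)) (p : Fin 4) :
    relDom (relInv (X.rel (l ++ [p]))) ≤ X.E p := by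
  rw [← X.rel_revWord, ← X.E_add_two p]
  have h : revWord (l ++ [p]) = (p + 2) :: revWord l := by simp [revWord]
  rw [h]
  exact X.dom_rel_le _ _

/-- The rank of a word. For the empty word it is the sum of the ranks of the one-letter words. -/
noncomputable def wordRank : List (Fin 4) → ℕ
  | [] => ∑ p, Module.finrank k (X.E p)
  | p :: l => relRank (X.rel (p :: l))

lemma wordRank_of_ne_nil {w : List (Fin 4)} (h : w ≠ []) : X.wordRank w = relRank (X.rel w) := by
  cases w with
  | nil => exact absurd rfl h
  | cons p l => rfl

lemma sum_fin_four_shift (g : Fin 4 → ℕ) (p : Fin 4) :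
    ∑ q, g q = g (p + 1) + g p + g (p + 3) + g (p + 2) := by
  rw [Fin.sum_univ_four]
  fin_cases p <;> simp <;> ring

variable [FiniteDimensional k V]

lemma wordRank_revWord (w : List (Fin 4)) : X.wordRank (revWord w) = X.wordRank w := by
  by_cases h : w = []
  · rw [h]; rfl
  · rw [X.wordRank_of_ne_nil h, X.wordRank_of_ne_nil (by simpa [revWord] using h), X.rel_revWord,
      relRank_relInv]

lemma wordRank_right (w : List (Fin 4)) : X.wordRank w = ∑ q, X.wordRank (w ++ [q]) := by
  induction w using List.reverseRecOn with
  | nil =>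
    refine Finset.sum_congr rfl fun q _ => ?_
    exact (relRank_relDiag _).symm
  | append_singleton l p _ =>
    have h : ∀ q, X.wordRank (l ++ [p] ++ [q]) = relRank (relComp (X.rel (l ++ [p])) (X.S p q)) := by
      intro q
      rw [X.wordRank_of_ne_nil (by simp), List.append_assoc, List.singleton_append, X.rel_append,
        X.rel_pair]
    rw [X.wordRank_of_ne_nil (by simp), sum_fin_four_shift _ p, h, h, h, h]
    set R := X.rel (l ++ [p]) with hR
    have h0 : relRank (relComp R (X.S p (p + 2))) = 0 := by
      rw [X.S_opposite, relRank, relDom_relComp, relKer_relComp]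
      have h1 : relDom (⊥ : Submodule k (V × V)) = relKer ⊥ := by
        refine le_antisymm ?_ (relKer_le_relDom _)
        rintro x ⟨y, _, hxy⟩
        have hx : x = 0 := congrArg Prod.fst hxy
        rw [hx]
        exact zero_mem _
      rw [h1, Nat.sub_self]
    have hdom : relPre R (X.E p) = relDom R := relPre_eq_relDom (X.ran_rel_le l p)
    have a1 := Submodule.finrank_mono (relPre_mono R (relKer_le_relDom (X.S p (p + 1))))
    have a2 := Submodule.finrank_mono (relPre_mono R (relKer_le_relDom (X.S p p)))
    have a3 := Submodule.finrank_mono (relPre_mono R (relKer_le_relDom (X.S p (p + 3))))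
    rw [h0]
    unfold relRank
    rw [relDom_relComp, relDom_relComp, relDom_relComp, relKer_relComp, relKer_relComp,
      relKer_relComp]
    rw [X.ker_first, X.ker_second, X.ker_third, X.dom_third, hdom] at *
    change _ = Module.finrank k _ - Module.finrank k (relKer R) + _ + _ + _
    have a1' : Module.finrank k (relKer R) ≤ _ := a1
    omega

/-- Ranks of words are additive: the flags at the end of a word refine its graded piece. -/
lemma stationaryWeight_wordRank : StationaryWeight X.wordRank where
  right := X.wordRank_right
  left w := by
    rw [← X.wordRank_revWord, X.wordRank_right, ← Equiv.sum_comp (Equiv.addRight (2 : Fin 4))]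
    refine Finset.sum_congr rfl fun q _ => ?_
    rw [← X.wordRank_revWord (q :: w)]
    simp [revWord]

end SideSystem

/-! ### Lifting the local system of a periodic word -/

section Chains

/-- Dependent choice of a sequence. -/
lemma exists_seq_of_step {V : Type*} (P : ℕ → V → Prop) (R : ℕ → V → V → Prop)
    (h : ∀ n x, P n x → ∃ y, P (n + 1) y ∧ R n x y) {x₀ : V} (h₀ : P 0 x₀) :
    ∃ x : ℕ → V, x 0 = x₀ ∧ ∀ n, P n (x n) ∧ R n (x n) (x (n + 1)) := by
  choose! g hg using h
  let x : ℕ → V := fun n => Nat.rec x₀ (fun n y => g n y) n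
  have hP : ∀ n, P n (x n) := by
    intro n
    induction n with
    | zero => exact h₀
    | succ n ih => exact (hg n _ ih).1
  exact ⟨x, rfl, fun n => ⟨hP n, (hg n _ (hP n)).2⟩⟩

variable {k V : Type*} [Field k] [AddCommGroup V] [Module k V] [FiniteDimensional k V]

/-- A family in `P` of the right size which is independent modulo `Q` spans `P` modulo `Q`. -/
lemma le_span_sup_of_independent {n : ℕ} {P Q : Submodule k V} (hQP : Q ≤ P)
    (hn : Module.finrank k P - Module.finrank k Q = n) (x : Fin n → V) (hx : ∀ a, x a ∈ P)
    (hind : ∀ c : Fin n → k, ∑ a, c a • x a ∈ Q → c = 0) :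
    P ≤ Submodule.span k (Set.range x) ⊔ Q := by
  have hlin : LinearIndependent k x := by
    rw [Fintype.linearIndependent_iff]
    intro c hc a
    have := hind c (by rw [hc]; exact Q.zero_mem)
    rw [this]
    rfl
  have hdisj : Submodule.span k (Set.range x) ⊓ Q = ⊥ := by
    rw [eq_bot_iff]
    rintro v ⟨hv, hvQ⟩
    obtain ⟨c, rfl⟩ := (Submodule.mem_span_range_iff_exists_fun k).1 hv
    rw [hind c hvQ]
    simp
  have h1 := Submodule.finrank_sup_add_finrank_inf_eq (Submodule.span k (Set.range x)) Q
  rw [hdisj, finrank_bot, add_zero, finrank_span_eq_card hlin, Fintype.card_fin] at h1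
  have hle : Submodule.span k (Set.range x) ⊔ Q ≤ P := by
    refine sup_le (Submodule.span_le.2 ?_) hQP
    rintro _ ⟨a, rfl⟩
    exact hx a
  have h2 := Submodule.finrank_mono hQP
  exact (Submodule.eq_of_le_of_finrank_le hle (by omega)).ge

/-- If composing with `A` on the left does not lower the rank of `B`, then the subquotient on which
`B` is an isomorphism is compatible with the filtration by the range and the indeterminacy
of `A`. -/
lemma inf_le_and_le_sup_of_relRank_eq {A B : Submodule k (V × V)}
    (h : relRank (relComp A B) = relRank B) :
    relDom B ⊓ relKer (relInv A) ≤ relKer B ∧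
      relDom B ≤ (relDom B ⊓ relDom (relInv A)) ⊔ relKer B := by
  have h' : relRank (relComp (relInv B) (relInv A)) = relRank (relInv B) := by
    rw [← relInv_relComp, relRank_relInv, relRank_relInv, h]
  obtain ⟨h1, h2⟩ := relPre_eq_of_relRank_eq h'
  constructor
  · rintro x ⟨hx, hxA⟩
    obtain ⟨y, hy⟩ := mem_relDom.1 hx
    have hy' : y ∈ relKer (relInv B) := by
      rw [← h1]
      exact ⟨x, hxA, hy⟩
    rw [mem_relKer, mem_relInv] at hy'
    rw [mem_relKer]
    simpa using B.sub_mem hy hy'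
  · intro x hx
    obtain ⟨y, hy⟩ := mem_relDom.1 hx
    have hy' : y ∈ relPre (relInv B) (relDom (relInv A)) := by
      rw [h2]
      exact mem_relDom.2 ⟨x, hy⟩
    obtain ⟨x', hx', hxy'⟩ := hy'
    have h3 : x - x' ∈ relKer B := by
      rw [mem_relKer]
      simpa using B.sub_mem hy (mem_relInv.1 hxy')
    have h4 : x = x' + (x - x') := by abel
    rw [h4]
    exact Submodule.add_mem_sup ⟨mem_relDom.2 ⟨y, hxy'⟩, hx'⟩ h3

end Chains

namespace SideSystem

variable {k V : Type*} [Field k] [AddCommGroup V] [Module k V] (X : SideSystem k V)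

/-- The relation along a bi-infinite word `d` from position `s` to position `s + n`. -/
def along (d : ℤ → Fin 4) (s : ℤ) (n : ℕ) : Submodule k (V × V) := X.rel (window d s (n + 1))

lemma along_add (d : ℤ → Fin 4) (s : ℤ) (m n : ℕ) :
    X.along d s (m + n) = relComp (X.along d s m) (X.along d (s + m) n) := by
  rw [along, add_assoc, window_add, window_succ, X.rel_append, along, window_succ_last]
  rfl

lemma along_one (d : ℤ → Fin 4) (s : ℤ) : X.along d s 1 = X.S (d s) (d (s + 1)) := X.rel_pair _ _

lemma along_shift (d : ℤ → Fin 4) (c s : ℤ) (n : ℕ) :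
    X.along (fun i => d (i + c)) s n = X.along d (s + c) n := by
  rw [along, window_shift, along]

/-- The reverse of a bi-infinite word: the same path traversed backwards. -/
def reverse (d : ℤ → Fin 4) : ℤ → Fin 4 := fun i => d (-i) + 2

lemma reverse_reverse (d : ℤ → Fin 4) : reverse (reverse d) = d := by
  funext i
  simp [reverse, add_two_add_two]

lemma window_reverse_eq (d : ℤ → Fin 4) (s : ℤ) (n : ℕ) :
    window (reverse d) s n = revWord (window d (1 - s - n) n) :=
  window_reverse (· + 2) d s n

lemma along_reverse (d : ℤ → Fin 4) (s : ℤ) (n : ℕ) :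
    X.along (reverse d) (-s) n = relInv (X.along d (s - n) n) := by
  rw [along, window_reverse_eq, X.rel_revWord, along]
  congr 3
  push_cast
  ring

/-- The vectors at position `s` from which one can go `n` steps forward along the word. -/
def fwd (d : ℤ → Fin 4) (s : ℤ) (n : ℕ) : Submodule k V := relDom (X.along d s n)

/-- The vectors at position `s` from which one can go `n` steps forward along the word
and arrive at zero. -/
def fwdKer (d : ℤ → Fin 4) (s : ℤ) (n : ℕ) : Submodule k V := relKer (X.along d s n)

/-- The vectors at position `s` from which one can go `n` steps backward along the word. -/
def bwd (d : ℤ → Fin 4) (s : ℤ) (n : ℕ) : Submodule k V := relDom (relInv (X.along d (s - n) n))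

/-- The vectors at position `s` from which one can go `n` steps backward along the word
and arrive at zero. -/
def bwdKer (d : ℤ → Fin 4) (s : ℤ) (n : ℕ) : Submodule k V :=
  relKer (relInv (X.along d (s - n) n))

lemma bwd_eq (d : ℤ → Fin 4) (s : ℤ) (n : ℕ) : X.bwd d s n = X.fwd (reverse d) (-s) n := by
  rw [fwd, along_reverse, bwd]

lemma bwdKer_eq (d : ℤ → Fin 4) (s : ℤ) (n : ℕ) :
    X.bwdKer d s n = X.fwdKer (reverse d) (-s) n := by
  rw [fwdKer, along_reverse, bwdKer]

lemma fwdKer_mono (d : ℤ → Fin 4) (s : ℤ) (m n : ℕ) :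
    X.fwdKer d s m ≤ X.fwdKer d s (m + n) := by
  rw [fwdKer, fwdKer, along_add, relKer_relComp]
  exact relPre_mono _ bot_le

lemma wordRank_window (d : ℤ → Fin 4) (s : ℤ) (n : ℕ) :
    X.wordRank (window d s (n + 1)) = relRank (X.along d s n) := rfl

/-- The bi-infinite words that carry a nonzero graded piece. -/
def support : Set (ℤ → Fin 4) := wordSupport X.wordRank

lemma shift_mem_support {d : ℤ → Fin 4} (hd : d ∈ X.support) (c : ℤ) :
    (fun i => d (i + c)) ∈ X.support := by
  intro s n
  rw [window_shift]
  exact hd _ _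

lemma support_reduced {d : ℤ → Fin 4} (hd : d ∈ X.support) (s : ℤ) : d (s + 1) ≠ d s + 2 := by
  intro h
  have h1 := hd s 2
  rw [X.wordRank_window d s 1, along_one, h, X.S_opposite, relRank_bot] at h1
  exact lt_irrefl _ h1

/-- No word of the support is a shift of its reverse: a closed curve without backtracking is not
homotopic to its reverse. -/
lemma reverse_ne_shift {d : ℤ → Fin 4} (hd : d ∈ X.support) (c : ℤ) :
    reverse d ≠ fun i => d (i + c) := by
  intro h
  have hne : ∀ p : Fin 4, p + 2 ≠ p := by decide
  obtain ⟨j, hj⟩ | ⟨j, hj⟩ := Int.even_or_odd c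
  · have h1 := congrFun h (-j)
    have h2 : d j + 2 = d j := by
      convert h1 using 2
      · simp [reverse]
      · rw [hj]
        ring
    exact hne _ h2
  · have h1 := congrFun h (-j)
    have h2 : d j + 2 = d (j + 1) := by
      convert h1 using 2
      · simp [reverse]
      · rw [hj]
        ring
    exact X.support_reduced hd j h2.symm

variable [FiniteDimensional k V]

lemma reverse_mem_support {d : ℤ → Fin 4} (hd : d ∈ X.support) : reverse d ∈ X.support := by
  intro s n
  rw [window_reverse_eq, X.wordRank_revWord]
  exact hd _ _

/-- `M` is a stable depth for the word `d` if all windows of more than `M` letters have the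
same rank. -/
def StableDepth (d : ℤ → Fin 4) (M κ : ℕ) : Prop :=
  ∀ s n, M ≤ n → relRank (X.along d s n) = κ

namespace StableDepth

variable {X} {d : ℤ → Fin 4} {M κ : ℕ} (hd : X.StableDepth d M κ)
include hd

lemma reverse : X.StableDepth (reverse d) M κ := by
  intro s n hn
  have h := X.along_reverse d (-s) n
  rw [neg_neg] at h
  rw [h, relRank_relInv]
  exact hd _ _ hn

lemma fwd_eq (s : ℤ) {n : ℕ} (hn : M ≤ n) : X.fwd d s n = X.fwd d s M := by
  obtain ⟨j, rfl⟩ := Nat.exists_eq_add_of_le hn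
  rw [fwd, along_add, relDom_relComp]
  refine (relPre_eq_of_relRank_eq ?_).2
  rw [← along_add, hd _ _ hn, hd _ _ le_rfl]

lemma fwdKer_eq (s : ℤ) {n : ℕ} (hn : M ≤ n) : X.fwdKer d s n = X.fwdKer d s M := by
  obtain ⟨j, rfl⟩ := Nat.exists_eq_add_of_le hn
  rw [fwdKer, along_add, relKer_relComp]
  refine (relPre_eq_of_relRank_eq ?_).1
  rw [← along_add, hd _ _ hn, hd _ _ le_rfl]

lemma bwd_eq (s : ℤ) {n : ℕ} (hn : M ≤ n) : X.bwd d s n = X.bwd d s M := by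
  rw [X.bwd_eq, X.bwd_eq, hd.reverse.fwd_eq _ hn]

lemma fwdKer_le (s : ℤ) (n : ℕ) : X.fwdKer d s n ≤ X.fwdKer d s M := by
  rw [← hd.fwdKer_eq s (Nat.le_add_left M n)]
  exact X.fwdKer_mono d s n M

omit [FiniteDimensional k V] in
lemma finrank_fwd (s : ℤ) :
    Module.finrank k (X.fwd d s M) - Module.finrank k (X.fwdKer d s M) = κ := hd s M le_rfl

lemma finrank_bwd (s : ℤ) :
    Module.finrank k (X.bwd d s M) - Module.finrank k (X.bwdKer d s M) = κ := by
  rw [X.bwd_eq, X.bwdKer_eq]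
  exact hd.reverse.finrank_fwd _

lemma fwd_inf_bwdKer_le (s : ℤ) : X.fwd d s M ⊓ X.bwdKer d s M ≤ X.fwdKer d s M := by
  refine (inf_le_and_le_sup_of_relRank_eq ?_).1
  have h := X.along_add d (s - M) M M
  rw [sub_add_cancel] at h
  rw [← h, hd _ _ (Nat.le_add_left M M), hd _ _ le_rfl]

lemma fwd_le (s : ℤ) : X.fwd d s M ≤ (X.fwd d s M ⊓ X.bwd d s M) ⊔ X.fwdKer d s M := by
  refine (inf_le_and_le_sup_of_relRank_eq ?_).2
  have h := X.along_add d (s - M) M M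
  rw [sub_add_cancel] at h
  rw [← h, hd _ _ (Nat.le_add_left M M), hd _ _ le_rfl]

lemma mem_bwd_succ {s : ℤ} {x y : V} (hx : x ∈ X.bwd d s M)
    (hxy : (x, y) ∈ X.S (d s) (d (s + 1))) : y ∈ X.bwd d (s + 1) M := by
  obtain ⟨z, hz⟩ := mem_relDom.1 hx
  rw [← hd.bwd_eq (s + 1) (Nat.le_succ M)]
  refine mem_relDom.2 ⟨z, ?_⟩
  have h1 : s + 1 - (M + 1 : ℕ) = s - M := by push_cast; ring
  rw [mem_relInv, h1, Nat.succ_eq_add_one, along_add, sub_add_cancel, along_one]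
  exact ⟨x, hz, hxy⟩

lemma exists_step {s : ℤ} {x : V} (hx : x ∈ X.fwd d s M ⊓ X.bwd d s M) :
    ∃ y ∈ X.fwd d (s + 1) M ⊓ X.bwd d (s + 1) M, (x, y) ∈ X.S (d s) (d (s + 1)) := by
  have h1 : x ∈ X.fwd d s (1 + M) := by
    rw [hd.fwd_eq s (Nat.le_add_left M 1)]
    exact hx.1
  rw [fwd, along_add, relDom_relComp, along_one] at h1
  obtain ⟨y, hy, hxy⟩ := h1
  exact ⟨y, ⟨hy, hd.mem_bwd_succ hx.2 hxy⟩, hxy⟩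

lemma exists_step_ker {s : ℤ} {n : ℕ} {x : V} (hx : x ∈ X.fwdKer d s n ⊓ X.bwd d s M) :
    ∃ y ∈ X.fwdKer d (s + 1) (n - 1) ⊓ X.bwd d (s + 1) M, (x, y) ∈ X.S (d s) (d (s + 1)) := by
  cases n with
  | zero =>
    have hx0 : x = 0 := (mem_relKer.1 hx.1).1
    subst hx0
    exact ⟨0, zero_mem _, zero_mem _⟩
  | succ n =>
    have h1 := hx.1
    rw [add_comm, fwdKer, along_add, relKer_relComp, along_one] at h1
    obtain ⟨y, hy, hxy⟩ := h1
    exact ⟨y, ⟨hy, hd.mem_bwd_succ hx.2 hxy⟩, hxy⟩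

lemma mem_fwdKer_of_step {s : ℤ} {x y : V} (hy : y ∈ X.fwdKer d (s + 1) M)
    (hxy : (x, y) ∈ X.S (d s) (d (s + 1))) : x ∈ X.fwdKer d s M := by
  rw [← hd.fwdKer_eq s (Nat.le_add_left M 1), fwdKer, along_add, relKer_relComp, along_one]
  exact ⟨y, hy, hxy⟩

lemma sum_mem_fwdKer {ι : Type*} [Fintype ι] (x : ℕ → ι → V)
    (hx : ∀ (s : ℕ) a, (x s a, x (s + 1) a) ∈ X.S (d s) (d (s + 1))) (c : ι → k) (s : ℕ)
    (hs : ∑ a, c a • x s a ∈ X.fwdKer d s M) : ∑ a, c a • x 0 a ∈ X.fwdKer d 0 M := by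
  induction s with
  | zero => exact hs
  | succ s ih =>
    refine ih (hd.mem_fwdKer_of_step (y := ∑ a, c a • x (s + 1) a) (by exact_mod_cast hs) ?_)
    have h := Submodule.sum_mem (X.S (d s) (d (s + 1))) (t := Finset.univ)
      (f := fun a => c a • (x s a, x (s + 1) a)) fun a _ => Submodule.smul_mem _ (c a) (hx s a)
    convert h using 1
    rw [Prod.ext_iff]
    simp [Prod.fst_sum, Prod.snd_sum]

end StableDepth

end SideSystem

namespace SideSystem

variable {k V : Type*} [Field k] [AddCommGroup V] [Module k V] {X : SideSystem k V}

section Periodic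

variable {d : ℤ → Fin 4} {ℓ : ℕ} (hper : ∀ s, d (s + ℓ) = d s)
include hper

lemma periodic_mul (j : ℕ) (s : ℤ) : d (s + (j * ℓ : ℕ)) = d s := by
  induction j with
  | zero => simp
  | succ j ih =>
    rw [← ih, ← hper (s + (j * ℓ : ℕ))]
    congr 1
    push_cast
    ring

lemma along_periodic (j s n : ℕ) : X.along d ((j * ℓ + s : ℕ) : ℤ) n = X.along d s n := by
  have h : (fun i : ℤ => d (i + (j * ℓ : ℕ))) = d := funext fun i => periodic_mul hper j i
  have h1 := X.along_shift d (j * ℓ : ℕ) s n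
  rw [h] at h1
  rw [h1]
  congr 1
  push_cast
  ring

lemma fwdKer_periodic (j s n : ℕ) : X.fwdKer d ((j * ℓ + s : ℕ) : ℤ) n = X.fwdKer d s n := by
  rw [fwdKer, along_periodic hper, fwdKer]

lemma fwd_periodic (j s n : ℕ) : X.fwd d ((j * ℓ + s : ℕ) : ℤ) n = X.fwd d s n := by
  rw [fwd, along_periodic hper, fwd]

lemma bwd_periodic (j s n : ℕ) : X.bwd d ((j * ℓ + s : ℕ) : ℤ) n = X.bwd d s n := by
  have h : (fun i : ℤ => d (i + (j * ℓ : ℕ))) = d := funext fun i => periodic_mul hper j i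
  have h1 := X.along_shift d (j * ℓ : ℕ) (s - n) n
  rw [h] at h1
  rw [bwd, bwd, h1]
  congr 3
  push_cast
  ring

end Periodic

open scoped Matrix.Module

lemma matrix_smul_mem {ι W : Type*} [Fintype ι] [DecidableEq ι] [AddCommGroup W] [Module k W]
    (B : Matrix ι ι k) (R : Submodule k W) (v : ι → W) (hv : ∀ a, v a ∈ R) (a : ι) :
    (B • v) a ∈ R :=
  Submodule.sum_mem _ fun b _ => R.smul_mem _ (hv b)

lemma matrix_smul_mem_rel {ι : Type*} [Fintype ι] [DecidableEq ι] (B : Matrix ι ι k)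
    (R : Submodule k (V × V)) (v w : ι → V) (hvw : ∀ a, (v a, w a) ∈ R) (a : ι) :
    ((B • v) a, (B • w) a) ∈ R := by
  have h := matrix_smul_mem B R (fun a => (v a, w a)) hvw a
  convert h using 1
  rw [Prod.ext_iff]
  simp [Prod.fst_sum, Prod.snd_sum]

variable [FiniteDimensional k V]

/-- For a periodic word the graded piece, with the automorphism obtained by going once around, lifts
to a family of vectors that are related exactly along the word. A first choice `y` of the lift closes
up only up to an error `t`, which lies in the part that can be continued to zero in finitely many
steps `z`. The sum of the geometric series `∑ A⁻¹ ^ (j + 1) z_j`, where `z_j` is the continuation of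
`t` after `j` turns, corrects the error. -/
theorem StableDepth.exists_periodic_lift {d : ℤ → Fin 4} {M κ ℓ : ℕ} (hd : X.StableDepth d M κ)
    (hℓ : 0 < ℓ) (hper : ∀ s, d (s + ℓ) = d s) :
    ∃ (A : GL (Fin κ) k) (x : ℕ → Fin κ → V),
      (∀ (s : ℕ) a, x s a ∈ X.fwd d s M ⊓ X.bwd d s M) ∧
      (∀ (s : ℕ) a, (x s a, x (s + 1) a) ∈ X.S (d s) (d (s + 1))) ∧
      (∀ a, x ℓ a = ∑ b, (A : Matrix (Fin κ) (Fin κ) k) a b • x 0 b) ∧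
      ∀ (s : ℕ) (c : Fin κ → k), ∑ a, c a • x s a ∈ X.fwdKer d s M → c = 0 := by
  set P := X.fwd d 0 M with hP
  set Pk := X.fwdKer d 0 M with hPk
  set Q := X.bwd d 0 M with hQ
  have hPkP : Pk ≤ P := relKer_le_relDom _
  -- A complement `U` of the part of `P ⊓ Q` that dies.
  obtain ⟨U, hUdis, hUsup⟩ : ∃ U : Submodule k V, U ⊓ Pk = ⊥ ∧ U ⊔ (Pk ⊓ Q) = P ⊓ Q := by
    obtain ⟨U', hU'⟩ := Submodule.exists_isCompl ((Pk ⊓ Q).comap (P ⊓ Q).subtype)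
    have hmap : ((Pk ⊓ Q).comap (P ⊓ Q).subtype).map (P ⊓ Q).subtype = Pk ⊓ Q := by
      rw [Submodule.map_comap_subtype]
      exact inf_eq_right.2 (inf_le_inf_right _ hPkP)
    refine ⟨U'.map (P ⊓ Q).subtype, ?_, ?_⟩
    · have h1 := congrArg (Submodule.map (P ⊓ Q).subtype) hU'.inf_eq_bot
      rw [Submodule.map_inf _ (Submodule.injective_subtype _), hmap, Submodule.map_bot] at h1
      rw [eq_bot_iff, ← h1]
      rintro v ⟨hv, hvk⟩
      exact ⟨⟨hvk, (Submodule.map_subtype_le _ _ hv).2⟩, hv⟩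
    · have h1 := congrArg (Submodule.map (P ⊓ Q).subtype) hU'.sup_eq_top
      rw [Submodule.map_sup, hmap, Submodule.map_top, Submodule.range_subtype] at h1
      rw [sup_comm, h1]
  have hUle : U ≤ P ⊓ Q := le_sup_left.trans hUsup.le
  have hUP : U ⊔ Pk = P := by
    refine le_antisymm (sup_le (hUle.trans inf_le_left) hPkP) ((hd.fwd_le 0).trans ?_)
    rw [← hUsup]
    exact sup_le (sup_le le_sup_left (inf_le_left.trans le_sup_right)) le_sup_right
  have hUcard : Module.finrank k U = κ := by
    have h1 := Submodule.finrank_sup_add_finrank_inf_eq U Pk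
    rw [hUdis, hUP, finrank_bot] at h1
    have h2 : Module.finrank k P - Module.finrank k Pk = κ := hd.finrank_fwd 0
    omega
  let bas : Module.Basis (Fin κ) k U := Module.finBasisOfFinrankEq k U hUcard
  let u : Fin κ → V := fun a => bas a
  have hu : ∀ a, u a ∈ P ⊓ Q := fun a => hUle (bas a).2
  have hu_ind : ∀ c : Fin κ → k, ∑ a, c a • u a ∈ Pk → c = 0 := by
    intro c hc
    have h1 : ∑ a, c a • u a = ((∑ a, c a • bas a : U) : V) := by simp [u]
    rw [h1] at hc
    have h2 : ((∑ a, c a • bas a : U) : V) ∈ U ⊓ Pk := ⟨Subtype.property _, hc⟩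
    rw [hUdis, Submodule.mem_bot, Submodule.coe_eq_zero] at h2
    exact funext (Fintype.linearIndependent_iff.1 bas.linearIndependent c h2)
  -- A first choice of the lift.
  have hy : ∀ a, ∃ y : ℕ → V, y 0 = u a ∧ ∀ n : ℕ, y n ∈ X.fwd d n M ⊓ X.bwd d n M ∧
      (y n, y (n + 1)) ∈ X.S (d n) (d (n + 1)) := fun a =>
    exists_seq_of_step (fun n x => x ∈ X.fwd d n M ⊓ X.bwd d n M)
      (fun n x y => (x, y) ∈ X.S (d n) (d (n + 1)))
      (fun n x hx => by exact_mod_cast hd.exists_step hx) (by exact_mod_cast hu a)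
  choose y hy0 hy using hy
  -- Its failure to close up.
  have hyl : ∀ a, ∃ (c : Fin κ → k) (t : V), t ∈ Pk ⊓ Q ∧ y a ℓ = ∑ b, c b • u b + t := by
    intro a
    have h1 := (hy a ℓ).1
    have h2 := fwd_periodic (X := X) hper 1 0 M
    have h3 := bwd_periodic (X := X) hper 1 0 M
    rw [one_mul, add_zero, Nat.cast_zero] at h2 h3
    rw [h2, h3, ← hP, ← hQ, ← hUsup] at h1
    obtain ⟨v, hv, t, ht, hvt⟩ := Submodule.mem_sup.1 h1
    refine ⟨bas.repr ⟨v, hv⟩, t, ht, ?_⟩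
    rw [← hvt]
    congr 1
    have h4 : ((∑ b, bas.repr ⟨v, hv⟩ b • bas b : U) : V) = v :=
      congrArg Subtype.val (bas.sum_repr ⟨v, hv⟩)
    conv_lhs => rw [← h4]
    rw [AddSubmonoidClass.coe_finsetSum]
    rfl
  choose A t ht hyA using hyl
  have hPkl : X.fwdKer d ℓ M = Pk := by
    have h := fwdKer_periodic (X := X) hper 1 0 M
    rwa [one_mul, add_zero, Nat.cast_zero] at h
  have hA : IsUnit (Matrix.of A) := by
    rw [← Matrix.vecMul_injective_iff_isUnit]
    intro c c' hcc
    rw [← sub_eq_zero]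
    apply hu_ind
    have h0 : ∀ b, ∑ a, (c - c') a * A a b = 0 := by
      intro b
      have := congrFun hcc b
      simp only [Matrix.vecMul, dotProduct, Matrix.of_apply] at this
      simp [sub_mul, Finset.sum_sub_distrib, this]
    have h1 : ∑ a, (c - c') a • y a ℓ ∈ X.fwdKer d ℓ M := by
      have h2 : ∑ a, (c - c') a • y a ℓ = ∑ a, (c - c') a • t a := by
        simp only [hyA, smul_add, Finset.sum_add_distrib, Finset.smul_sum, smul_smul]
        rw [Finset.sum_comm]
        simp only [← Finset.sum_smul, h0, zero_smul, Finset.sum_const_zero, zero_add]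
      rw [h2, hPkl]
      exact Submodule.sum_mem _ fun a _ => Submodule.smul_mem _ _ (ht a).1
    have h3 := hd.sum_mem_fwdKer (fun s a => y a s) (fun s a => (hy a s).2) (c - c') ℓ h1
    simpa [hy0] using h3
  -- The error can be continued to zero.
  have hz : ∀ a, ∃ z : ℕ → V, z 0 = t a ∧ ∀ n : ℕ,
      z n ∈ X.fwdKer d n (M - n) ⊓ X.bwd d n M ∧ (z n, z (n + 1)) ∈ X.S (d n) (d (n + 1)) :=
    fun a => exists_seq_of_step (fun n x => x ∈ X.fwdKer d n (M - n) ⊓ X.bwd d n M)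
      (fun n x y => (x, y) ∈ X.S (d n) (d (n + 1)))
      (fun n x hx => by
        rw [← Nat.sub_sub]
        exact_mod_cast hd.exists_step_ker hx)
      (by exact_mod_cast ht a)
  choose z hz0 hz using hz
  have hz_end : ∀ a n, M ≤ n → z a n = 0 := by
    intro a n hn
    have h := (hz a n).1.1
    rw [Nat.sub_eq_zero_of_le hn] at h
    exact (mem_relKer.1 h).1
  obtain ⟨A', hA'⟩ := hA
  let τ : ℕ → Fin κ → V := fun s =>
    ∑ j ∈ Finset.range M, ((A'⁻¹ : GL (Fin κ) k) : Matrix (Fin κ) (Fin κ) k) ^ (j + 1) •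
      fun a => z a (j * ℓ + s)
  have hzk : ∀ (j s : ℕ) a, z a (j * ℓ + s) ∈ X.fwdKer d s M ⊓ X.bwd d s M := by
    intro j s a
    have h := (hz a (j * ℓ + s)).1
    refine ⟨?_, ?_⟩
    · rw [← fwdKer_periodic hper j s]
      exact hd.fwdKer_le _ _ h.1
    · rw [← bwd_periodic hper j s]
      exact h.2
  have hτ : ∀ (s : ℕ) a, τ s a ∈ X.fwdKer d s M ⊓ X.bwd d s M := by
    intro s a
    simp only [τ, Finset.sum_apply]
    exact Submodule.sum_mem _ fun j _ => matrix_smul_mem _ _ _ (hzk j s) a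
  have hτS : ∀ (s : ℕ) a, (τ s a, τ (s + 1) a) ∈ X.S (d s) (d (s + 1)) := by
    intro s a
    have h : ∀ j ∈ Finset.range M,
        ((((A'⁻¹ : GL (Fin κ) k) : Matrix (Fin κ) (Fin κ) k) ^ (j + 1) •
          fun a => z a (j * ℓ + s)) a,
        (((A'⁻¹ : GL (Fin κ) k) : Matrix (Fin κ) (Fin κ) k) ^ (j + 1) •
          fun a => z a (j * ℓ + (s + 1))) a) ∈ X.S (d s) (d (s + 1)) := by
      intro j _
      refine matrix_smul_mem_rel _ _ _ _ (fun a => ?_) a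
      have h1 := (hz a (j * ℓ + s)).2
      have h2 := periodic_mul hper j s
      have h3 := periodic_mul hper j (s + 1)
      have e1 : ((j * ℓ + s : ℕ) : ℤ) = s + (j * ℓ : ℕ) := by push_cast; ring
      have e2 : (s : ℤ) + (j * ℓ : ℕ) + 1 = s + 1 + (j * ℓ : ℕ) := by ring
      rw [e1, e2, h2, h3] at h1
      exact h1
    have h' := Submodule.sum_mem _ h
    convert h' using 1
    rw [Prod.ext_iff]
    simp only [τ, Finset.sum_apply, Prod.fst_sum, Prod.snd_sum, and_self]
  have hclose : (fun a => t a) + τ ℓ = (A' : Matrix (Fin κ) (Fin κ) k) • τ 0 := by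
    have h1 : ∀ j, (A' : Matrix (Fin κ) (Fin κ) k) •
        (((A'⁻¹ : GL (Fin κ) k) : Matrix (Fin κ) (Fin κ) k) ^ (j + 1) •
          fun a => z a (j * ℓ + 0)) =
        ((A'⁻¹ : GL (Fin κ) k) : Matrix (Fin κ) (Fin κ) k) ^ j • fun a => z a (j * ℓ) := by
      intro j
      rw [smul_smul, pow_succ', ← mul_assoc, ← Units.val_mul, mul_inv_cancel, Units.val_one,
        one_mul, add_zero]
    simp only [τ, Finset.smul_sum, h1]
    have h2 : ∀ j s : ℕ, j * ℓ + ℓ = (j + 1) * ℓ := fun j s => by ring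
    have h3 := Finset.sum_range_succ' (fun j =>
      ((A'⁻¹ : GL (Fin κ) k) : Matrix (Fin κ) (Fin κ) k) ^ j • fun a => z a (j * ℓ)) M
    rw [Finset.sum_range_succ] at h3
    have h4 : (fun a => z a (M * ℓ)) = 0 :=
      funext fun a => hz_end a _ (Nat.le_mul_of_pos_right M hℓ)
    simp only [h4, smul_zero, add_zero, pow_zero, one_smul, zero_mul, hz0] at h3
    rw [h3, add_comm]
    simp only [add_mul, one_mul]
  refine ⟨A', fun s a => y a s + τ s a, ?_, ?_, ?_, ?_⟩
  · intro s a
    refine Submodule.add_mem _ (hy a s).1 ⟨relKer_le_relDom _ (hτ s a).1, (hτ s a).2⟩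
  · intro s a
    exact Submodule.add_mem _ (hy a s).2 (hτS s a)
  · intro a
    have h1 := congrFun hclose a
    simp only [Pi.add_apply, Matrix.Module.smul_apply, hA', Matrix.of_apply] at h1
    simp only [hA', Matrix.of_apply, smul_add, Finset.sum_add_distrib, hyA, hy0, add_assoc, h1]
  · intro s c hc
    have h1 := hd.sum_mem_fwdKer (fun s a => y a s + τ s a)
      (fun s a => Submodule.add_mem _ (hy a s).2 (hτS s a)) c s hc
    simp only [smul_add, Finset.sum_add_distrib, hy0] at h1
    apply hu_ind
    refine (Submodule.add_mem_iff_left _ ?_).1 h1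
    exact Submodule.sum_mem _ fun a _ => Submodule.smul_mem _ _ (by exact_mod_cast (hτ 0 a).1)

end SideSystem

/-! ### Bands -/

namespace SideSystem

variable {k V : Type*} [Field k] [AddCommGroup V] [Module k V]

/-- A closed path through the sides of the square together with a local system, realised by vectors
`vec s a` at the crossings `s` which are related along the path: by the identity on all arcs but the
last one, where the relation is the monodromy. -/
structure Band (X : SideSystem k V) where
  len : ℕ
  [len_ne_zero : NeZero len]
  side : ZMod len → Fin 4
  reduced : ∀ s, side (s + 1) ≠ side s + 2
  dim : ℕ
  dim_pos : 0 < dim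
  monodromy : GL (Fin dim) k
  vec : ZMod len → Fin dim → V
  vec_mem : ∀ s a, vec s a ∈ X.E (side s)
  step : ∀ s a, (vec s a, ∑ b, ((if s + 1 = 0 then monodromy else 1 : GL (Fin dim) k) :
    Matrix (Fin dim) (Fin dim) k) a b • vec (s + 1) b) ∈ X.S (side s) (side (s + 1))

attribute [instance] Band.len_ne_zero

variable [FiniteDimensional k V] {X : SideSystem k V}

/-- The band of a periodic word. At each crossing its vectors span the graded piece of the word in
the forward and in the backward direction. -/
lemma exists_band {d : ℤ → Fin 4} (hdX : d ∈ X.support) {M κ ℓ : ℕ} (hd : X.StableDepth d M κ)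
    (hκ : 0 < κ) (hℓ : 0 < ℓ) (hper : ∀ s, d (s + ℓ) = d s) :
    ∃ B : X.Band, B.len = ℓ ∧ B.dim = κ ∧ ∀ s : ℕ, s < ℓ → ∃ s' : ZMod B.len,
      X.fwd d s M ≤ Submodule.span k (Set.range (B.vec s')) ⊔ X.fwdKer d s M ∧
      X.bwd d s M ≤ Submodule.span k (Set.range (B.vec s')) ⊔ X.bwdKer d s M := by
  obtain ⟨A, x, hx, hxS, hxl, hind⟩ := hd.exists_periodic_lift hℓ hper
  have : NeZero ℓ := ⟨hℓ.ne'⟩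
  have hval : ∀ s : ZMod ℓ, s + 1 ≠ 0 → (s + 1).val = s.val + 1 := by
    intro s hs
    have hlt : s.val + 1 < ℓ := by
      by_contra hlt
      apply hs
      have h1 : s.val + 1 = ℓ := by have := ZMod.val_lt s; omega
      have h2 : ((s.val + 1 : ℕ) : ZMod ℓ) = 0 := by rw [h1]; exact ZMod.natCast_self ℓ
      simpa using h2
    have h3 : s + 1 = ((s.val + 1 : ℕ) : ZMod ℓ) := by simp
    rw [h3, ZMod.val_cast_of_lt hlt]
  have hval0 : ∀ s : ZMod ℓ, s + 1 = 0 → s.val + 1 = ℓ := by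
    intro s hs
    have h1 : ((s.val + 1 : ℕ) : ZMod ℓ) = 0 := by simpa using hs
    have h2 := (ZMod.natCast_eq_zero_iff _ _).1 h1
    have h3 := Nat.le_of_dvd (Nat.succ_pos _) h2
    have := ZMod.val_lt s
    omega
  have hside : ∀ s : ZMod ℓ, d ((s + 1).val : ℤ) = d (s.val + 1) := by
    intro s
    by_cases hs : s + 1 = 0
    · have h1 : (s.val : ℤ) + 1 = 0 + ℓ := by rw [zero_add]; exact_mod_cast hval0 s hs
      rw [hs, ZMod.val_zero, h1, hper]
      rfl
    · rw [hval s hs]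
      push_cast
      rfl
  refine ⟨{ len := ℓ
            side := fun s => d s.val
            reduced := fun s => by rw [hside]; exact X.support_reduced hdX _
            dim := κ
            dim_pos := hκ
            monodromy := A
            vec := fun s a => x s.val a
            vec_mem := fun s a => X.dom_rel_le _ _ (hx s.val a).1
            step := fun s a => ?_ }, rfl, rfl, ?_⟩
  · have h := hxS s.val a
    rw [hside]
    by_cases hs : s + 1 = 0
    · rw [hval0 s hs, hxl] at h
      simpa [hs] using h
    · simpa [hs, hval s hs, Matrix.one_apply] using h
  · intro s hs
    refine ⟨(s : ZMod ℓ), ?_⟩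
    have hsv : (s : ZMod ℓ).val = s := ZMod.val_cast_of_lt hs
    have hvec : (fun a => x (s : ZMod ℓ).val a) = x s := by rw [hsv]
    change X.fwd d s M ≤ Submodule.span k (Set.range fun a => x (s : ZMod ℓ).val a) ⊔ _ ∧
      X.bwd d s M ≤ Submodule.span k (Set.range fun a => x (s : ZMod ℓ).val a) ⊔ _
    rw [hvec]
    constructor
    · exact le_span_sup_of_independent (relKer_le_relDom _) (hd.finrank_fwd s) _
        (fun a => (hx s a).1) (hind s)
    · refine le_span_sup_of_independent (relKer_le_relDom _) (hd.finrank_bwd s) _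
        (fun a => (hx s a).2) fun c hc => hind s c ?_
      refine hd.fwd_inf_bwdKer_le s ⟨?_, hc⟩
      exact Submodule.sum_mem _ fun a _ => Submodule.smul_mem _ _ (hx s a).1

omit [FiniteDimensional k V] in
/-- If a subspace contains representatives of all graded pieces of words of length `M + 1`, it is
everything. -/
lemma le_of_graded_pieces (U : Submodule k V) (M : ℕ)
    (h : ∀ w : List (Fin 4), w.length = M + 1 → relDom (X.rel w) ≤ relKer (X.rel w) ⊔ U)
    (p : Fin 4) : X.E p ≤ U := by
  have key : ∀ j (l : List (Fin 4)) (p : Fin 4), l.length + j = M →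
      relDom (X.rel (l ++ [p])) ≤ relKer (X.rel (l ++ [p])) ⊔ U := by
    intro j
    induction j with
    | zero =>
      intro l p hl
      exact h _ (by simpa using hl)
    | succ j ih =>
      intro l p hl
      have h1 : ∀ q, relPre (X.rel (l ++ [p])) (relDom (X.S p q)) ≤
          relPre (X.rel (l ++ [p])) (relKer (X.S p q)) ⊔ U := by
        intro q
        have h2 := ih (l ++ [p]) q (by simp; omega)
        rwa [List.append_assoc, List.singleton_append, X.rel_append, X.rel_pair, relDom_relComp,
          relKer_relComp] at h2
      have e1 := h1 (p + 1)
      have e2 := h1 p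
      have e3 := h1 (p + 3)
      rw [X.ker_first] at e1
      rw [X.ker_second] at e2
      rw [X.ker_third, X.dom_third, relPre_eq_relDom (X.ran_rel_le l p)] at e3
      exact e3.trans (sup_le (e2.trans (sup_le e1 le_sup_right)) le_sup_right)
  have h0 := key M [] p (by simp)
  have h1 : relKer (relDiag (X.E p)) = ⊥ := by
    rw [eq_bot_iff]
    intro x hx
    exact (mem_relKer.1 hx).1
  have h2 : X.E p ≤ relDom (relDiag (X.E p)) := fun x hx => mem_relDom.2 ⟨x, rfl, hx⟩
  change relDom (relDiag (X.E p)) ≤ relKer (relDiag (X.E p)) ⊔ U at h0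
  rw [h1, bot_sup_eq] at h0
  exact h2.trans h0

/-- Translation of the words of the support. -/
def shift (X : SideSystem k V) : Equiv.Perm X.support where
  toFun d := ⟨fun i => d.1 (i + 1), X.shift_mem_support d.2 1⟩
  invFun d := ⟨fun i => d.1 (i + (-1)), X.shift_mem_support d.2 (-1)⟩
  left_inv d := Subtype.ext (funext fun i => by simp)
  right_inv d := Subtype.ext (funext fun i => by simp)

omit [FiniteDimensional k V] in
lemma shift_iterate (n : ℕ) (d : X.support) (i : ℤ) : (X.shift^[n] d).1 i = d.1 (i + n) := by
  induction n generalizing d with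
  | zero => simp
  | succ n ih =>
    rw [Function.iterate_succ_apply, ih]
    exact congrArg d.1 (by push_cast; ring)

omit [FiniteDimensional k V] in
lemma shift_zpow (n : ℤ) (d : X.support) (i : ℤ) : ((X.shift ^ n) d).1 i = d.1 (i + n) := by
  induction n using Int.induction_on generalizing d with
  | zero => simp
  | succ n ih =>
    rw [zpow_add, zpow_one, Equiv.Perm.mul_apply, ih]
    exact congrArg d.1 (by ring)
  | pred n ih =>
    rw [zpow_sub, zpow_one, Equiv.Perm.mul_apply, ih]
    exact congrArg d.1 (by ring)

/-- Reversal of the words of the support. -/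
def rev (X : SideSystem k V) (d : X.support) : X.support :=
  ⟨reverse d.1, X.reverse_mem_support d.2⟩

lemma rev_rev (d : X.support) : X.rev (X.rev d) = d := Subtype.ext (reverse_reverse d.1)

lemma rev_shift_zpow (n : ℤ) (d : X.support) :
    X.rev ((X.shift ^ n) d) = (X.shift ^ (-n)) (X.rev d) := by
  refine Subtype.ext (funext fun i => ?_)
  rw [shift_zpow]
  change ((X.shift ^ n) d).1 (-i) + 2 = d.1 (-(i + -n)) + 2
  rw [shift_zpow, neg_add, neg_neg]

lemma rev_sameCycle {d e : X.support} (h : X.shift.SameCycle d e) :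
    X.shift.SameCycle (X.rev d) (X.rev e) := by
  obtain ⟨n, hn⟩ := h
  exact ⟨-n, by rw [← rev_shift_zpow, hn]⟩

lemma not_sameCycle_rev (d : X.support) : ¬ X.shift.SameCycle d (X.rev d) := by
  rintro ⟨n, hn⟩
  refine X.reverse_ne_shift d.2 n ?_
  have h := congrArg Subtype.val hn
  change _ = reverse d.1 at h
  rw [← h]
  funext i
  rw [shift_zpow]

lemma finite_support (X : SideSystem k V) : Finite X.support := by
  obtain ⟨N, -, -, -, hN⟩ := X.stationaryWeight_wordRank.exists_stable_length
  let φ : X.support → {w // w ∈ wordsOfLength (Fin 4) N} := fun d =>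
    ⟨window d.1 0 N, mem_wordsOfLength.2 (length_window _ _ _)⟩
  refine Finite.of_injective φ fun d e h => Subtype.ext ?_
  exact hN d.1 d.2 e.1 e.2 (congrArg Subtype.val h)

/-- The graded pieces of the words in the support fill the four spaces `E p`. -/
lemma exists_stableDepth (X : SideSystem k V) : ∃ (M : ℕ) (κ : X.support → ℕ),
    (∀ d, 0 < κ d) ∧ (∀ d, X.StableDepth d.1 M (κ d)) ∧
    (∀ s : Finset X.support, ∑ d ∈ s, κ d ≤ ∑ p, Module.finrank k (X.E p)) ∧
    ∀ w : List (Fin 4), w.length = M + 1 → relDom (X.rel w) ≤ relKer (X.rel w) ∨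
      ∃ d : X.support, X.rel w = X.along d.1 0 M := by
  obtain ⟨N, hN0, h1, h2, h3⟩ := X.stationaryWeight_wordRank.exists_stable_length
  obtain ⟨M, rfl⟩ : ∃ M, N = M + 1 := ⟨N - 1, by omega⟩
  refine ⟨M, fun d => X.wordRank (window d.1 0 (M + 1)), fun d => d.2 _ _, fun d s n hn => ?_,
    fun s => ?_, fun w hw => ?_⟩
  · exact h1 d.1 d.2 s (n + 1) (by omega)
  · have h4 : X.wordRank [] = ∑ p, Module.finrank k (X.E p) := rfl
    rw [← h4, ← X.stationaryWeight_wordRank.sum_words (M + 1)]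
    have hinj : Set.InjOn (fun d : X.support => window d.1 0 (M + 1)) s :=
      fun d _ e _ h => Subtype.ext (h3 d.1 d.2 e.1 e.2 h)
    rw [← Finset.sum_image (f := X.wordRank) hinj]
    refine Finset.sum_le_sum_of_subset fun w hw => ?_
    obtain ⟨d, _, rfl⟩ := Finset.mem_image.1 hw
    exact mem_wordsOfLength.2 (length_window _ _ _)
  · rcases Nat.eq_zero_or_pos (X.wordRank w) with h0 | h0
    · left
      rw [X.wordRank_of_ne_nil (by rintro rfl; simp at hw), relRank] at h0
      exact (Submodule.eq_of_le_of_finrank_le (relKer_le_relDom _) (by omega)).ge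
    · right
      obtain ⟨d, hd, hdw⟩ := h2 w hw h0
      exact ⟨⟨d, hd⟩, by rw [← hdw]; rfl⟩

/-- The vectors of finitely many bands form a basis of the whole space. The words of the support
fall into finitely many orbits under translation, and reversal exchanges these orbits in pairs. One
band is used for each pair: its vectors represent the graded pieces of both words. -/
theorem exists_bands (X : SideSystem k V) (hE : X.E 0 ⊔ X.E 1 = ⊤)
    (hE' : X.E 0 ⊓ X.E 1 = ⊥) :
    ∃ (m : ℕ) (B : Fin m → X.Band),
      LinearIndependent k
        (fun g : Σ i, ZMod (B i).len × Fin (B i).dim => (B g.1).vec g.2.1 g.2.2) ∧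
      Submodule.span k
        (Set.range fun g : Σ i, ZMod (B i).len × Fin (B i).dim => (B g.1).vec g.2.1 g.2.2) = ⊤ := by
  classical
  obtain ⟨M, κ, hκ, hst, hsum, hcover⟩ := X.exists_stableDepth
  have := X.finite_support
  have : Fintype X.support := Fintype.ofFinite _
  have hκ_shift : ∀ (n : ℕ) d, κ (X.shift^[n] d) = κ d := by
    intro n d
    rw [← hst _ 0 M le_rfl, ← hst d n M le_rfl]
    have h : (X.shift^[n] d).1 = fun i => d.1 (i + n) := funext fun i => shift_iterate n d i
    rw [h, along_shift, zero_add]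
  have hκ_rev : ∀ d, κ (X.rev d) = κ d := by
    intro d
    rw [← hst (X.rev d) 0 M le_rfl]
    exact (hst d).reverse 0 M le_rfl
  -- Orbits under translation, and the choice of one of each pair of mutually reverse orbits.
  let Orb := Quotient (Equiv.Perm.SameCycle.setoid X.shift)
  let revO : Orb → Orb := Quotient.map X.rev fun _ _ h => rev_sameCycle h
  have hrevO : ∀ c, revO (revO c) = c := by
    intro c
    induction c using Quotient.inductionOn with
    | h d => exact congrArg _ (rev_rev d)
  have hrevO_ne : ∀ c, revO c ≠ c := by
    intro c
    induction c using Quotient.inductionOn with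
    | h d => exact fun h => not_sameCycle_rev d (Quotient.exact h).symm
  have : Finite Orb := Quotient.finite _
  let num : Orb ≃ Fin (Nat.card Orb) := Finite.equivFin Orb
  let C := {c : Orb // num c < num (revO c)}
  have : Fintype C := Fintype.ofFinite _
  let e : Fin (Fintype.card C) ≃ C := (Fintype.equivFin C).symm
  let base : C → X.support := fun c => c.1.out
  have hbase : ∀ c : C, (⟦base c⟧ : Orb) = c.1 := fun c => Quotient.out_eq _
  let per : C → ℕ := fun c => Function.minimalPeriod X.shift (base c)
  have hper0 : ∀ c, 0 < per c := fun c =>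
    Function.minimalPeriod_pos_of_mem_periodicPts (X.shift.injective.mem_periodicPts (base c))
  have hper : ∀ c s, (base c).1 (s + per c) = (base c).1 s := by
    intro c s
    rw [← shift_iterate, Function.iterate_minimalPeriod]
  have hB := fun c : C =>
    exists_band (base c).2 (hst (base c)) (hκ _) (hper0 c) (hper c)
  choose B hlen hdim hspan using hB
  have horbit : ∀ (c : C) (d : X.support), (⟦d⟧ : Orb) = c.1 →
      ∃ n < per c, X.shift^[n] (base c) = d := by
    intro c d hd
    have h1 : X.shift.SameCycle (base c) d := Quotient.exact ((hbase c).trans hd.symm)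
    obtain ⟨n, hn⟩ := h1.exists_nat_pow_eq
    refine ⟨n % per c, Nat.mod_lt _ (hper0 c), ?_⟩
    rw [Function.iterate_mod_minimalPeriod_eq, ← Equiv.Perm.coe_pow, hn]
  refine ⟨Fintype.card C, fun i => B (e i), ?_⟩
  set vec : (Σ i, ZMod (B (e i)).len × Fin (B (e i)).dim) → V :=
    fun g => (B (e g.1)).vec g.2.1 g.2.2 with hvec
  set U := Submodule.span k (Set.range vec) with hU
  have hBU : ∀ (c : C) (s : ZMod (B c).len), Submodule.span k (Set.range ((B c).vec s)) ≤ U := by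
    intro c s
    obtain ⟨i, rfl⟩ := e.surjective c
    refine Submodule.span_le.2 ?_
    rintro _ ⟨a, rfl⟩
    exact Submodule.subset_span ⟨⟨i, s, a⟩, rfl⟩
  have htop : U = ⊤ := by
    have hEU : ∀ p, X.E p ≤ U := by
      refine le_of_graded_pieces U M fun w hw => ?_
      rcases hcover w hw with h | ⟨d, hd⟩
      · exact h.trans le_sup_left
      rw [hd]
      change X.fwd d.1 0 M ≤ X.fwdKer d.1 0 M ⊔ U
      have hshift : ∀ (c : C) (n : ℕ) (s : ℤ), X.along (X.shift^[n] (base c)).1 s M =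
          X.along (base c).1 (s + n) M := by
        intro c n s
        have h : (X.shift^[n] (base c)).1 = fun i => (base c).1 (i + n) :=
          funext fun i => shift_iterate n _ i
        rw [h, along_shift]
      rcases lt_or_gt_of_ne (fun h => hrevO_ne ⟦d⟧ (num.injective h).symm :
          num ⟦d⟧ ≠ num (revO ⟦d⟧)) with h | h
      · let c : C := ⟨⟦d⟧, h⟩
        obtain ⟨n, hn, hnd⟩ := horbit c d rfl
        obtain ⟨s', hs', -⟩ := hspan c n hn
        have e1 : X.fwd d.1 0 M = X.fwd (base c).1 n M := by
          rw [fwd, fwd, ← hnd, hshift, zero_add]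
        have e2 : X.fwdKer d.1 0 M = X.fwdKer (base c).1 n M := by
          rw [fwdKer, fwdKer, ← hnd, hshift, zero_add]
        rw [e1, e2]
        exact hs'.trans (sup_le ((hBU c s').trans le_sup_right) le_sup_left)
      · let c : C := ⟨revO ⟦d⟧, by rw [hrevO]; exact h⟩
        obtain ⟨n, hn, hnd⟩ := horbit c (X.rev d) rfl
        obtain ⟨s', -, hs'⟩ := hspan c n hn
        have hz : (0 : ℤ) - M + n = n - M := by ring
        have hrd : reverse (X.rev d).1 = d.1 := reverse_reverse d.1
        have e1 : X.fwd d.1 0 M = X.bwd (base c).1 n M := by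
          have h := X.bwd_eq (X.rev d).1 0 M
          rw [neg_zero, hrd] at h
          rw [← h, bwd, bwd, ← hnd, hshift, hz]
        have e2 : X.fwdKer d.1 0 M = X.bwdKer (base c).1 n M := by
          have h := X.bwdKer_eq (X.rev d).1 0 M
          rw [neg_zero, hrd] at h
          rw [← h, bwdKer, bwdKer, ← hnd, hshift, hz]
        rw [e1, e2]
        exact hs'.trans (sup_le ((hBU c s').trans le_sup_right) le_sup_left)
    rw [eq_top_iff, ← hE]
    exact sup_le (hEU 0) (hEU 1)
  refine ⟨?_, htop⟩
  -- Each orbit and its reverse are counted once on the left of the following inequality.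
  have hcount : 2 * ∑ c, per c * κ (base c) ≤ ∑ p, Module.finrank k (X.E p) := by
    let φ : (Σ c : C, Fin (per c)) → X.support := fun z => X.shift^[z.2] (base z.1)
    have hφ : ∀ z, (⟦φ z⟧ : Orb) = z.1.1 := by
      rintro ⟨c, n⟩
      rw [← hbase c]
      refine Quotient.sound (Equiv.Perm.SameCycle.symm ⟨n, ?_⟩)
      simp [φ, ← Equiv.Perm.coe_pow]
    let ψ : (Σ c : C, Fin (per c)) ⊕ (Σ c : C, Fin (per c)) → X.support :=
      Sum.elim φ (X.rev ∘ φ)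
    have hφ_inj : Function.Injective φ := by
      rintro ⟨c, n⟩ ⟨c', n'⟩ h
      have h1 : c = c' := Subtype.ext (by rw [← hφ ⟨c, n⟩, ← hφ ⟨c', n'⟩, h])
      subst h1
      have h2 := (Function.iterate_eq_iterate_iff_of_lt_minimalPeriod n.2 n'.2).1 h
      rw [Fin.ext h2]
    have hrev_inj : Function.Injective X.rev := fun d d' h => by
      rw [← rev_rev d, h, rev_rev]
    have hψ : Function.Injective ψ := by
      refine hφ_inj.sumElim (hrev_inj.comp hφ_inj) fun z z' h => ?_
      have h1 : z.1.1 = revO z'.1.1 := by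
        rw [← hφ z, ← hφ z', h]
        rfl
      have h2 := z.1.2
      have h3 := z'.1.2
      rw [h1, hrevO] at h2
      exact lt_asymm h2 h3
    have h1 := hsum (Finset.univ.map ⟨ψ, hψ⟩)
    rw [Finset.sum_map] at h1
    refine le_trans (le_of_eq ?_) h1
    simp only [Function.Embedding.coeFn_mk, Fintype.sum_sum_type, ψ, Sum.elim_inl, Sum.elim_inr,
      Function.comp_apply, hκ_rev, φ, hκ_shift]
    rw [← two_mul, Fintype.sum_sigma]
    simp
  have hdimE : ∑ p, Module.finrank k (X.E p) = 2 * Module.finrank k V := by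
    have h2 : X.E 2 = X.E 0 := X.E_add_two 0
    have h3 : X.E 3 = X.E 1 := X.E_add_two 1
    have h4 := Submodule.finrank_sup_add_finrank_inf_eq (X.E 0) (X.E 1)
    rw [hE, hE', finrank_top, finrank_bot] at h4
    rw [Fin.sum_univ_four, h2, h3]
    omega
  have hcard : Fintype.card (Σ i, ZMod (B (e i)).len × Fin (B (e i)).dim) =
      ∑ c, per c * κ (base c) := by
    rw [Fintype.card_sigma, ← e.sum_comp]
    refine Finset.sum_congr rfl fun i _ => ?_
    rw [Fintype.card_prod, ZMod.card, Fintype.card_fin, hlen, hdim]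
  refine linearIndependent_of_top_le_span_of_card_le_finrank htop.ge ?_
  refine hcard.le.trans ?_
  omega

end SideSystem

/-! ### Immersed curves with prescribed crossings -/

section SmoothStep

/-- A smooth function increasing from `0` on `(-∞, -1]` to `1` on `[1, ∞)`. -/
noncomputable def smoothStep (t : ℝ) : ℝ := Real.smoothTransition ((t + 1) / 2)

lemma contDiff_smoothStep : ContDiff ℝ ∞ smoothStep :=
  Real.smoothTransition.contDiff.comp ((contDiff_id.add contDiff_const).div_const 2)

lemma smoothStep_le_one (t : ℝ) : smoothStep t ≤ 1 := Real.smoothTransition.le_one _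

lemma smoothStep_nonneg (t : ℝ) : 0 ≤ smoothStep t := Real.smoothTransition.nonneg _

lemma smoothStep_of_one_le {t : ℝ} (ht : 1 ≤ t) : smoothStep t = 1 :=
  Real.smoothTransition.one_of_one_le (by linarith)

lemma smoothStep_of_le_neg_one {t : ℝ} (ht : t ≤ -1) : smoothStep t = 0 :=
  Real.smoothTransition.zero_of_nonpos (by linarith)

lemma smoothStep_zero : smoothStep 0 = 1 / 2 := by
  have h0 : 0 < expNegInvGlue (1 / 2) := expNegInvGlue.pos_of_pos (by norm_num)
  have h1 : (1 : ℝ) - 1 / 2 = 1 / 2 := by norm_num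
  rw [smoothStep, zero_add, Real.smoothTransition, h1]
  field_simp
  norm_num

lemma deriv_smoothStep_of_one_le {t : ℝ} (ht : 1 ≤ t) : deriv smoothStep t = 0 := by
  refine IsLocalMax.deriv_eq_zero (Filter.Eventually.of_forall fun x => ?_)
  rw [smoothStep_of_one_le ht]
  exact smoothStep_le_one x

lemma deriv_smoothStep_of_le_neg_one {t : ℝ} (ht : t ≤ -1) : deriv smoothStep t = 0 := by
  refine IsLocalMin.deriv_eq_zero (Filter.Eventually.of_forall fun x => ?_)
  rw [smoothStep_of_le_neg_one ht]
  exact smoothStep_nonneg x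

lemma deriv_smoothStep_pos {t : ℝ} (h1 : -1 < t) (h2 : t < 1) : 0 < deriv smoothStep t := by
  -- On the open interval the function is `1 / (1 + exp (1 / u - 1 / v))`, where `u` and `v` are
  -- proportional to the distances to the ends.
  have hev : smoothStep =ᶠ[nhds t] fun x =>
      (1 + Real.exp (((x + 1) / 2)⁻¹ - (1 - (x + 1) / 2)⁻¹))⁻¹ := by
    filter_upwards [Ioo_mem_nhds h1 h2] with x hx
    have hu : ¬ (x + 1) / 2 ≤ 0 := by have := hx.1; push Not; linarith
    have hv : ¬ 1 - (x + 1) / 2 ≤ 0 := by have := hx.2; push Not; linarith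
    rw [smoothStep, Real.smoothTransition, expNegInvGlue, expNegInvGlue, if_neg hu, if_neg hv,
      Real.exp_sub, Real.exp_neg, Real.exp_neg]
    have := Real.exp_pos ((x + 1) / 2)⁻¹
    have := Real.exp_pos (1 - (x + 1) / 2)⁻¹
    field_simp
  rw [hev.deriv_eq]
  have hu : (t + 1) / 2 ≠ 0 := by intro h; linarith
  have hv : 1 - (t + 1) / 2 ≠ 0 := by intro h; linarith
  have d1 : HasDerivAt (fun x : ℝ => (x + 1) / 2) (1 / 2) t :=
    ((hasDerivAt_id t).add_const 1).div_const 2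
  have d2 := ((d1.inv hu).sub ((d1.const_sub 1).inv hv)).exp.const_add 1
  have hpos : 0 < 1 + Real.exp (((t + 1) / 2)⁻¹ - (1 - (t + 1) / 2)⁻¹) := by positivity
  have d3 := d2.inv hpos.ne'
  have d4 := d3.deriv
  refine lt_of_lt_of_eq ?_ d4.symm
  refine div_pos ?_ (by positivity)
  rw [neg_pos]
  refine mul_neg_of_pos_of_neg (Real.exp_pos _) ?_
  have e1 : 0 < 1 / 2 / ((t + 1) / 2) ^ 2 := by positivity
  have e2 : 0 < 1 / 2 / (1 - (t + 1) / 2) ^ 2 := by positivity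
  rw [neg_neg, neg_div]
  linarith

lemma deriv_smoothStep_nonneg (t : ℝ) : 0 ≤ deriv smoothStep t := by
  rcases le_or_gt t (-1) with h | h
  · exact (deriv_smoothStep_of_le_neg_one h).ge
  rcases le_or_gt 1 t with h' | h'
  · exact (deriv_smoothStep_of_one_le h').ge
  · exact (deriv_smoothStep_pos h h').le

lemma strictMonoOn_smoothStep : StrictMonoOn smoothStep (Set.Icc (-1) 1) := by
  refine strictMonoOn_of_deriv_pos (convex_Icc _ _) contDiff_smoothStep.continuous.continuousOn ?_
  intro x hx
  rw [interior_Icc] at hx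
  exact deriv_smoothStep_pos hx.1 hx.2

end SmoothStep

section Curve

/-- The direction in which a curve leaves a square through a given side. -/
def sideDir : Fin 4 → ℤ × ℤ := ![(1, 0), (0, -1), (-1, 0), (0, 1)]

/-- A function on the integers with prescribed differences. -/
lemma exists_discrete_antideriv {A : Type*} [AddCommGroup A] (g : ℤ → A) :
    ∃ a : ℤ → A, ∀ s, a (s + 1) = a s + g s := by
  refine ⟨fun s => ∑ i ∈ Finset.range s.toNat, g i -
    ∑ i ∈ Finset.range (-s).toNat, g (-(i : ℤ) - 1), fun s => ?_⟩
  rcases lt_or_ge s 0 with h | h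
  · obtain ⟨n, rfl⟩ : ∃ n : ℕ, s = -(n : ℤ) - 1 := ⟨(-s - 1).toNat, by omega⟩
    have e1 : (-(n : ℤ) - 1 + 1).toNat = 0 := by omega
    have e2 : (-(-(n : ℤ) - 1 + 1)).toNat = n := by omega
    have e3 : (-(n : ℤ) - 1).toNat = 0 := by omega
    have e4 : (-(-(n : ℤ) - 1)).toNat = n + 1 := by omega
    simp only [e1, e2, e3, e4, Finset.sum_range_succ]
    abel
  · obtain ⟨n, rfl⟩ := Int.eq_ofNat_of_zero_le h
    have e1 : ((n : ℤ) + 1).toNat = n + 1 := by omega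
    have e2 : (-((n : ℤ) + 1)).toNat = 0 := by omega
    have e3 : (n : ℤ).toNat = n := by omega
    have e4 : (-(n : ℤ)).toNat = 0 := by omega
    simp only [e1, e2, e3, e4, Finset.sum_range_succ]
    simp

variable (σ : ℤ → Fin 4) (a : ℤ → ℤ × ℤ)

/-- The path that starts, at time `s`, at the centre of the side `σ s` of the unit square with lower
left corner `a s`, and turns smoothly to the centre of the side `σ (s + 1)` of the next square,
which it reaches at time `s + 1`. It is written as a map to `ℝ²` by coordinates. -/
noncomputable def gridPath (t : ℝ) : ℝ × ℝ :=
  (1 / 2 + (a ⌊t⌋).1 + smoothStep (t - ⌊t⌋) * (sideDir (σ ⌊t⌋)).1 +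
      smoothStep (t - ⌊t⌋ - 1) * (sideDir (σ (⌊t⌋ + 1))).1,
    1 / 2 + (a ⌊t⌋).2 + smoothStep (t - ⌊t⌋) * (sideDir (σ ⌊t⌋)).2 +
      smoothStep (t - ⌊t⌋ - 1) * (sideDir (σ (⌊t⌋ + 1))).2)

/-- A smooth formula for `gridPath` near time `s`. -/
noncomputable def gridPathNear (s : ℤ) (t : ℝ) : ℝ × ℝ :=
  (1 / 2 + (a (s - 1)).1 + smoothStep (t - s + 1) * (sideDir (σ (s - 1))).1 +
      smoothStep (t - s) * (sideDir (σ s)).1 + smoothStep (t - s - 1) * (sideDir (σ (s + 1))).1,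
    1 / 2 + (a (s - 1)).2 + smoothStep (t - s + 1) * (sideDir (σ (s - 1))).2 +
      smoothStep (t - s) * (sideDir (σ s)).2 + smoothStep (t - s - 1) * (sideDir (σ (s + 1))).2)

variable {σ a} (ha : ∀ s, a (s + 1) = a s + sideDir (σ s))
include ha

lemma gridPath_eq_near {s : ℤ} {t : ℝ} (h1 : (s : ℝ) - 1 < t) (h2 : t < s + 1) :
    gridPath σ a t = gridPathNear σ a s t := by
  have hs := ha (s - 1)
  rw [sub_add_cancel] at hs
  rcases lt_or_ge t s with h | h
  · have hf : ⌊t⌋ = s - 1 := by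
      rw [Int.floor_eq_iff]
      push_cast
      constructor <;> linarith
    have e1 : smoothStep (t - s - 1) = 0 := smoothStep_of_le_neg_one (by linarith)
    rw [gridPath, gridPathNear, hf, e1, sub_add_cancel]
    push_cast
    have e2 : t - ((s : ℝ) - 1) = t - s + 1 := by ring
    have e3 : t - s + 1 - 1 = t - s := by ring
    rw [e2, e3]
    simp
  · have hf : ⌊t⌋ = s := by
      rw [Int.floor_eq_iff]
      exact ⟨h, h2⟩
    have e1 : smoothStep (t - s + 1) = 1 := smoothStep_of_one_le (by linarith)
    rw [gridPath, gridPathNear, hf, e1, hs]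
    simp only [Prod.fst_add, Prod.snd_add]
    push_cast
    ext
    · ring
    · ring

/-- The formula of `gridPath` holds up to the end of each unit interval. -/
lemma gridPath_eq {s : ℤ} {t : ℝ} (h1 : (s : ℝ) ≤ t) (h2 : t ≤ s + 1) :
    gridPath σ a t = (1 / 2 + (a s).1 + smoothStep (t - s) * (sideDir (σ s)).1 +
      smoothStep (t - s - 1) * (sideDir (σ (s + 1))).1,
    1 / 2 + (a s).2 + smoothStep (t - s) * (sideDir (σ s)).2 +
      smoothStep (t - s - 1) * (sideDir (σ (s + 1))).2) := by
  rcases h2.lt_or_eq with h | h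
  · have hf : ⌊t⌋ = s := by
      rw [Int.floor_eq_iff]
      exact ⟨h1, h⟩
    rw [gridPath, hf]
  · have hf : ⌊t⌋ = s + 1 := by
      rw [h]
      exact_mod_cast Int.floor_intCast (s + 1)
    rw [gridPath, hf, h, ha]
    push_cast
    have e1 : (s : ℝ) + 1 - (s + 1) = 0 := by ring
    have e2 : (s : ℝ) + 1 - s = 1 := by ring
    have e3 : smoothStep (0 - 1) = 0 := smoothStep_of_le_neg_one (by norm_num)
    have e4 : smoothStep 1 = 1 := smoothStep_of_one_le le_rfl
    rw [e1, e2, e3, e4, sub_self]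
    simp only [Prod.fst_add, Prod.snd_add]
    push_cast
    ext
    · ring
    · ring

lemma gridPath_eventuallyEq (t : ℝ) : gridPath σ a =ᶠ[nhds t] gridPathNear σ a ⌊t⌋ := by
  filter_upwards [Ioo_mem_nhds (show (⌊t⌋ : ℝ) - 1 < t by linarith [Int.floor_le t])
    (Int.lt_floor_add_one t)] with x hx
  exact gridPath_eq_near ha hx.1 hx.2

omit ha in
lemma contDiff_gridPathNear (s : ℤ) : ContDiff ℝ ∞ (gridPathNear σ a s) := by
  have h : ∀ c : ℝ, ContDiff ℝ ∞ fun t : ℝ => smoothStep (t + c) := fun c =>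
    contDiff_smoothStep.comp (contDiff_id.add contDiff_const)
  have e1 : ∀ t : ℝ, t - s + 1 = t + (-s + 1) := fun t => by ring
  have e2 : ∀ t : ℝ, t - s = t + -s := fun t => by ring
  have e3 : ∀ t : ℝ, t - s - 1 = t + (-s - 1) := fun t => by ring
  unfold gridPathNear
  simp only [e1, e3]
  simp only [e2]
  refine ContDiff.prodMk ?_ ?_ <;>
  exact ((contDiff_const.add ((h _).mul contDiff_const)).add ((h _).mul contDiff_const)).add
    ((h _).mul contDiff_const)

lemma contDiff_gridPath : ContDiff ℝ ∞ (gridPath σ a) :=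
  contDiff_iff_contDiffAt.2 fun t =>
    (contDiff_gridPathNear ⌊t⌋).contDiffAt.congr_of_eventuallyEq (gridPath_eventuallyEq ha t)

lemma deriv_gridPath (t : ℝ) : deriv (gridPath σ a) t =
    (deriv smoothStep (t - ⌊t⌋) * (sideDir (σ ⌊t⌋)).1 +
      deriv smoothStep (t - ⌊t⌋ - 1) * (sideDir (σ (⌊t⌋ + 1))).1,
    deriv smoothStep (t - ⌊t⌋) * (sideDir (σ ⌊t⌋)).2 +
      deriv smoothStep (t - ⌊t⌋ - 1) * (sideDir (σ (⌊t⌋ + 1))).2) := by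
  rw [(gridPath_eventuallyEq ha t).deriv_eq]
  have hst : ∀ x, HasDerivAt smoothStep (deriv smoothStep x) x := fun x =>
    (contDiff_smoothStep.differentiable (by simp) x).hasDerivAt
  have d0 : HasDerivAt (fun x : ℝ => x - ⌊t⌋) 1 t := (hasDerivAt_id t).sub_const _
  have d1 := (hst (t - ⌊t⌋)).comp t d0
  have d2 := (hst (t - ⌊t⌋ - 1)).comp t (d0.sub_const 1)
  have d3 := (hst (t - ⌊t⌋ + 1)).comp t (d0.add_const 1)
  have hz : deriv smoothStep (t - ⌊t⌋ + 1) = 0 :=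
    deriv_smoothStep_of_one_le (by linarith [Int.floor_le t])
  rw [hz, zero_mul] at d3
  rw [mul_one] at d1 d2
  have key : ∀ c p q r : ℝ, HasDerivAt (fun x : ℝ => c + smoothStep (x - ⌊t⌋ + 1) * p +
      smoothStep (x - ⌊t⌋) * q + smoothStep (x - ⌊t⌋ - 1) * r)
      (deriv smoothStep (t - ⌊t⌋) * q + deriv smoothStep (t - ⌊t⌋ - 1) * r) t := by
    intro c p q r
    have h := (((d3.mul_const p).const_add c).add (d1.mul_const q)).add (d2.mul_const r)
    rw [zero_mul, zero_add] at h
    exact h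
  exact (HasDerivAt.prodMk (key _ _ _ _) (key _ _ _ _)).deriv

omit ha in
lemma sideDir_turn {p q : Fin 4} (h : q ≠ p + 2) {x y : ℝ} (hx : 0 < x) (hy : 0 ≤ y) :
    0 < (x * (sideDir p).1 + y * (sideDir q).1) * (sideDir p).1 +
      (x * (sideDir p).2 + y * (sideDir q).2) * (sideDir p).2 := by
  fin_cases p <;> fin_cases q <;> first | (exact absurd rfl h) | skip
  all_goals simp [sideDir]
  all_goals linarith

lemma deriv_gridPath_ne_zero {t : ℝ} (h : σ (⌊t⌋ + 1) ≠ σ ⌊t⌋ + 2) :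
    deriv (gridPath σ a) t ≠ 0 := by
  intro h0
  rw [deriv_gridPath ha, Prod.mk_eq_zero] at h0
  have h1 := sideDir_turn h (deriv_smoothStep_pos (t := t - ⌊t⌋) (by linarith [Int.floor_le t])
    (by linarith [Int.lt_floor_add_one t])) (deriv_smoothStep_nonneg (t - ⌊t⌋ - 1))
  rw [h0.1, h0.2] at h1
  simp at h1

lemma injOn_gridPath {s : ℤ} (h : σ (s + 1) ≠ σ s + 2) :
    Set.InjOn (gridPath σ a) (Set.Icc (s : ℝ) (s + 1)) := by
  have key : ∀ t t' : ℝ, (s : ℝ) ≤ t → t < t' → t' ≤ s + 1 →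
      gridPath σ a t ≠ gridPath σ a t' := by
    intro t t' h1 h2 h3 heq
    rw [gridPath_eq ha h1 (by linarith), gridPath_eq ha (by linarith) h3, Prod.mk.injEq] at heq
    have e1 : smoothStep (t - s) < smoothStep (t' - s) :=
      strictMonoOn_smoothStep ⟨by linarith, by linarith⟩ ⟨by linarith, by linarith⟩ (by linarith)
    have e2 : smoothStep (t - s - 1) < smoothStep (t' - s - 1) :=
      strictMonoOn_smoothStep ⟨by linarith, by linarith⟩ ⟨by linarith, by linarith⟩ (by linarith)
    have e3 := sideDir_turn h (sub_pos.2 e1) (sub_pos.2 e2).le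
    have e4 : (smoothStep (t' - s) - smoothStep (t - s)) * (sideDir (σ s)).1 +
        (smoothStep (t' - s - 1) - smoothStep (t - s - 1)) * (sideDir (σ (s + 1))).1 = 0 := by
      linarith [heq.1]
    have e5 : (smoothStep (t' - s) - smoothStep (t - s)) * (sideDir (σ s)).2 +
        (smoothStep (t' - s - 1) - smoothStep (t - s - 1)) * (sideDir (σ (s + 1))).2 = 0 := by
      linarith [heq.2]
    rw [e4, e5] at e3
    simp at e3
  intro t ht t' ht' heq
  rcases lt_trichotomy t t' with hlt | hlt | hlt
  · exact absurd heq (key t t' ht.1 hlt ht'.2)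
  · exact hlt
  · exact absurd heq.symm (key t' t ht'.1 hlt ht.2)

omit ha in
lemma half_add_ne_int {w : ℝ} (hw : (-(1 / 2) < w ∧ w < 1 / 2) ∨ (1 / 2 < w ∧ w < 3 / 2) ∨
    (-(3 / 2) < w ∧ w < -(1 / 2))) (m b : ℤ) : 1 / 2 + (m : ℝ) + w ≠ b := by
  intro h
  have h2 : ((b - m : ℤ) : ℝ) = 1 / 2 + w := by push_cast; linarith
  obtain ⟨h3, h4⟩ | ⟨h3, h4⟩ | ⟨h3, h4⟩ := hw
  · have e1 : (0 : ℝ) < ((b - m : ℤ) : ℝ) := by linarith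
    have e2 : ((b - m : ℤ) : ℝ) < (1 : ℤ) := by push_cast at h2 ⊢; linarith
    have e3 : 0 < b - m := by exact_mod_cast e1
    have e4 : b - m < 1 := by exact_mod_cast e2
    omega
  · have e1 : ((1 : ℤ) : ℝ) < ((b - m : ℤ) : ℝ) := by push_cast at h2 ⊢; linarith
    have e2 : ((b - m : ℤ) : ℝ) < (2 : ℤ) := by push_cast at h2 ⊢; linarith
    have e3 : 1 < b - m := by exact_mod_cast e1
    have e4 : b - m < 2 := by exact_mod_cast e2
    omega
  · have e1 : ((-1 : ℤ) : ℝ) < ((b - m : ℤ) : ℝ) := by push_cast at h2 ⊢; linarith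
    have e2 : ((b - m : ℤ) : ℝ) < (0 : ℤ) := by push_cast at h2 ⊢; linarith
    have e3 : -1 < b - m := by exact_mod_cast e1
    have e4 : b - m < 0 := by exact_mod_cast e2
    omega

omit ha in
/-- Between two crossings the path stays away from the grid. -/
lemma gridPath_off_grid {t : ℝ} (h : σ (⌊t⌋ + 1) ≠ σ ⌊t⌋ + 2) (ht : (⌊t⌋ : ℝ) ≠ t) (b : ℤ) :
    (gridPath σ a t).1 ≠ b ∧ (gridPath σ a t).2 ≠ b := by
  have h0 : 0 < t - ⌊t⌋ := by
    have := lt_of_le_of_ne (Int.floor_le t) ht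
    linarith
  have h1 : t - ⌊t⌋ < 1 := by linarith [Int.lt_floor_add_one t]
  have e1 : 1 / 2 < smoothStep (t - ⌊t⌋) := by
    rw [← smoothStep_zero]
    exact strictMonoOn_smoothStep ⟨by norm_num, by norm_num⟩ ⟨by linarith, by linarith⟩ h0
  have e2 : smoothStep (t - ⌊t⌋) < 1 := by
    rw [← smoothStep_of_one_le (t := 1) le_rfl]
    exact strictMonoOn_smoothStep ⟨by linarith, by linarith⟩ ⟨by norm_num, by norm_num⟩ h1
  have e3 : smoothStep (t - ⌊t⌋ - 1) < 1 / 2 := by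
    rw [← smoothStep_zero]
    exact strictMonoOn_smoothStep ⟨by linarith, by linarith⟩ ⟨by norm_num, by norm_num⟩
      (by linarith)
  have e4 : 0 < smoothStep (t - ⌊t⌋ - 1) := by
    rw [← smoothStep_of_le_neg_one (t := -1) le_rfl]
    exact strictMonoOn_smoothStep ⟨by norm_num, by norm_num⟩ ⟨by linarith, by linarith⟩
      (by linarith)
  rw [gridPath]
  generalize smoothStep (t - ⌊t⌋) = x at *
  generalize smoothStep (t - ⌊t⌋ - 1) = y at *
  generalize σ (⌊t⌋ + 1) = q at *
  generalize σ ⌊t⌋ = p at *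
  have hx : (-(1 / 2 : ℝ) < x * (sideDir p).1 + y * (sideDir q).1 ∧
      x * (sideDir p).1 + y * (sideDir q).1 < 1 / 2) ∨
      (1 / 2 < x * (sideDir p).1 + y * (sideDir q).1 ∧
        x * (sideDir p).1 + y * (sideDir q).1 < 3 / 2) ∨
      (-(3 / 2 : ℝ) < x * (sideDir p).1 + y * (sideDir q).1 ∧
        x * (sideDir p).1 + y * (sideDir q).1 < -(1 / 2)) := by
    fin_cases p <;> fin_cases q <;> first | (exact absurd rfl h) | skip
    all_goals simp only [sideDir]
    all_goals norm_num
    all_goals first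
      | (left; constructor <;> linarith)
      | (right; left; constructor <;> linarith)
      | (right; right; constructor <;> linarith)
  have hy : (-(1 / 2 : ℝ) < x * (sideDir p).2 + y * (sideDir q).2 ∧
      x * (sideDir p).2 + y * (sideDir q).2 < 1 / 2) ∨
      (1 / 2 < x * (sideDir p).2 + y * (sideDir q).2 ∧
        x * (sideDir p).2 + y * (sideDir q).2 < 3 / 2) ∨
      (-(3 / 2 : ℝ) < x * (sideDir p).2 + y * (sideDir q).2 ∧
        x * (sideDir p).2 + y * (sideDir q).2 < -(1 / 2)) := by
    fin_cases p <;> fin_cases q <;> first | (exact absurd rfl h) | skip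
    all_goals simp only [sideDir]
    all_goals norm_num
    all_goals first
      | (left; constructor <;> linarith)
      | (right; left; constructor <;> linarith)
      | (right; right; constructor <;> linarith)
  constructor
  · rw [add_assoc]
    exact half_add_ne_int hx _ _
  · change 1 / 2 + ((a ⌊t⌋).2 : ℝ) + _ + _ ≠ _
    rw [add_assoc]
    exact half_add_ne_int hy _ _

lemma gridPath_int (s : ℤ) : gridPath σ a s = ((1 / 2 + (a s).1 + 1 / 2 * (sideDir (σ s)).1 : ℝ),
    (1 / 2 + (a s).2 + 1 / 2 * (sideDir (σ s)).2 : ℝ)) := by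
  rw [gridPath_eq ha le_rfl (by linarith), sub_self, smoothStep_zero,
    smoothStep_of_le_neg_one (t := 0 - 1) (by norm_num)]
  simp

lemma deriv_gridPath_int (s : ℤ) : deriv (gridPath σ a) s =
    (deriv smoothStep 0 * (sideDir (σ s)).1, deriv smoothStep 0 * (sideDir (σ s)).2) := by
  rw [deriv_gridPath ha, Int.floor_intCast, sub_self,
    deriv_smoothStep_of_le_neg_one (t := 0 - 1) (by norm_num)]
  simp

end Curve

/-- Every closed path through the sides of the square which never turns back is the sequence of
crossings of an immersed curve in reduced position. -/
theorem exists_immersedCurve (n : ℕ) [NeZero n] (side : ZMod n → Fin 4)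
    (hred : ∀ s, side (s + 1) ≠ side s + 2) :
    ∃ (γ : ImmersedCurve) (time : ℤ → ℝ), StrictMono time ∧ (∀ s, time (s + n) = time s + 1) ∧
      (∀ t, γ.OnGrid t ↔ t ∈ Set.range time) ∧
      (∀ s : ℤ, γ.LeavesThrough (time s) (side (s : ZMod n))) ∧
      ∀ s : ℤ, Set.InjOn γ.lift (Set.Icc (time s) (time (s + 1))) := by
  obtain ⟨σ, hσ⟩ : ∃ σ : ℤ → Fin 4, ∀ s, σ s = side (s : ZMod n) := ⟨_, fun _ => rfl⟩
  obtain ⟨a, ha⟩ := exists_discrete_antideriv fun s : ℤ => sideDir (σ s)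
  have hσred : ∀ s, σ (s + 1) ≠ σ s + 2 := fun s => by simpa [hσ] using hred s
  have hσper : ∀ s, σ (s + n) = σ s := fun s => by simp [hσ]
  have hn : (0 : ℝ) < n := Nat.cast_pos.2 (Nat.pos_of_ne_zero (NeZero.ne n))
  have haper : ∀ s, a (s + n) = a s + (a n - a 0) := by
    have hstep : ∀ s, a (s + 1 + n) - a (s + 1) = a (s + n) - a s := by
      intro s
      have e : s + 1 + n = s + n + 1 := by ring
      rw [e, ha, ha, hσper]
      abel
    have hconst : ∀ s, a (s + n) - a s = a n - a 0 := by
      intro s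
      induction s using Int.induction_on with
      | zero => simp
      | succ i ih => rw [hstep, ih]
      | pred i ih => rw [← ih, ← hstep, sub_add_cancel]
    intro s
    rw [← hconst s]
    abel
  have hper : ∀ u : ℝ, gridPath σ a (u + n) =
      gridPath σ a u + (((a n - a 0).1 : ℝ), ((a n - a 0).2 : ℝ)) := by
    intro u
    have hf : ⌊u + n⌋ = ⌊u⌋ + n := Int.floor_add_natCast u n
    have e1 : u + n - (⌊u⌋ + n : ℤ) = u - ⌊u⌋ := by push_cast; ring
    have e2 : ⌊u⌋ + (n : ℤ) + 1 = ⌊u⌋ + 1 + n := by ring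
    rw [gridPath, hf, e1, hσper, e2, hσper, haper, gridPath]
    simp only [Prod.fst_add, Prod.snd_add, Prod.mk_add_mk]
    push_cast
    ext
    · ring
    · ring
  have hderiv : ∀ t : ℝ, deriv (fun t : ℝ => gridPath σ a (t * n)) t =
      (n : ℝ) • deriv (gridPath σ a) (t * n) := by
    intro t
    have d1 : HasDerivAt (fun t : ℝ => t * n) (n : ℝ) t := by
      simpa using (hasDerivAt_id t).mul_const (n : ℝ)
    have d2 := ((contDiff_gridPath ha).differentiable (by simp) (t * n)).hasDerivAt
    exact (d2.scomp t d1).deriv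
  have hgrid : ∀ u : ℝ, ((∃ b : ℤ, (gridPath σ a u).1 = b) ∨ (∃ b : ℤ, (gridPath σ a u).2 = b)) ↔
      (⌊u⌋ : ℝ) = u := by
    intro u
    constructor
    · intro h
      by_contra hu
      obtain ⟨b, hb⟩ | ⟨b, hb⟩ := h
      · exact (gridPath_off_grid (hσred _) hu b).1 hb
      · exact (gridPath_off_grid (hσred _) hu b).2 hb
    · intro h
      rw [← h, gridPath_int ha]
      generalize σ ⌊u⌋ = p
      fin_cases p
      · exact Or.inl ⟨(a ⌊u⌋).1 + 1, by simp [sideDir]; ring⟩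
      · exact Or.inr ⟨(a ⌊u⌋).2, by simp [sideDir]⟩
      · exact Or.inl ⟨(a ⌊u⌋).1, by simp [sideDir]⟩
      · exact Or.inr ⟨(a ⌊u⌋).2 + 1, by simp [sideDir]; ring⟩
  let γ : ImmersedCurve :=
    { lift := fun t => gridPath σ a (t * n)
      smooth := (contDiff_gridPath ha).comp (contDiff_id.mul contDiff_const)
      immersed := fun t => by
        rw [hderiv]
        exact smul_ne_zero hn.ne' (deriv_gridPath_ne_zero ha (hσred _))
      closed := ⟨(a n - a 0).1, (a n - a 0).2, fun t => by
        rw [add_mul, one_mul]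
        exact hper _⟩
      avoids_puncture := fun t b c h => by
        have hu : (⌊t * n⌋ : ℝ) = t * n := (hgrid _).1 (Or.inl ⟨b, congrArg Prod.fst h⟩)
        rw [← hu, gridPath_int ha, Prod.mk.injEq] at h
        -- On the grid exactly one coordinate is an integer and the other one a half-integer.
        have key : ∀ m z : ℤ, (1 : ℝ) / 2 + m + 1 / 2 * (0 : ℤ) ≠ z := fun m z =>
          half_add_ne_int (by norm_num) m z
        generalize σ ⌊t * n⌋ = p at h
        fin_cases p
        · exact key _ _ h.2
        · exact key _ _ h.1
        · exact key _ _ h.2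
        · exact key _ _ h.1 }
  have htime : ∀ s : ℤ, (s : ℝ) / n * n = s := fun s => div_mul_cancel₀ _ hn.ne'
  refine ⟨γ, fun s => s / n, ?_, ?_, ?_, ?_, ?_⟩
  · intro s s' hs
    exact div_lt_div_of_pos_right (by exact_mod_cast hs) hn
  · intro s
    push_cast
    rw [add_div, div_self hn.ne']
  · intro t
    refine (hgrid (t * n)).trans ⟨fun h => ⟨⌊t * n⌋, ?_⟩, ?_⟩
    · simp only [h]
      exact mul_div_cancel_right₀ _ hn.ne'
    · rintro ⟨s, rfl⟩
      simp only [htime, Int.floor_intCast]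
  · intro s
    have hpos : 0 < (n : ℝ) * deriv smoothStep 0 :=
      mul_pos hn (deriv_smoothStep_pos (by norm_num) (by norm_num))
    have e1 : γ.lift (s / n) = gridPath σ a s := by
      change gridPath σ a (s / n * n) = _
      rw [htime]
    have e2 : deriv γ.lift (s / n) = (n : ℝ) • deriv (gridPath σ a) s := by
      change deriv (fun t : ℝ => gridPath σ a (t * n)) (s / n) = _
      rw [hderiv, htime]
    rw [gridPath_int ha] at e1
    rw [deriv_gridPath_int ha] at e2
    change γ.LeavesThrough (s / n) (side s)
    rw [← hσ]
    generalize σ s = p at e1 e2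
    fin_cases p
    · refine ⟨⟨(a s).1 + 1, ?_⟩, ?_⟩
      · rw [e1]; simp [sideDir]; ring
      · rw [e2]; simpa [sideDir] using hpos
    · refine ⟨⟨(a s).2, ?_⟩, ?_⟩
      · rw [e1]; simp [sideDir]
      · rw [e2]; simpa [sideDir] using hpos
    · refine ⟨⟨(a s).1, ?_⟩, ?_⟩
      · rw [e1]; simp [sideDir]
      · rw [e2]; simpa [sideDir] using hpos
    · refine ⟨⟨(a s).2 + 1, ?_⟩, ?_⟩
      · rw [e1]; simp [sideDir]; ring
      · rw [e2]; simpa [sideDir] using hpos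
  · intro s t ht t' ht' h
    have hinj := injOn_gridPath ha (hσred s)
    have hmem : ∀ t ∈ Set.Icc ((s : ℝ) / n) ((s + 1 : ℤ) / n),
        t * n ∈ Set.Icc (s : ℝ) (s + 1) := by
      intro t ht
      rw [Set.mem_Icc, div_le_iff₀ hn, le_div_iff₀ hn] at ht
      push_cast at ht
      exact ht
    exact mul_right_cancel₀ hn.ne' (hinj (hmem t ht) (hmem t' ht') h)

/-! ### From acyclic filtered complexes to systems of relations -/

/-- A differential on `E 0 ⊕ E 1 ⊕ E 2 ⊕ E 3` which strictly increases the filtration by the index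
and has no homology. The summands are indexed by the sides of the square, and opposite sides carry
the same subspace of `V`. The map `M` is defined on all of `V ^ 4`; only its restriction to the sum
of the `E p` matters. -/
structure FilteredComplex (k V : Type*) [Field k] [AddCommGroup V] [Module k V] where
  E : Fin 4 → Submodule k V
  E_add_two : ∀ p, E (p + 2) = E p
  M : (Fin 4 → V) →ₗ[k] (Fin 4 → V)
  M_mem : ∀ w q, M w q ∈ E q
  strict : ∀ w q, (∀ r < q, w r = 0) → M w q = 0
  sq : ∀ w, M (M w) = 0
  acyclic : ∀ w, (∀ p, w p ∈ E p) → M w = 0 → ∃ u, (∀ p, u p ∈ E p) ∧ M u = w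

namespace FilteredComplex

variable {k V : Type*} [Field k] [AddCommGroup V] [Module k V] (C : FilteredComplex k V)

/-- The filtration: families supported in degrees at least `n`. -/
def filt (n : ℕ) : Submodule k (Fin 4 → V) where
  carrier := {w | (∀ p, w p ∈ C.E p) ∧ ∀ r : Fin 4, r.val < n → w r = 0}
  zero_mem' := ⟨fun p => (C.E p).zero_mem, fun _ _ => rfl⟩
  add_mem' := by
    rintro a b ⟨h1, h2⟩ ⟨h1', h2'⟩
    refine ⟨fun p => (C.E p).add_mem (h1 p) (h1' p), fun r hr => ?_⟩
    rw [Pi.add_apply, h2 r hr, h2' r hr, add_zero]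
  smul_mem' := by
    rintro c a ⟨h1, h2⟩
    refine ⟨fun p => (C.E p).smul_mem c (h1 p), fun r hr => ?_⟩
    rw [Pi.smul_apply, h2 r hr, smul_zero]

lemma filt_succ {w : Fin 4 → V} (p : Fin 4) :
    w ∈ C.filt (p.val + 1) ↔ w ∈ C.filt p.val ∧ w p = 0 := by
  constructor
  · rintro ⟨h1, h2⟩
    exact ⟨⟨h1, fun r hr => h2 r (by omega)⟩, h2 p (by omega)⟩
  · rintro ⟨⟨h1, h2⟩, h3⟩
    refine ⟨h1, fun r hr => ?_⟩
    rcases Nat.lt_succ_iff_lt_or_eq.1 hr with h | h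
    · exact h2 r h
    · rw [Fin.ext h]
      exact h3

lemma filt_four {w : Fin 4 → V} : w ∈ C.filt 4 ↔ w = 0 := by
  constructor
  · rintro ⟨-, h2⟩
    exact funext fun r => h2 r r.2
  · rintro rfl
    exact zero_mem _

lemma filt_zero {w : Fin 4 → V} (h : ∀ p, w p ∈ C.E p) : w ∈ C.filt 0 :=
  ⟨h, fun _ hr => absurd hr (Nat.not_lt_zero _)⟩

lemma M_filt {w : Fin 4 → V} {n : ℕ} (hw : w ∈ C.filt n) : C.M w ∈ C.filt (n + 1) :=
  ⟨C.M_mem w, fun r hr => C.strict w r fun i hi => hw.2 i (by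
    have : i.val < r.val := hi
    omega)⟩

/-- The leading terms in degree `p` of elements of filtration `p` whose boundary has filtration
`n`. -/
def cycles (p : Fin 4) (n : ℕ) : Submodule k V :=
  (C.filt p.val ⊓ (C.filt n).comap C.M).map (LinearMap.proj p)

/-- The leading terms in degree `p` of boundaries, of filtration `p`, of elements of
filtration `n`. -/
def boundaries (n : ℕ) (p : Fin 4) : Submodule k V :=
  (C.filt n ⊓ (C.filt p.val).comap C.M).map ((LinearMap.proj p).comp C.M)

/-- The differential as a relation between leading terms in degree `p` and in degree `q`. -/
def lead (p q : Fin 4) : Submodule k (V × V) :=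
  (C.filt p.val ⊓ (C.filt q.val).comap C.M).map
    ((LinearMap.proj p).prod ((LinearMap.proj q).comp C.M))

lemma mem_lead {p q : Fin 4} {x y : V} : (x, y) ∈ C.lead p q ↔
    ∃ w, w ∈ C.filt p.val ∧ C.M w ∈ C.filt q.val ∧ w p = x ∧ C.M w q = y := by
  simp [lead, and_assoc]

lemma dom_lead (p q : Fin 4) : relDom (C.lead p q) = C.cycles p q.val := by
  ext x
  simp [mem_relDom, mem_lead, cycles, and_assoc]

lemma ker_lead (p q : Fin 4) : relKer (C.lead p q) = C.cycles p (q.val + 1) := by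
  ext x
  simp only [mem_relKer, mem_lead, cycles, Submodule.mem_map, Submodule.mem_inf,
    Submodule.mem_comap, filt_succ, LinearMap.proj_apply]
  exact exists_congr fun w => by tauto

lemma dom_inv_lead (p q : Fin 4) : relDom (relInv (C.lead q p)) = C.boundaries q.val p := by
  ext x
  simp only [mem_relDom, mem_relInv, mem_lead, boundaries, Submodule.mem_map, Submodule.mem_inf,
    Submodule.mem_comap, LinearMap.comp_apply, LinearMap.proj_apply]
  constructor
  · rintro ⟨y, w, h1, h2, _, h4⟩
    exact ⟨w, ⟨h1, h2⟩, h4⟩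
  · rintro ⟨w, ⟨h1, h2⟩, h4⟩
    exact ⟨_, w, h1, h2, rfl, h4⟩

lemma ker_inv_lead (p q : Fin 4) :
    relKer (relInv (C.lead q p)) = C.boundaries (q.val + 1) p := by
  ext x
  simp only [mem_relKer, mem_relInv, mem_lead, boundaries, Submodule.mem_map, Submodule.mem_inf,
    Submodule.mem_comap, filt_succ, LinearMap.comp_apply, LinearMap.proj_apply]
  exact exists_congr fun w => by tauto

/-- Acyclicity: the leading terms of cycles are the leading terms of boundaries. -/
lemma cycles_four (p : Fin 4) : C.cycles p 4 = C.boundaries 0 p := by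
  ext x
  simp only [cycles, boundaries, Submodule.mem_map, Submodule.mem_inf, Submodule.mem_comap,
    filt_four, LinearMap.comp_apply, LinearMap.proj_apply]
  constructor
  · rintro ⟨w, ⟨h1, h2⟩, rfl⟩
    obtain ⟨u, hu, rfl⟩ := C.acyclic w h1.1 h2
    exact ⟨u, ⟨C.filt_zero hu, h1⟩, rfl⟩
  · rintro ⟨u, ⟨_, h2⟩, rfl⟩
    exact ⟨C.M u, ⟨h2, C.sq u⟩, rfl⟩

lemma boundaries_self (p : Fin 4) : C.boundaries p.val p = ⊥ := by
  rw [eq_bot_iff]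
  rintro x ⟨w, ⟨h1, _⟩, rfl⟩
  exact ((C.filt_succ p).1 (C.M_filt h1)).2

lemma cycles_succ (p : Fin 4) : C.cycles p (p.val + 1) = C.E p := by
  classical
  refine le_antisymm ?_ fun x hx => ?_
  · rintro x ⟨w, ⟨h1, _⟩, rfl⟩
    exact h1.1 p
  · have h : Pi.single p x ∈ C.filt p.val := by
      refine ⟨fun q => ?_, fun r hr => ?_⟩
      · rcases eq_or_ne q p with rfl | h
        · rwa [Pi.single_eq_same]
        · rw [Pi.single_eq_of_ne h]
          exact zero_mem _
      · rw [Pi.single_eq_of_ne]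
        rintro rfl
        exact lt_irrefl _ hr
    exact ⟨Pi.single p x, ⟨h, C.M_filt h⟩, Pi.single_eq_same (M := fun _ => V) p x⟩

/-- The relation between leading terms in degrees `p ≠ q`: the differential if `p < q`, and its
converse if `q < p`. -/
def crossRel (p q : Fin 4) : Submodule k (V × V) :=
  if p < q then C.lead p q else if q < p then relInv (C.lead q p) else ⊥

lemma crossRel_of_lt {p q : Fin 4} (h : p < q) : C.crossRel p q = C.lead p q := if_pos h

lemma crossRel_of_gt {p q : Fin 4} (h : q < p) : C.crossRel p q = relInv (C.lead q p) := by
  rw [crossRel, if_neg (lt_asymm h), if_pos h]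

lemma relInv_crossRel (p q : Fin 4) : relInv (C.crossRel p q) = C.crossRel q p := by
  rcases lt_trichotomy p q with h | rfl | h
  · rw [C.crossRel_of_lt h, C.crossRel_of_gt h]
  · have h0 : C.crossRel p p = ⊥ := by simp [crossRel]
    rw [h0]
    ext ⟨x, y⟩
    rw [mem_relInv, Submodule.mem_bot, Submodule.mem_bot, Prod.mk_eq_zero, Prod.mk_eq_zero,
      and_comm]
  · rw [C.crossRel_of_lt h, C.crossRel_of_gt h, relInv_relInv]

lemma dom_crossRel_lt {p q : Fin 4} (h : p < q) : relDom (C.crossRel p q) = C.cycles p q.val := by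
  rw [C.crossRel_of_lt h, dom_lead]

lemma ker_crossRel_lt {p q : Fin 4} (h : p < q) :
    relKer (C.crossRel p q) = C.cycles p (q.val + 1) := by
  rw [C.crossRel_of_lt h, ker_lead]

lemma dom_crossRel_gt {p q : Fin 4} (h : q < p) :
    relDom (C.crossRel p q) = C.boundaries q.val p := by
  rw [C.crossRel_of_gt h, dom_inv_lead]

lemma ker_crossRel_gt {p q : Fin 4} (h : q < p) :
    relKer (C.crossRel p q) = C.boundaries (q.val + 1) p := by
  rw [C.crossRel_of_gt h, ker_inv_lead]

/-- Along the cyclic order of the sides other than `p`, starting at `p - 1` and going down to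
`p + 1`, the domains of the relations form a complete flag. -/
lemma crossRel_flag (p : Fin 4) : relKer (C.crossRel p (p + 3)) = ⊥ ∧
    relKer (C.crossRel p (p + 2)) = relDom (C.crossRel p (p + 3)) ∧
    relKer (C.crossRel p (p + 1)) = relDom (C.crossRel p (p + 2)) ∧
    relDom (C.crossRel p (p + 1)) = C.E p := by
  fin_cases p
  · refine ⟨?_, ?_, ?_, ?_⟩
    · exact (C.ker_crossRel_lt (p := 0) (q := 3) (by decide)).trans
        ((C.cycles_four 0).trans (C.boundaries_self 0))
    · exact (C.ker_crossRel_lt (p := 0) (q := 2) (by decide)).trans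
        (C.dom_crossRel_lt (p := 0) (q := 3) (by decide)).symm
    · exact (C.ker_crossRel_lt (p := 0) (q := 1) (by decide)).trans
        (C.dom_crossRel_lt (p := 0) (q := 2) (by decide)).symm
    · exact (C.dom_crossRel_lt (p := 0) (q := 1) (by decide)).trans (C.cycles_succ 0)
  · refine ⟨?_, ?_, ?_, ?_⟩
    · exact (C.ker_crossRel_gt (p := 1) (q := 0) (by decide)).trans (C.boundaries_self 1)
    · exact (C.ker_crossRel_lt (p := 1) (q := 3) (by decide)).trans
        ((C.cycles_four 1).trans (C.dom_crossRel_gt (p := 1) (q := 0) (by decide)).symm)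
    · exact (C.ker_crossRel_lt (p := 1) (q := 2) (by decide)).trans
        (C.dom_crossRel_lt (p := 1) (q := 3) (by decide)).symm
    · exact (C.dom_crossRel_lt (p := 1) (q := 2) (by decide)).trans (C.cycles_succ 1)
  · refine ⟨?_, ?_, ?_, ?_⟩
    · exact (C.ker_crossRel_gt (p := 2) (q := 1) (by decide)).trans (C.boundaries_self 2)
    · exact (C.ker_crossRel_gt (p := 2) (q := 0) (by decide)).trans
        (C.dom_crossRel_gt (p := 2) (q := 1) (by decide)).symm
    · exact (C.ker_crossRel_lt (p := 2) (q := 3) (by decide)).trans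
        ((C.cycles_four 2).trans (C.dom_crossRel_gt (p := 2) (q := 0) (by decide)).symm)
    · exact (C.dom_crossRel_lt (p := 2) (q := 3) (by decide)).trans (C.cycles_succ 2)
  · refine ⟨?_, ?_, ?_, ?_⟩
    · exact (C.ker_crossRel_gt (p := 3) (q := 2) (by decide)).trans (C.boundaries_self 3)
    · exact (C.ker_crossRel_gt (p := 3) (q := 1) (by decide)).trans
        (C.dom_crossRel_gt (p := 3) (q := 2) (by decide)).symm
    · exact (C.ker_crossRel_gt (p := 3) (q := 0) (by decide)).trans
        (C.dom_crossRel_gt (p := 3) (q := 1) (by decide)).symm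
    · exact (C.dom_crossRel_gt (p := 3) (q := 0) (by decide)).trans
        ((C.cycles_four 3).symm.trans (C.cycles_succ 3))

lemma add_two_add_three : ∀ p : Fin 4, p + 2 + 3 = p + 1 := by decide

lemma add_two_add_one : ∀ p : Fin 4, p + 2 + 1 = p + 3 := by decide

/-- The system of relations of an acyclic filtered complex. -/
def toSideSystem : SideSystem k V where
  E := C.E
  S p q := C.crossRel (p + 2) q
  E_add_two := C.E_add_two
  inv_S p q := by rw [relInv_crossRel, SideSystem.add_two_add_two]
  S_opposite p := by simp [crossRel]
  ker_first p := by
    have h := (C.crossRel_flag (p + 2)).1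
    rwa [add_two_add_three p] at h
  ker_second p := by
    have h := (C.crossRel_flag (p + 2)).2.1
    rwa [add_two_add_three p, SideSystem.add_two_add_two] at h
  ker_third p := by
    have h := (C.crossRel_flag (p + 2)).2.2.1
    rwa [add_two_add_one p, SideSystem.add_two_add_two] at h
  dom_third p := by
    have h := (C.crossRel_flag (p + 2)).2.2.2
    rwa [add_two_add_one p, C.E_add_two] at h

end FilteredComplex

/-! ### Linear maps between modules `B ⊗ V` -/

section Extend

variable {B : Type} [Ring B] [OverIdem B] {V : Type u} [AddCommGroup V] [Module IdemRing V]
  {V' : Type v} [AddCommGroup V'] [Module IdemRing V']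

lemma tmul_eq_smul_one_tmul (a : B) (x : V) :
    a ⊗ₜ[IdemRing] x = a • ((1 : B) ⊗ₜ[IdemRing] x) := by
  rw [TensorProduct.smul_tmul', smul_eq_mul, mul_one]

lemma one_tmul_smul (s : IdemRing) (x : V) :
    (1 : B) ⊗ₜ[IdemRing] (s • x) = (OverIdem.incl s : B) • ((1 : B) ⊗ₜ[IdemRing] x) := by
  rw [← TensorProduct.smul_tmul, right_smul_def, one_mul, tmul_eq_smul_one_tmul]

/-- The `B`-linear map `a ⊗ x ↦ a • T x` attached to a map `T : V → B ⊗ V'` which is linear over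
the idempotents. -/
noncomputable def extend (T : V →+ B ⊗[IdemRing] V')
    (hT : ∀ (s : IdemRing) (x : V), T (s • x) = (OverIdem.incl s : B) • T x) :
    B ⊗[IdemRing] V →ₗ[B] B ⊗[IdemRing] V' :=
  let F : B ⊗[IdemRing] V →+ B ⊗[IdemRing] V' := TensorProduct.liftAddHom
      (AddMonoidHom.mk' (fun a : B => (DistribSMul.toAddMonoidHom (B ⊗[IdemRing] V') a).comp T)
        (fun a b => by ext x; simp [add_smul]))
      (fun s a x => by simp [right_smul_def, mul_smul, hT])
  { toFun := F
    map_add' := map_add F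
    map_smul' := fun a y => by
      induction y using TensorProduct.induction_on with
      | zero => simp
      | tmul b x => simp [F, TensorProduct.smul_tmul', mul_smul]
      | add y z hy hz =>
        simp only [RingHom.id_apply] at hy hz ⊢
        simp only [smul_add, map_add, hy, hz] }

lemma extend_tmul (T : V →+ B ⊗[IdemRing] V')
    (hT : ∀ (s : IdemRing) (x : V), T (s • x) = (OverIdem.incl s : B) • T x) (a : B) (x : V) :
    extend T hT (a ⊗ₜ x) = a • T x := by
  simp [extend]

lemma extend_one_tmul (T : V →+ B ⊗[IdemRing] V')
    (hT : ∀ (s : IdemRing) (x : V), T (s • x) = (OverIdem.incl s : B) • T x) (x : V) :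
    extend T hT ((1 : B) ⊗ₜ x) = T x := by
  rw [extend_tmul, one_smul]

lemma linearMap_ext {f g : B ⊗[IdemRing] V →ₗ[B] B ⊗[IdemRing] V'}
    (h : ∀ x : V, f ((1 : B) ⊗ₜ x) = g ((1 : B) ⊗ₜ x)) : f = g := by
  refine LinearMap.ext fun y => ?_
  induction y using TensorProduct.induction_on with
  | zero => simp
  | tmul a x => rw [tmul_eq_smul_one_tmul, map_smul, map_smul, h]
  | add y z hy hz => rw [map_add, map_add, hy, hz]

/-- The `B`-linear map `1 ⊗ L`. -/
noncomputable def tensorOne (B : Type) [Ring B] [OverIdem B] (L : V →ₗ[IdemRing] V') :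
    B ⊗[IdemRing] V →ₗ[B] B ⊗[IdemRing] V' :=
  extend (AddMonoidHom.mk' (fun x => (1 : B) ⊗ₜ L x) fun x y => by
    rw [map_add, TensorProduct.tmul_add]) fun s x => by
      simp only [AddMonoidHom.mk'_apply, map_smul, one_tmul_smul]

lemma tensorOne_one_tmul (L : V →ₗ[IdemRing] V') (x : V) :
    tensorOne B L ((1 : B) ⊗ₜ x) = (1 : B) ⊗ₜ L x :=
  extend_one_tmul _ _ x

/-- The map `x ↦ T (1 ⊗ x)` intertwines the actions of the idempotents. -/
lemma map_one_tmul_smul (T : B ⊗[IdemRing] V →ₗ[B] B ⊗[IdemRing] V') (s : IdemRing) (x : V) :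
    T ((1 : B) ⊗ₜ (s • x)) = (OverIdem.incl s : B) • T ((1 : B) ⊗ₜ x) := by
  rw [one_tmul_smul, map_smul]

end Extend

/-! ### Coordinates from matrix representations -/

lemma single_mul_eq (i : Fin 2) (c : ZMod 2) (s : IdemRing) :
    (Pi.single i (c * s i) : IdemRing) = Pi.single i c * s := by
  ext j
  by_cases h : j = i
  · subst h
    simp
  · simp [Pi.single_eq_of_ne h]

/-- A representation of `B` by matrices over the field with two elements, acting on row vectors, in
which the idempotents act by the diagonal projections given by a labelling of the indices. -/
structure IdemRep (B : Type) [Ring B] [OverIdem B] (n : Type) [Fintype n] [DecidableEq n] where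
  toHom : B →+* Matrix n n (ZMod 2)
  label : n → Fin 2
  map_incl : ∀ s : IdemRing, toHom (OverIdem.incl s) = Matrix.diagonal fun p => s (label p)

namespace IdemRep

variable {B : Type} [Ring B] [OverIdem B] {n : Type} [Fintype n] [DecidableEq n]
  (R : IdemRep B n) {V : Type u} [AddCommGroup V] [Module IdemRing V]
  {V' : Type v} [AddCommGroup V'] [Module IdemRing V']

/-- The matrix coefficient `(p, q)` on `B ⊗ V`: the map `a ⊗ x ↦ a_{pq} x`, where only the part of
`x` at the label of `q` is kept. -/
noncomputable def coord (p q : n) : B ⊗[IdemRing] V →+ V :=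
  TensorProduct.liftAddHom
    (AddMonoidHom.mk' (fun a : B => DistribSMul.toAddMonoidHom V
      (Pi.single (R.label q) (R.toHom a p q) : IdemRing))
      (fun a b => by ext x; simp [Pi.single_add, add_smul]))
    (fun s a x => by
      simp only [AddMonoidHom.mk'_apply, DistribSMul.toAddMonoidHom_apply]
      rw [right_smul_def, map_mul, R.map_incl, Matrix.mul_diagonal, single_mul_eq, mul_smul])

lemma coord_tmul (p q : n) (a : B) (x : V) :
    R.coord p q (a ⊗ₜ x) = (Pi.single (R.label q) (R.toHom a p q) : IdemRing) • x := rfl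

lemma coord_smul (p q : n) (a : B) (y : B ⊗[IdemRing] V) :
    R.coord p q (a • y) =
      ∑ r, (algebraMap (ZMod 2) IdemRing (R.toHom a p r)) • R.coord r q y := by
  induction y using TensorProduct.induction_on with
  | zero => simp
  | tmul b x =>
    rw [TensorProduct.smul_tmul', coord_tmul, smul_eq_mul, map_mul, Matrix.mul_apply]
    simp only [coord_tmul, smul_smul]
    rw [← Finset.sum_smul]
    congr 1
    ext j
    by_cases h : j = R.label q
    · subst h
      simp
    · simp [Pi.single_eq_of_ne h]
  | add y z hy hz => simp only [smul_add, map_add, hy, hz, Finset.sum_add_distrib]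

lemma coord_incl_smul (p q : n) (s : IdemRing) (y : B ⊗[IdemRing] V) :
    R.coord p q ((OverIdem.incl s : B) • y) =
      (algebraMap (ZMod 2) IdemRing (s (R.label p))) • R.coord p q y := by
  rw [coord_smul, R.map_incl, Finset.sum_eq_single p]
  · rw [Matrix.diagonal_apply_eq]
  · intro r _ hr
    rw [Matrix.diagonal_apply_ne _ hr.symm, map_zero, zero_smul]
  · simp

/-- The coefficients in column `q` are supported at the label of `q`. -/
lemma smul_coord (p q : n) (y : B ⊗[IdemRing] V) :
    (Pi.single (R.label q) 1 : IdemRing) • R.coord p q y = R.coord p q y := by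
  induction y using TensorProduct.induction_on with
  | zero => simp
  | tmul b x =>
    rw [coord_tmul, smul_smul]
    congr 1
    rw [← Pi.single_mul, one_mul]
  | add y z hy hz => simp only [smul_add, map_add, hy, hz]

/-- The map between spaces of row vectors induced by a `B`-linear map. -/
noncomputable def hat (T : B ⊗[IdemRing] V →ₗ[B] B ⊗[IdemRing] V') : (n → V) →+ (n → V') :=
  AddMonoidHom.mk' (fun w q => ∑ r, R.coord r q (T ((1 : B) ⊗ₜ w r))) (fun w w' => by
    ext q
    simp only [Pi.add_apply, TensorProduct.tmul_add, map_add, Finset.sum_add_distrib])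

lemma hat_apply (T : B ⊗[IdemRing] V →ₗ[B] B ⊗[IdemRing] V') (w : n → V) (q : n) :
    R.hat T w q = ∑ r, R.coord r q (T ((1 : B) ⊗ₜ w r)) := rfl

/-- The row of index `p` of an element of `B ⊗ V`. -/
noncomputable def row (p : n) (y : B ⊗[IdemRing] V) : n → V := fun q => R.coord p q y

/-- A `B`-linear map acts on the rows of an element. -/
lemma row_map (T : B ⊗[IdemRing] V →ₗ[B] B ⊗[IdemRing] V') (p : n) (y : B ⊗[IdemRing] V) :
    R.row p (T y) = R.hat T (R.row p y) := by
  ext q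
  rw [hat_apply]
  induction y using TensorProduct.induction_on with
  | zero => simp [row]
  | tmul a x =>
    rw [tmul_eq_smul_one_tmul, map_smul, row, coord_smul]
    refine Finset.sum_congr rfl fun r _ => ?_
    rw [← tmul_eq_smul_one_tmul, row, coord_tmul, map_one_tmul_smul, coord_incl_smul,
      Pi.single_eq_same]
  | add y z hy hz =>
    simp only [row, map_add, TensorProduct.tmul_add, Finset.sum_add_distrib] at hy hz ⊢
    rw [hy, hz]

lemma hat_eq_sum_row (T : B ⊗[IdemRing] V →ₗ[B] B ⊗[IdemRing] V') (w : n → V) :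
    R.hat T w = ∑ r, R.row r (T ((1 : B) ⊗ₜ w r)) := by
  ext q
  rw [Finset.sum_apply, hat_apply]
  rfl

lemma hat_comp {V'' : Type*} [AddCommGroup V''] [Module IdemRing V'']
    (S : B ⊗[IdemRing] V' →ₗ[B] B ⊗[IdemRing] V'') (T : B ⊗[IdemRing] V →ₗ[B] B ⊗[IdemRing] V')
    (w : n → V) : R.hat (S ∘ₗ T) w = R.hat S (R.hat T w) := by
  rw [hat_eq_sum_row _ T, map_sum, hat_eq_sum_row]
  exact Finset.sum_congr rfl fun r _ => R.row_map S r _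

/-- The row vectors whose entries are supported at their labels. -/
def IsRow (w : n → V) : Prop := ∀ p, (Pi.single (R.label p) 1 : IdemRing) • w p = w p

lemma isRow_hat (T : B ⊗[IdemRing] V →ₗ[B] B ⊗[IdemRing] V') (w : n → V) :
    R.IsRow (R.hat T w) := fun q => by
  rw [hat_apply, Finset.smul_sum]
  exact Finset.sum_congr rfl fun r _ => R.smul_coord r q _

/-- The map on row vectors given by multiplication by an element which acts on generators. -/
lemma hat_of_smul {T : B ⊗[IdemRing] V →ₗ[B] B ⊗[IdemRing] V} {c : B}
    (h : ∀ x : V, T ((1 : B) ⊗ₜ x) = c • ((1 : B) ⊗ₜ[IdemRing] x)) (w : n → V) (q : n) : R.hat T w q =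
      ∑ r, (Pi.single (R.label q) (R.toHom c r q) : IdemRing) • w r := by
  rw [hat_apply]
  refine Finset.sum_congr rfl fun r _ => ?_
  rw [h, ← tmul_eq_smul_one_tmul, coord_tmul]

lemma hat_id {w : n → V} (hw : R.IsRow w) :
    R.hat (LinearMap.id : B ⊗[IdemRing] V →ₗ[B] B ⊗[IdemRing] V) w = w := by
  ext q
  rw [R.hat_of_smul (c := 1) (fun x => (one_smul _ _).symm), map_one,
    Finset.sum_eq_single q]
  · rw [Matrix.one_apply_eq, hw]
  · intro r _ hr
    rw [Matrix.one_apply_ne hr, Pi.single_zero, zero_smul]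
  · simp

end IdemRep

/-! ### The matrix representations of the torus algebras -/

open TorusAlg

namespace ExtAlg

/-- The homomorphism from the extended torus algebra with given values on the generators. -/
noncomputable def lift {S : Type} [Ring S] [Algebra (ZMod 2) S] (f : Gen → S)
    (h : ∀ ⦃a b⦄, ExtRel a b → FreeAlgebra.lift (ZMod 2) f a = FreeAlgebra.lift (ZMod 2) f b) :
    ExtAlg →ₐ[ZMod 2] S :=
  RingQuot.liftAlgHom (ZMod 2) ⟨FreeAlgebra.lift (ZMod 2) f, h⟩

lemma lift_mk {S : Type} [Ring S] [Algebra (ZMod 2) S] (f : Gen → S)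
    (h : ∀ ⦃a b⦄, ExtRel a b → FreeAlgebra.lift (ZMod 2) f a = FreeAlgebra.lift (ZMod 2) f b)
    (x : FreeAlg) : lift f h (mk x) = FreeAlgebra.lift (ZMod 2) f x :=
  RingQuot.liftAlgHom_mkAlgHom_apply _ _ _ _

lemma lift_idem {S : Type} [Ring S] [Algebra (ZMod 2) S] (f : Gen → S)
    (h : ∀ ⦃a b⦄, ExtRel a b → FreeAlgebra.lift (ZMod 2) f a = FreeAlgebra.lift (ZMod 2) f b)
    (i : Fin 2) : lift f h (idem i) = f (Gen.idem i) :=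
  (lift_mk f h _).trans (FreeAlgebra.lift_ι_apply _ _)

lemma lift_rho {S : Type} [Ring S] [Algebra (ZMod 2) S] (f : Gen → S)
    (h : ∀ ⦃a b⦄, ExtRel a b → FreeAlgebra.lift (ZMod 2) f a = FreeAlgebra.lift (ZMod 2) f b)
    (i : Fin 4) : lift f h (rho i) = f (Gen.arrow i) :=
  (lift_mk f h _).trans (FreeAlgebra.lift_ι_apply _ _)

/-- Induction on an element: sums and products of generators. -/
lemma induction {P : ExtAlg → Prop} (zero : P 0) (one : P 1) (idem : ∀ i, P (idem i))
    (rho : ∀ i, P (rho i)) (add : ∀ a b, P a → P b → P (a + b))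
    (mul : ∀ a b, P a → P b → P (a * b)) (a : ExtAlg) : P a := by
  obtain ⟨x, rfl⟩ := RingQuot.mkAlgHom_surjective (ZMod 2) ExtRel a
  change P (mk x)
  induction x using FreeAlgebra.induction with
  | grade0 r =>
    obtain rfl | rfl : r = 0 ∨ r = 1 := by revert r; decide
    · rwa [map_zero, map_zero]
    · rwa [map_one, map_one]
  | grade1 g =>
    cases g with
    | idem i => exact idem i
    | arrow i => exact rho i
  | mul a b ha hb => rw [map_mul]; exact mul _ _ ha hb
  | add a b ha hb => rw [map_add]; exact add _ _ ha hb

/-- The matrix of an idempotent, on the four sides of the square. -/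
def idemMatrix (i : Fin 2) : Matrix (Fin 4) (Fin 4) (ZMod 2) :=
  Matrix.diagonal fun p => if sideIdem p = i then 1 else 0

/-- The matrix of an arrow in the representation of the torus algebra on the sides of the
square. -/
def rhoMatrix (i : Fin 4) : Matrix (Fin 4) (Fin 4) (ZMod 2) :=
  if i = 0 then 0 else Matrix.single (i - 1) i 1

/-- The contribution of the arrows which pass the top right corner. -/
def cornerMatrix (i : Fin 4) : Matrix (Fin 4) (Fin 4) (ZMod 2) :=
  if i = 0 then Matrix.single 3 0 1 else 0

/-- The values on generators of the representation on two copies of the sides of the square, in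
which passing the top right corner leads from the first copy to the second. -/
def doubleGen : Gen → Matrix (Fin 4 ⊕ Fin 4) (Fin 4 ⊕ Fin 4) (ZMod 2)
  | Gen.idem i => Matrix.fromBlocks (idemMatrix i) 0 0 (idemMatrix i)
  | Gen.arrow i => Matrix.fromBlocks (rhoMatrix i) (cornerMatrix i) 0 (rhoMatrix i)

lemma doubleGen_rel ⦃a b : FreeAlg⦄ (h : ExtRel a b) :
    FreeAlgebra.lift (ZMod 2) doubleGen a = FreeAlgebra.lift (ZMod 2) doubleGen b := by
  cases h <;> simp only [freeIdem, freeArrow, map_mul, map_add, map_zero, map_one,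
    FreeAlgebra.lift_ι_apply, doubleGen, Matrix.fromBlocks_multiply, Matrix.fromBlocks_add,
    zero_mul, mul_zero, add_zero, zero_add]
  case idem_self i => congr 1 <;> revert i <;> decide
  case idem_ne i j h =>
    rw [show idemMatrix i * idemMatrix j = 0 by revert h; revert i j; decide]
    exact Matrix.fromBlocks_zero
  case idem_sum =>
    rw [show idemMatrix 0 + idemMatrix 1 = 1 by decide]
    exact Matrix.fromBlocks_one
  case src_arrow i => congr 1 <;> revert i <;> decide
  case arrow_tgt i => congr 1 <;> revert i <;> decide
  case back i =>
    rw [show rhoMatrix i * rhoMatrix (i - 1) = 0 by revert i; decide,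
      show rhoMatrix i * cornerMatrix (i - 1) + cornerMatrix i * rhoMatrix (i - 1) = 0 by
        revert i; decide]
    exact Matrix.fromBlocks_zero
  case long =>
    rw [show rhoMatrix 0 = 0 from rfl]
    simp only [zero_mul, mul_zero, add_zero, zero_add]
    exact Matrix.fromBlocks_zero

/-- The representation on two copies of the sides of the square. -/
noncomputable def double :
    ExtAlg →ₐ[ZMod 2] Matrix (Fin 4 ⊕ Fin 4) (Fin 4 ⊕ Fin 4) (ZMod 2) :=
  lift doubleGen doubleGen_rel

/-- The values on generators of the representation on the sides of the square. -/
def sideGen : Gen → Matrix (Fin 4) (Fin 4) (ZMod 2)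
  | Gen.idem i => idemMatrix i
  | Gen.arrow i => rhoMatrix i

lemma sideGen_rel ⦃a b : FreeAlg⦄ (h : ExtRel a b) :
    FreeAlgebra.lift (ZMod 2) sideGen a = FreeAlgebra.lift (ZMod 2) sideGen b := by
  cases h <;> simp only [freeIdem, freeArrow, map_mul, map_add, map_zero, map_one,
    FreeAlgebra.lift_ι_apply, sideGen]
  case idem_self i => revert i; decide
  case idem_ne i j h => revert h; revert i j; decide
  case idem_sum => decide
  case src_arrow i => revert i; decide
  case arrow_tgt i => revert i; decide
  case back i => revert i; decide
  case long => rw [show rhoMatrix 0 = 0 from rfl]; simp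

/-- The values on generators of the augmentation, which kills the arrows. -/
def augGen : Gen → IdemRing
  | Gen.idem i => Pi.single i 1
  | Gen.arrow _ => 0

lemma augGen_rel ⦃a b : FreeAlg⦄ (h : ExtRel a b) :
    FreeAlgebra.lift (ZMod 2) augGen a = FreeAlgebra.lift (ZMod 2) augGen b := by
  cases h <;> simp only [freeIdem, freeArrow, map_mul, map_add, map_zero, map_one,
    FreeAlgebra.lift_ι_apply, augGen, mul_zero, zero_mul]
  case idem_self i => revert i; decide
  case idem_ne i j h => revert h; revert i j; decide
  case idem_sum => decide

end ExtAlg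

namespace TorAlg

/-- The homomorphism induced by a homomorphism which kills `ρ₀`. -/
noncomputable def lift {S : Type} [Ring S] [Algebra (ZMod 2) S] (f : ExtAlg →ₐ[ZMod 2] S)
    (h : f (ExtAlg.rho 0) = 0) : TorAlg →ₐ[ZMod 2] S :=
  RingQuot.liftAlgHom (ZMod 2) ⟨f, by
    rintro a b ⟨rfl, rfl⟩
    rw [h, map_zero]⟩

lemma lift_toTorAlg {S : Type} [Ring S] [Algebra (ZMod 2) S] (f : ExtAlg →ₐ[ZMod 2] S)
    (h : f (ExtAlg.rho 0) = 0) (a : ExtAlg) : lift f h (toTorAlg a) = f a :=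
  RingQuot.liftAlgHom_mkAlgHom_apply _ _ _ _

/-- The representation of the torus algebra on the sides of the square. -/
noncomputable def sides : TorAlg →ₐ[ZMod 2] Matrix (Fin 4) (Fin 4) (ZMod 2) :=
  lift (ExtAlg.lift ExtAlg.sideGen ExtAlg.sideGen_rel) (ExtAlg.lift_rho _ _ 0)

lemma sides_idem (i : Fin 2) : sides (idem i) = ExtAlg.idemMatrix i :=
  (lift_toTorAlg _ _ _).trans (ExtAlg.lift_idem _ _ i)

lemma sides_rho (i : Fin 4) : sides (rho i) = ExtAlg.rhoMatrix i :=
  (lift_toTorAlg _ _ _).trans (ExtAlg.lift_rho _ _ i)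

/-- The augmentation of the torus algebra, which kills the arrows. -/
noncomputable def aug : TorAlg →ₐ[ZMod 2] IdemRing :=
  lift (ExtAlg.lift ExtAlg.augGen ExtAlg.augGen_rel) (ExtAlg.lift_rho _ _ 0)

lemma aug_idem (i : Fin 2) : aug (idem i) = Pi.single i 1 :=
  (lift_toTorAlg _ _ _).trans (ExtAlg.lift_idem _ _ i)

lemma aug_rho (i : Fin 4) : aug (rho i) = 0 :=
  (lift_toTorAlg _ _ _).trans (ExtAlg.lift_rho _ _ i)

lemma incl_eq (s : IdemRing) : (OverIdem.incl s : TorAlg) = s 0 • idem 0 + s 1 • idem 1 := by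
  change toTorAlg (s 0 • ExtAlg.idem 0 + s 1 • ExtAlg.idem 1) = _
  rw [map_add, map_smul, map_smul]
  rfl

lemma aug_incl (s : IdemRing) : aug (OverIdem.incl s) = s := by
  rw [incl_eq, map_add, map_smul, map_smul, aug_idem, aug_idem]
  ext j
  fin_cases j <;> simp

lemma aug_chord (p q : Fin 4) : aug (chord p q) = 0 := by
  fin_cases p <;> fin_cases q <;> simp [chord, aug_rho]

lemma sides_incl (s : IdemRing) :
    sides (OverIdem.incl s) = Matrix.diagonal fun p => s (sideIdem p) := by
  rw [incl_eq, map_add, map_smul, map_smul, sides_idem, sides_idem]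
  ext p q
  by_cases h : p = q
  · subst h
    fin_cases p <;> simp [ExtAlg.idemMatrix, sideIdem]
  · simp [ExtAlg.idemMatrix, Matrix.diagonal_apply_ne _ h]

lemma sides_chord (p q : Fin 4) :
    sides (chord p q) = if p < q then Matrix.single p q 1 else 0 := by
  have h1 : sides (rho 1) = Matrix.single 0 1 1 := (sides_rho 1).trans (by decide)
  have h2 : sides (rho 2) = Matrix.single 1 2 1 := (sides_rho 2).trans (by decide)
  have h3 : sides (rho 3) = Matrix.single 2 3 1 := (sides_rho 3).trans (by decide)
  fin_cases p <;> fin_cases q <;> simp [chord, h1, h2, h3]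

lemma chord_of_le {p q : Fin 4} (h : q ≤ p) : chord p q = 0 := by
  revert h
  fin_cases p <;> fin_cases q <;> simp [chord]

lemma idem_ne {i j : Fin 2} (h : i ≠ j) : idem i * idem j = 0 := by
  simp [idem, ← map_mul, ExtAlg.idem_ne h]

lemma idem_sum : idem 0 + idem 1 = 1 := by
  simp [idem, ← map_add, ExtAlg.idem_sum]

lemma rho_tgt (i : Fin 4) : rho i * idem (tgt i) = rho i := by
  simp [idem, rho, ← map_mul, ExtAlg.rho_tgt]

lemma rho_zero : rho 0 = 0 := toTorAlg_rho_zero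

lemma idem_mul_chord' (i : Fin 2) (p q : Fin 4) :
    idem i * chord p q = if sideIdem p = i then chord p q else 0 := by
  split_ifs with h
  · rw [← h, idem_mul_chord]
  · rw [← idem_mul_chord, ← mul_assoc, idem_ne (Ne.symm h), zero_mul]

lemma rho_mul_idem (i : Fin 4) (j : Fin 2) :
    rho i * idem j = if sideIdem i = j then chord (i - 1) i else 0 := by
  split_ifs with h
  · rw [← h]
    refine (rho_tgt i).trans ?_
    fin_cases i
    · exact rho_zero
    all_goals rfl
  · rw [← rho_tgt i, mul_assoc, idem_ne (show tgt i ≠ j from h), mul_zero]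

lemma rho_mul_rho_of_ne {i j : Fin 4} (h : tgt i ≠ src j) : rho i * rho j = 0 := by
  calc rho i * rho j = rho i * idem (tgt i) * (idem (src j) * rho j) := by
        rw [rho_tgt, src_rho]
    _ = 0 := by rw [mul_assoc, ← mul_assoc (idem _), idem_ne h, zero_mul, mul_zero]

lemma rho_mul_rho (i j : Fin 4) (h : j ≠ i + 1) : rho i * rho j = 0 := by
  rcases SideSystem.side_cases i j with rfl | rfl | rfl | rfl
  · exact absurd rfl h
  · exact rho_mul_rho_of_ne (by revert j; decide)
  · have h3 : i + 3 = i - 1 := by revert i; decide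
    rw [h3, rho_back]
  · exact rho_mul_rho_of_ne (by revert i; decide)

lemma rho_mul_chord (i p q : Fin 4) :
    rho i * chord p q = if i = p ∧ p < q then chord (i - 1) q else 0 := by
  have h : ∀ i j a, j ≠ i + 1 → rho i * (rho j * a) = 0 := fun i j a h => by
    rw [← mul_assoc, rho_mul_rho i j h, zero_mul]
  have hz := rho_zero
  fin_cases i <;> fin_cases p <;> fin_cases q <;>
    simp (decide := true) [chord, mul_assoc, h, rho_mul_rho, hz]

/-- The torus algebra is spanned by the idempotents and the chords. -/
lemma path_induction {P : TorAlg → Prop} (zero : P 0) (add : ∀ a b, P a → P b → P (a + b))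
    (idem_mem : ∀ i, P (idem i)) (chord_mem : ∀ p q, p < q → P (chord p q)) (a : TorAlg) : P a := by
  have hP : ∀ p q, P (chord p q) := fun p q => by
    rcases lt_or_ge p q with h | h
    · exact chord_mem p q h
    · rw [chord_of_le h]
      exact zero
  let S : AddSubmonoid TorAlg :=
    AddSubmonoid.closure (Set.range idem ∪ Set.range fun g : Fin 4 × Fin 4 => chord g.1 g.2)
  have hi : ∀ i, idem i ∈ S := fun i => AddSubmonoid.subset_closure (Or.inl ⟨i, rfl⟩)
  have hc : ∀ p q, chord p q ∈ S := fun p q => AddSubmonoid.subset_closure (Or.inr ⟨(p, q), rfl⟩)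
  have gen : ∀ x : TorAlg, (∀ i, x * idem i ∈ S) → (∀ p q, x * chord p q ∈ S) →
      ∀ b ∈ S, x * b ∈ S := by
    intro x h1 h2 b hb
    induction hb using AddSubmonoid.closure_induction with
    | mem b hb =>
      rcases hb with ⟨i, rfl⟩ | ⟨g, rfl⟩
      · exact h1 i
      · exact h2 g.1 g.2
    | zero => rw [mul_zero]; exact zero_mem S
    | add b c _ _ hb hc => rw [mul_add]; exact add_mem hb hc
  have hmul : ∀ x : ExtAlg, ∀ b ∈ S, toTorAlg x * b ∈ S := by
    intro x
    induction x using ExtAlg.induction with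
    | zero => intro b _; rw [map_zero, zero_mul]; exact zero_mem S
    | one => intro b hb; rwa [map_one, one_mul]
    | add x y hx hy =>
      intro b hb
      rw [map_add, add_mul]
      exact add_mem (hx b hb) (hy b hb)
    | mul x y hx hy =>
      intro b hb
      rw [map_mul, mul_assoc]
      exact hx _ (hy b hb)
    | idem i =>
      refine gen _ (fun j => ?_) fun p q => ?_
      · change idem i * idem j ∈ S
        by_cases h : i = j
        · rw [h, idem_mul_self]
          exact hi j
        · rw [idem_ne h]
          exact zero_mem S
      · change idem i * chord p q ∈ S
        rw [idem_mul_chord']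
        split_ifs
        · exact hc p q
        · exact zero_mem S
    | rho i =>
      refine gen _ (fun j => ?_) fun p q => ?_
      · change rho i * idem j ∈ S
        rw [rho_mul_idem]
        split_ifs
        · exact hc _ _
        · exact zero_mem S
      · change rho i * chord p q ∈ S
        rw [rho_mul_chord]
        split_ifs
        · exact hc _ _
        · exact zero_mem S
  obtain ⟨x, hx⟩ := RingQuot.mkAlgHom_surjective (ZMod 2) KillRhoZero a
  have ha : a ∈ S := by
    have h := hmul x 1 (by rw [← idem_sum]; exact add_mem (hi 0) (hi 1))
    rw [mul_one] at h
    rwa [← hx]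
  clear hx
  induction ha using AddSubmonoid.closure_induction with
  | mem b hb =>
    rcases hb with ⟨i, rfl⟩ | ⟨g, rfl⟩
    · exact idem_mem i
    · exact hP g.1 g.2
  | zero => exact zero
  | add b c _ _ hb hc => exact add _ _ hb hc

lemma sides_of_lt (a : TorAlg) {p q : Fin 4} (h : q < p) : sides a p q = 0 := by
  induction a using path_induction with
  | zero => simp
  | add a b ha hb => rw [map_add, Matrix.add_apply, ha, hb, add_zero]
  | idem_mem i => rw [sides_idem, ExtAlg.idemMatrix, Matrix.diagonal_apply_ne _ h.ne']
  | chord_mem r s hrs =>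
    rw [sides_chord, if_pos hrs, Matrix.single_apply_of_ne]
    rintro ⟨rfl, rfl⟩
    exact lt_asymm h hrs

lemma sides_diag (a : TorAlg) (p : Fin 4) : sides a p p = aug a (sideIdem p) := by
  induction a using path_induction with
  | zero => simp
  | add a b ha hb => rw [map_add, map_add, Matrix.add_apply, ha, hb, Pi.add_apply]
  | idem_mem i =>
    rw [sides_idem, ExtAlg.idemMatrix, Matrix.diagonal_apply_eq, aug_idem, Pi.single_apply]
  | chord_mem r s hrs =>
    rw [sides_chord, if_pos hrs, aug_chord, Matrix.single_apply_of_ne]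
    · rfl
    · rintro ⟨rfl, rfl⟩
      exact lt_irrefl _ hrs

/-- An element is determined by its augmentation and by its matrix on the sides. -/
lemma eq_sum (a : TorAlg) :
    a = (∑ i, aug a i • idem i) + ∑ p, ∑ q, sides a p q • chord p q := by
  induction a using path_induction with
  | zero => simp
  | add a b ha hb =>
    conv_lhs => rw [ha, hb]
    simp only [map_add, Pi.add_apply, Matrix.add_apply, add_smul, Finset.sum_add_distrib]
    abel
  | idem_mem i =>
    have h : ∀ p q, sides (idem i) p q • chord p q = 0 := fun p q => by
      by_cases hpq : p = q
      · rw [hpq, chord_of_le le_rfl, smul_zero]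
      · rw [sides_idem, ExtAlg.idemMatrix, Matrix.diagonal_apply_ne _ hpq, zero_smul]
    simp only [h, Finset.sum_const_zero, add_zero, aug_idem, Pi.single_apply, ite_smul, one_smul,
      zero_smul, Finset.sum_ite_eq', Finset.mem_univ, if_true]
  | chord_mem r s hrs =>
    simp only [aug_chord, Pi.zero_apply, zero_smul, Finset.sum_const_zero, zero_add, sides_chord,
      if_pos hrs, Matrix.single_apply, ite_smul, one_smul]
    rw [Finset.sum_eq_single r (fun x _ hx => by simp [hx.symm]) (by simp)]
    simp

/-- The representation on the sides, with its idempotents. -/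
noncomputable def sideRep : IdemRep TorAlg (Fin 4) where
  toHom := (sides : TorAlg →+* _)
  label := sideIdem
  map_incl := sides_incl

end TorAlg

namespace ExtAlg

lemma double_idem (i : Fin 2) :
    double (idem i) = Matrix.fromBlocks (idemMatrix i) 0 0 (idemMatrix i) :=
  lift_idem _ _ i

lemma double_rho (i : Fin 4) : double (rho i) =
    Matrix.fromBlocks (rhoMatrix i) (cornerMatrix i) 0 (rhoMatrix i) :=
  lift_rho _ _ i

/-- Both diagonal blocks of the doubled representation are given by the representation of the torus
algebra. -/
lemma double_eq (a : ExtAlg) : ∃ X, double a =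
    Matrix.fromBlocks (TorAlg.sides (toTorAlg a)) X 0 (TorAlg.sides (toTorAlg a)) := by
  induction a using ExtAlg.induction with
  | zero => exact ⟨0, by simp only [map_zero, Matrix.fromBlocks_zero]⟩
  | one => exact ⟨0, by simp only [map_one, Matrix.fromBlocks_one]⟩
  | idem i => exact ⟨0, (double_idem i).trans (by rw [← TorAlg.sides_idem]; rfl)⟩
  | rho i => exact ⟨_, (double_rho i).trans (by rw [← TorAlg.sides_rho]; rfl)⟩
  | add a b ha hb =>
    obtain ⟨X, hX⟩ := ha
    obtain ⟨Y, hY⟩ := hb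
    exact ⟨_, by rw [map_add, hX, hY, Matrix.fromBlocks_add, map_add, map_add, add_zero]⟩
  | mul a b ha hb =>
    obtain ⟨X, hX⟩ := ha
    obtain ⟨Y, hY⟩ := hb
    exact ⟨_, by
      rw [map_mul, hX, hY, Matrix.fromBlocks_multiply, map_mul, map_mul]
      simp only [zero_mul, mul_zero, add_zero, zero_add]
      rfl⟩

lemma double_U : double U = Matrix.fromBlocks 0 1 0 0 := by
  simp only [U, map_add, map_mul, double_rho, Matrix.fromBlocks_multiply, Matrix.fromBlocks_add,
    zero_mul, mul_zero, add_zero, zero_add]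
  congr 1 <;> decide

/-- The doubled representation, with its idempotents. -/
noncomputable def doubleRep : IdemRep ExtAlg (Fin 4 ⊕ Fin 4) where
  toHom := (double : ExtAlg →+* _)
  label := Sum.elim sideIdem sideIdem
  map_incl s := by
    change double (s 0 • idem 0 + s 1 • idem 1) = _
    rw [map_add, map_smul, map_smul, double_idem, double_idem]
    have h := TorAlg.sides_incl s
    rw [TorAlg.incl_eq, map_add, map_smul, map_smul, TorAlg.sides_idem, TorAlg.sides_idem] at h
    rw [Matrix.fromBlocks_smul, Matrix.fromBlocks_smul, Matrix.fromBlocks_add, h]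
    simp only [smul_zero, add_zero, Matrix.fromBlocks_diagonal]
    congr 1
    ext p
    cases p <;> rfl

end ExtAlg

/-! ### Linear maps over the torus algebra and their leading parts -/

open TorusAlg

section Lead

variable {V : Type u} [AddCommGroup V] [Module IdemRing V]
  {V' : Type v} [AddCommGroup V'] [Module IdemRing V']

/-- The quotient map `A ⊗ V → V` which kills the arrows. -/
noncomputable def augV : TorAlg ⊗[IdemRing] V →+ V :=
  TensorProduct.liftAddHom
    (AddMonoidHom.mk' (fun a : TorAlg => DistribSMul.toAddMonoidHom V (TorAlg.aug a))
      (fun a b => by ext x; simp [add_smul]))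
    (fun s a x => by
      simp only [AddMonoidHom.mk'_apply, DistribSMul.toAddMonoidHom_apply]
      rw [right_smul_def, map_mul, TorAlg.aug_incl, mul_smul])

lemma augV_tmul (a : TorAlg) (x : V) : augV (a ⊗ₜ[IdemRing] x) = TorAlg.aug a • x := rfl

lemma augV_one_tmul (x : V) : augV ((1 : TorAlg) ⊗ₜ[IdemRing] x) = x := by
  rw [augV_tmul, map_one, one_smul]

lemma augV_smul (a : TorAlg) (y : TorAlg ⊗[IdemRing] V) : augV (a • y) = TorAlg.aug a • augV y := by
  induction y using TensorProduct.induction_on with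
  | zero => simp
  | tmul b x => rw [TensorProduct.smul_tmul', augV_tmul, augV_tmul, smul_eq_mul, map_mul, mul_smul]
  | add y z hy hz => simp only [smul_add, map_add, hy, hz]

/-- The leading part of a linear map: the part which does not involve the arrows. -/
noncomputable def lead (T : TorAlg ⊗[IdemRing] V →ₗ[TorAlg] TorAlg ⊗[IdemRing] V') :
    V →ₗ[IdemRing] V' where
  toFun x := augV (T (1 ⊗ₜ x))
  map_add' x y := by rw [TensorProduct.tmul_add, map_add, map_add]
  map_smul' s x := by
    rw [map_one_tmul_smul, augV_smul, TorAlg.aug_incl, RingHom.id_apply]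

lemma lead_apply (T : TorAlg ⊗[IdemRing] V →ₗ[TorAlg] TorAlg ⊗[IdemRing] V') (x : V) :
    lead T x = augV (T (1 ⊗ₜ x)) := rfl

lemma augV_map (T : TorAlg ⊗[IdemRing] V →ₗ[TorAlg] TorAlg ⊗[IdemRing] V')
    (y : TorAlg ⊗[IdemRing] V) : augV (T y) = lead T (augV y) := by
  induction y using TensorProduct.induction_on with
  | zero => simp
  | tmul a x =>
    rw [tmul_eq_smul_one_tmul, map_smul, augV_smul, augV_smul, augV_one_tmul, map_smul, lead_apply]
  | add y z hy hz => simp only [map_add, hy, hz]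

lemma lead_comp {V'' : Type*} [AddCommGroup V''] [Module IdemRing V'']
    (S : TorAlg ⊗[IdemRing] V' →ₗ[TorAlg] TorAlg ⊗[IdemRing] V'')
    (T : TorAlg ⊗[IdemRing] V →ₗ[TorAlg] TorAlg ⊗[IdemRing] V') :
    lead (S ∘ₗ T) = lead S ∘ₗ lead T :=
  LinearMap.ext fun _ => augV_map S _

lemma lead_id : lead (LinearMap.id : TorAlg ⊗[IdemRing] V →ₗ[TorAlg] TorAlg ⊗[IdemRing] V) =
    LinearMap.id :=
  LinearMap.ext fun x => augV_one_tmul x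

lemma lead_add (S T : TorAlg ⊗[IdemRing] V →ₗ[TorAlg] TorAlg ⊗[IdemRing] V') :
    lead (S + T) = lead S + lead T :=
  LinearMap.ext fun x => by simp [lead_apply]

lemma lead_sub (S T : TorAlg ⊗[IdemRing] V →ₗ[TorAlg] TorAlg ⊗[IdemRing] V') :
    lead (S - T) = lead S - lead T :=
  LinearMap.ext fun x => by simp [lead_apply]

lemma lead_pow (T : Module.End TorAlg (TorAlg ⊗[IdemRing] V)) (n : ℕ) :
    lead (T ^ n) = (lead T : Module.End IdemRing V) ^ n := by
  induction n with
  | zero => exact lead_id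
  | succ n ih =>
    rw [pow_succ, pow_succ, ← ih]
    exact lead_comp _ _

lemma lead_tensorOne (L : V →ₗ[IdemRing] V') : lead (tensorOne TorAlg L) = L :=
  LinearMap.ext fun x => by rw [lead_apply, tensorOne_one_tmul, augV_one_tmul]

/-! ### Rows of elements of `A ⊗ V` -/

lemma TorAlg.incl_single (i : Fin 2) (c : ZMod 2) :
    (OverIdem.incl (Pi.single i c : IdemRing) : TorAlg) = c • TorAlg.idem i := by
  rw [TorAlg.incl_eq]
  fin_cases i <;> simp

lemma TorAlg.chord_mul_idem (p q : Fin 4) :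
    TorAlg.chord p q * TorAlg.idem (sideIdem q) = TorAlg.chord p q := by
  have h1 : rho 1 * idem 1 = rho 1 := rho_tgt 1
  have h2 : rho 2 * idem 0 = rho 2 := rho_tgt 2
  have h3 : rho 3 * idem 1 = rho 3 := rho_tgt 3
  fin_cases p <;> fin_cases q <;> simp [chord, sideIdem, mul_assoc, h1, h2, h3]

lemma coord_of_lt {p q : Fin 4} (h : q < p) (y : TorAlg ⊗[IdemRing] V) :
    TorAlg.sideRep.coord p q y = 0 := by
  induction y using TensorProduct.induction_on with
  | zero => simp
  | tmul a x =>
    rw [IdemRep.coord_tmul]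
    change (Pi.single _ (TorAlg.sides a p q) : IdemRing) • x = 0
    rw [TorAlg.sides_of_lt a h, Pi.single_zero, zero_smul]
  | add y z hy hz => rw [map_add, hy, hz, add_zero]

lemma coord_self (p : Fin 4) (y : TorAlg ⊗[IdemRing] V) :
    TorAlg.sideRep.coord p p y = (Pi.single (sideIdem p) 1 : IdemRing) • augV y := by
  induction y using TensorProduct.induction_on with
  | zero => simp
  | tmul a x =>
    rw [IdemRep.coord_tmul, augV_tmul, smul_smul]
    change (Pi.single _ (TorAlg.sides a p p) : IdemRing) • x = _
    rw [TorAlg.sides_diag, ← single_mul_eq, one_mul]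
    rfl
  | add y z hy hz => simp only [map_add, smul_add, hy, hz]

lemma tensor_eq_sum (y : TorAlg ⊗[IdemRing] V) :
    y = 1 ⊗ₜ augV y + ∑ p, ∑ q, TorAlg.chord p q ⊗ₜ TorAlg.sideRep.coord p q y := by
  induction y using TensorProduct.induction_on with
  | zero => simp
  | tmul a x =>
    conv_lhs => rw [TorAlg.eq_sum a]
    rw [TensorProduct.add_tmul]
    congr 1
    · rw [augV_tmul, ← TensorProduct.smul_tmul, right_smul_def, one_mul, TorAlg.incl_eq,
        Fin.sum_univ_two]
    · rw [TensorProduct.sum_tmul]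
      refine Finset.sum_congr rfl fun p _ => ?_
      rw [TensorProduct.sum_tmul]
      refine Finset.sum_congr rfl fun q _ => ?_
      rw [IdemRep.coord_tmul, ← TensorProduct.smul_tmul, right_smul_def, TorAlg.incl_single]
      congr 1
      rw [mul_smul_comm]
      change _ = _ • (_ * TorAlg.idem (sideIdem q))
      rw [TorAlg.chord_mul_idem]
      rfl
  | add y z hy hz =>
    conv_lhs => rw [hy, hz]
    simp only [map_add, TensorProduct.tmul_add, Finset.sum_add_distrib]
    abel

lemma eq_single_add_single (x : V) :
    x = (Pi.single 0 1 : IdemRing) • x + (Pi.single 1 1 : IdemRing) • x := by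
  rw [← add_smul]
  conv_lhs => rw [← one_smul IdemRing x]
  congr 1
  ext i
  fin_cases i <;> rfl

/-- The rows determine an element. -/
lemma row_ext {y z : TorAlg ⊗[IdemRing] V}
    (h : ∀ p, TorAlg.sideRep.row p y = TorAlg.sideRep.row p z) : y = z := by
  have hc : ∀ p q, TorAlg.sideRep.coord p q y = TorAlg.sideRep.coord p q z := fun p q =>
    congrFun (h p) q
  have ha : augV y = augV z := by
    have h0 := hc 0 0
    have h1 := hc 1 1
    rw [coord_self, coord_self] at h0 h1
    rw [eq_single_add_single (augV y), eq_single_add_single (augV z)]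
    exact congrArg₂ _ h0 h1
  rw [tensor_eq_sum y, tensor_eq_sum z, ha]
  simp only [hc]

/-- A linear map is determined by its action on rows. -/
lemma hat_injective : Function.Injective
    (TorAlg.sideRep.hat : (TorAlg ⊗[IdemRing] V →ₗ[TorAlg] TorAlg ⊗[IdemRing] V') → _) :=
  fun S T h => LinearMap.ext fun y => row_ext fun p => by
    rw [IdemRep.row_map, IdemRep.row_map, h]

/-- On rows which vanish before the index `q`, only the leading part contributes to the entry of
index `q`. -/
lemma hat_apply_of_forall_lt (T : TorAlg ⊗[IdemRing] V →ₗ[TorAlg] TorAlg ⊗[IdemRing] V')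
    {w : Fin 4 → V} {q : Fin 4} (hw : ∀ r < q, w r = 0) :
    TorAlg.sideRep.hat T w q = (Pi.single (sideIdem q) 1 : IdemRing) • lead T (w q) := by
  rw [IdemRep.hat_apply, Finset.sum_eq_single q]
  · rw [coord_self, lead_apply]
  · intro r _ hr
    rcases lt_or_gt_of_ne hr with h | h
    · rw [hw r h, TensorProduct.tmul_zero, map_zero, map_zero]
    · exact coord_of_lt h _
  · simp

lemma pow_eq_zero_of_lead_eq_zero {T : Module.End TorAlg (TorAlg ⊗[IdemRing] V)}
    (h : lead T = 0) : T ^ 4 = 0 := by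
  have key : ∀ n : ℕ, ∀ y p, ∀ r : Fin 4, r.val < n → TorAlg.sideRep.row p ((T ^ n) y) r = 0 := by
    intro n
    induction n with
    | zero => intro y p r hr; exact absurd hr (Nat.not_lt_zero _)
    | succ n ih =>
      intro y p r hr
      rw [pow_succ', Module.End.mul_apply, IdemRep.row_map, hat_apply_of_forall_lt, h,
        LinearMap.zero_apply, smul_zero]
      intro i hi
      exact ih y p i (by have : i.val < r.val := hi; omega)
  refine LinearMap.ext fun y => row_ext fun p => funext fun r => ?_
  rw [key 4 y p r r.2]
  simp [IdemRep.row]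

lemma eq_zero_of_isIdempotentElem_of_lead_eq_zero {T : Module.End TorAlg (TorAlg ⊗[IdemRing] V)}
    (hT : IsIdempotentElem T) (h : lead T = 0) : T = 0 := by
  rw [← hT.pow_succ_eq 3]
  exact pow_eq_zero_of_lead_eq_zero h

lemma isUnit_of_lead_eq_id {T : Module.End TorAlg (TorAlg ⊗[IdemRing] V)}
    (h : lead T = LinearMap.id) : IsUnit T := by
  have h1 : IsNilpotent (T - 1) := ⟨4, pow_eq_zero_of_lead_eq_zero (by
    rw [lead_sub, h]
    exact sub_eq_zero.2 lead_id.symm)⟩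
  have h2 := IsNilpotent.isUnit_one_add (R := Module.End TorAlg (TorAlg ⊗[IdemRing] V)) h1
  exact (congrArg IsUnit (add_sub_cancel (1 : Module.End TorAlg (TorAlg ⊗[IdemRing] V)) T)).mp h2

/-- A linear map whose leading part is bijective is bijective. -/
lemma bijective_of_lead (T : TorAlg ⊗[IdemRing] V →ₗ[TorAlg] TorAlg ⊗[IdemRing] V')
    (L : V ≃ₗ[IdemRing] V') (h : lead T = L) : Function.Bijective T := by
  have h1 : IsUnit (tensorOne TorAlg (L.symm : V' →ₗ[IdemRing] V) ∘ₗ T :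
      Module.End TorAlg (TorAlg ⊗[IdemRing] V)) := isUnit_of_lead_eq_id (by
    rw [lead_comp, lead_tensorOne, h]
    exact LinearMap.ext fun x => L.symm_apply_apply x)
  have h2 : IsUnit (T ∘ₗ tensorOne TorAlg (L.symm : V' →ₗ[IdemRing] V) :
      Module.End TorAlg (TorAlg ⊗[IdemRing] V')) := isUnit_of_lead_eq_id (by
    rw [lead_comp, lead_tensorOne, h]
    exact LinearMap.ext fun x => L.apply_symm_apply x)
  rw [Module.End.isUnit_iff] at h1 h2
  exact ⟨Function.Injective.of_comp (f := tensorOne TorAlg (L.symm : V' →ₗ[IdemRing] V)) h1.1,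
    Function.Surjective.of_comp (g := tensorOne TorAlg (L.symm : V' →ₗ[IdemRing] V)) h2.2⟩

instance finite_end [Finite V] : Finite (Module.End TorAlg (TorAlg ⊗[IdemRing] V)) :=
  Finite.of_injective (fun T w => TorAlg.sideRep.hat T w) fun _ _ h =>
    hat_injective (DFunLike.coe_injective h)

/-- The element with given augmentation and given matrix coefficients above the diagonal. -/
noncomputable def ofRows (x : V) (w : Fin 4 → Fin 4 → V) : TorAlg ⊗[IdemRing] V :=
  1 ⊗ₜ x + ∑ p, ∑ q, TorAlg.chord p q ⊗ₜ w p q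

lemma augV_ofRows (x : V) (w : Fin 4 → Fin 4 → V) : augV (ofRows x w) = x := by
  simp [ofRows, augV_tmul, TorAlg.aug_chord]

lemma row_ofRows (x : V) {w : Fin 4 → Fin 4 → V} (hw : ∀ p, TorAlg.sideRep.IsRow (w p))
    (hlt : ∀ p, ∀ q < p, w p q = 0)
    (hx : ∀ p, w p p = (Pi.single (sideIdem p) 1 : IdemRing) • x) (p : Fin 4) :
    TorAlg.sideRep.row p (ofRows x w) = w p := by
  ext q
  rcases lt_trichotomy p q with h | rfl | h
  · change TorAlg.sideRep.coord p q _ = _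
    have h1 : ∀ (a : TorAlg) (v : V), TorAlg.sideRep.coord p q (a ⊗ₜ v) =
        (Pi.single (sideIdem q) (TorAlg.sides a p q) : IdemRing) • v := fun _ _ => rfl
    simp only [ofRows, map_add, map_sum, h1, map_one, Matrix.one_apply_ne h.ne, Pi.single_zero,
      zero_smul, zero_add, TorAlg.sides_chord]
    rw [Finset.sum_eq_single p, Finset.sum_eq_single q, if_pos h, Matrix.single_apply_same]
    · exact hw p q
    · intro r _ hr
      split_ifs
      · rw [Matrix.single_apply_of_ne _ _ _ _ _ (fun h => hr h.2), Pi.single_zero, zero_smul]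
      · rw [Matrix.zero_apply, Pi.single_zero, zero_smul]
    · simp
    · intro r _ hr
      refine Finset.sum_eq_zero fun s _ => ?_
      split_ifs
      · rw [Matrix.single_apply_of_ne _ _ _ _ _ (fun h => hr h.1), Pi.single_zero, zero_smul]
      · rw [Matrix.zero_apply, Pi.single_zero, zero_smul]
    · simp
  · change TorAlg.sideRep.coord p p _ = _
    rw [coord_self, augV_ofRows, hx]
  · change TorAlg.sideRep.coord p q _ = _
    rw [coord_of_lt h, hlt p q h]

end Lead

/-! ### Cancelling the leading part of the differential -/

open TorusAlg

lemma CurvedTypeD.d_one_tmul {B : Type} [Ring B] [OverIdem B] {c : B} (N : CurvedTypeD.{u} B c)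
    (x : N.V) : N.d (1 ⊗ₜ x) = N.δ x :=
  (boundary_tmul N.δ N.δ_smul 1 x).trans (one_smul _ _)

/-- In a finite monoid, every element has an idempotent positive power. -/
lemma exists_isIdempotentElem_pow {M : Type*} [Monoid M] [Finite M] (p : M) :
    ∃ n : ℕ, IsIdempotentElem (p ^ (n + 1)) := by
  obtain ⟨a, b, hab, h⟩ := Finite.exists_ne_map_eq_of_infinite (fun n : ℕ => p ^ n)
  wlog hlt : a < b generalizing a b
  · exact this b a hab.symm h.symm (lt_of_le_of_ne (not_lt.1 hlt) hab.symm)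
  obtain ⟨c, rfl⟩ := Nat.exists_eq_add_of_lt hlt
  have h1 : ∀ m, p ^ (a + m + (c + 1)) = p ^ (a + m) := fun m => by
    have h' : p ^ (a + c + 1) = p ^ a := h.symm
    rw [show a + m + (c + 1) = a + c + 1 + m by ring, pow_add, h', ← pow_add]
  have h2 : ∀ j m, p ^ (a + m + j * (c + 1)) = p ^ (a + m) := fun j m => by
    induction j with
    | zero => rw [zero_mul, add_zero]
    | succ j ih =>
      rw [show a + m + (j + 1) * (c + 1) = a + (m + j * (c + 1)) + (c + 1) by ring, h1,
        ← add_assoc, ih]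
  -- `(a + 1) * (c + 1)` is a positive multiple of the period, beyond the preperiod
  refine ⟨a + c + a * c, ?_⟩
  have h3 := h2 (a + 1) (c + a * c + 1)
  rw [IsIdempotentElem, ← pow_add]
  convert h3 using 2 <;> ring

/-- Endomorphisms of modules over the idempotents have generalized inverses. -/
lemma exists_generalized_inverse {V : Type u} [AddCommGroup V] [Module IdemRing V]
    (d : V →ₗ[IdemRing] V) : ∃ k : V →ₗ[IdemRing] V, ∀ x, d (k (d x)) = d x := by
  obtain ⟨W, hW⟩ := exists_isCompl (LinearMap.ker d)
  obtain ⟨W', hW'⟩ := exists_isCompl (LinearMap.range d)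
  refine ⟨W.subtype ∘ₗ ((LinearMap.ker d).quotientEquivOfIsCompl W hW).toLinearMap ∘ₗ
    d.quotKerEquivRange.symm.toLinearMap ∘ₗ (LinearMap.range d).projectionOnto W' hW',
    fun x => ?_⟩
  have h1 : (LinearMap.range d).projectionOnto W' hW' (d x) =
      ⟨d x, LinearMap.mem_range_self d x⟩ :=
    Submodule.projectionOnto_apply_left hW' ⟨d x, LinearMap.mem_range_self d x⟩
  have h2 := d.quotKerEquivRange_symm_apply_image x (LinearMap.mem_range_self d x)
  have h3 := Submodule.mk_quotientEquivOfIsCompl_apply hW ((LinearMap.ker d).mkQ x)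
  rw [Submodule.mkQ_apply, Submodule.Quotient.eq, LinearMap.mem_ker, map_sub, sub_eq_zero] at h3
  simp only [LinearMap.comp_apply, LinearEquiv.coe_coe, h1, h2]
  exact h3

namespace TypeD

lemma d_comp_d (N : TypeD.{u}) : N.d ∘ₗ N.d = 0 :=
  linearMap_ext fun x => (N.sq x).trans (by rw [zero_smul]; rfl)

/-- The type D structure with a given differential on `A ⊗ V`. -/
noncomputable def ofDifferential (V : Type u) [AddCommGroup V] [Module IdemRing V]
    [Module.Finite IdemRing V] (D : TorAlg ⊗[IdemRing] V →ₗ[TorAlg] TorAlg ⊗[IdemRing] V)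
    (hD : D ∘ₗ D = 0) : TypeD.{u} where
  V := V
  δ := AddMonoidHom.mk' (fun x => D (1 ⊗ₜ x)) fun x y => by rw [TensorProduct.tmul_add, map_add]
  δ_smul s x := map_one_tmul_smul D s x
  sq x := by
    have h : boundary (AddMonoidHom.mk' (fun x : V => D (1 ⊗ₜ x)) fun x y => by
        rw [TensorProduct.tmul_add, map_add]) (fun s x => map_one_tmul_smul D s x) = D :=
      linearMap_ext fun x => (boundary_tmul _ _ _ _).trans (one_smul _ _)
    rw [h, zero_smul]
    exact LinearMap.congr_fun hD _

lemma ofDifferential_d (V : Type u) [AddCommGroup V] [Module IdemRing V]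
    [Module.Finite IdemRing V] (D : TorAlg ⊗[IdemRing] V →ₗ[TorAlg] TorAlg ⊗[IdemRing] V)
    (hD : D ∘ₗ D = 0) : (ofDifferential V D hD).d = D :=
  linearMap_ext fun x => (ofDifferential V D hD).d_one_tmul x

/-- Every type D structure deformation retracts onto one whose differential has no leading part.
The leading part `d` of the differential has a generalized inverse `k`. Some power of the
null-homotopic map `∂ (1 ⊗ k) + (1 ⊗ k) ∂` is idempotent, and the complementary idempotent is
homotopic to the identity and splits through `A ⊗ H`, where `H` is the image of its leading part. -/
theorem exists_reduced (N : TypeD.{u}) : ∃ (N' : TypeD.{u}) (f : N.Mod →ₗ[TorAlg] N'.Mod)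
    (g : N'.Mod →ₗ[TorAlg] N.Mod) (h : N.Mod →ₗ[TorAlg] N.Mod), lead N'.d = 0 ∧
    f ∘ₗ N.d = N'.d ∘ₗ f ∧ g ∘ₗ N'.d = N.d ∘ₗ g ∧ f ∘ₗ g = LinearMap.id ∧
    g ∘ₗ f - LinearMap.id = N.d ∘ₗ h + h ∘ₗ N.d := by
  have : Finite N.V := Module.finite_of_finite IdemRing
  obtain ⟨k, hk⟩ := exists_generalized_inverse (lead N.d)
  let D : Module.End TorAlg N.Mod := N.d
  let K : Module.End TorAlg N.Mod := tensorOne TorAlg k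
  have hDD : D * D = 0 := N.d_comp_d
  let p := D * K + K * D
  obtain ⟨m, hm⟩ := exists_isIdempotentElem_pow p
  have hDp : Commute D p := by
    change D * (D * K + K * D) = (D * K + K * D) * D
    rw [mul_add, add_mul, ← mul_assoc, hDD, mul_assoc K, hDD, zero_mul, mul_zero, zero_add,
      add_zero, mul_assoc]
  have hDpm := hDp.pow_right m
  -- the power of `p` is null-homotopic
  have hnull : p ^ (m + 1) = D * (K * p ^ m) + K * p ^ m * D := by
    rw [mul_assoc K, ← hDpm.eq, pow_succ', add_mul]
    simp only [mul_assoc]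
  let e : Module.End TorAlg N.Mod := 1 - p ^ (m + 1)
  have he : e * e = e := IsIdempotentElem.one_sub (R := Module.End TorAlg N.Mod) hm
  have heDy : ∀ y, e (D y) = D (e y) := fun y => by
    have h : D ((p ^ (m + 1)) y) = (p ^ (m + 1)) (D y) :=
      LinearMap.congr_fun (hDp.pow_right (m + 1)).eq y
    change D y - (p ^ (m + 1)) (D y) = D (y - (p ^ (m + 1)) y)
    rw [map_sub, h]
  let dV : Module.End IdemRing N.V := lead N.d
  let q : Module.End IdemRing N.V := dV * k + k * dV
  let P : Module.End IdemRing N.V := 1 - q ^ (m + 1)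
  have hdd : dV * dV = 0 := by
    have h := lead_comp N.d N.d
    rw [N.d_comp_d] at h
    exact h.symm.trans (LinearMap.ext fun x => by rw [lead_apply]; simp)
  have hdkd : dV * (k * dV) = dV := LinearMap.ext hk
  have hlp : lead p = q := by
    have h1 := lead_comp N.d (tensorOne TorAlg k)
    have h2 := lead_comp (tensorOne TorAlg k) N.d
    rw [lead_tensorOne] at h1 h2
    exact (lead_add _ _).trans (congrArg₂ _ h1 h2)
  have hle : lead e = P := by
    refine (lead_sub _ _).trans ?_
    rw [lead_pow, hlp]
    exact congrArg (· - q ^ (m + 1)) lead_id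
  have hP : P * P = P := by
    have h := lead_comp e e
    rw [hle] at h
    exact h.symm.trans ((congrArg lead he).trans hle)
  have hqd : ∀ n : ℕ, q ^ n * dV = dV := fun n => by
    induction n with
    | zero => rw [pow_zero, one_mul]
    | succ n ih =>
      rw [pow_succ, mul_assoc, add_mul, mul_assoc, hdkd, mul_assoc, hdd, mul_zero, add_zero, ih]
  have hPd : P * dV = 0 := by rw [sub_mul, one_mul, hqd, sub_self]
  let H := LinearMap.range P
  let incl : H →ₗ[IdemRing] N.V := H.subtype
  let π : N.V →ₗ[IdemRing] H := P.rangeRestrict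
  have hPx : ∀ x, P (P x) = P x := fun x => LinearMap.congr_fun hP x
  have hPincl : ∀ x : H, P (incl x) = incl x := by
    rintro ⟨_, y, rfl⟩
    exact hPx y
  have hincl_π : ∀ x, incl (π x) = P x := fun x => rfl
  have hπ_incl : ∀ x, π (incl x) = x := fun x => Subtype.ext (hPincl x)
  have hπP : ∀ x, π (P x) = π x := fun x => Subtype.ext (hPx x)
  let f₀ : N.Mod →ₗ[TorAlg] TorAlg ⊗[IdemRing] H := tensorOne TorAlg π
  let g₀ : TorAlg ⊗[IdemRing] H →ₗ[TorAlg] N.Mod := tensorOne TorAlg incl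
  let u : Module.End TorAlg (TorAlg ⊗[IdemRing] H) := f₀ ∘ₗ e ∘ₗ g₀
  have hlu : lead u = LinearMap.id := by
    change lead (f₀ ∘ₗ e ∘ₗ g₀) = _
    rw [lead_comp, lead_comp, lead_tensorOne, lead_tensorOne, hle]
    refine LinearMap.ext fun x => ?_
    change π (P (incl x)) = x
    rw [hπP, hπ_incl]
  obtain ⟨u', hu'⟩ := isUnit_of_lead_eq_id hlu
  let w : Module.End TorAlg (TorAlg ⊗[IdemRing] H) := ((u'⁻¹ : (Module.End TorAlg _)ˣ) : _)
  have huw : u * w = 1 := by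
    rw [← hu']
    exact u'.mul_inv
  have hlw : lead w = LinearMap.id := by
    have h := lead_comp u w
    rw [hlu, LinearMap.id_comp] at h
    exact h.symm.trans ((congrArg lead huw).trans lead_id)
  let f : N.Mod →ₗ[TorAlg] TorAlg ⊗[IdemRing] H := f₀ ∘ₗ e
  let g : TorAlg ⊗[IdemRing] H →ₗ[TorAlg] N.Mod := e ∘ₗ g₀ ∘ₗ w
  have hee : ∀ y, e (e y) = e y := fun y => LinearMap.congr_fun he y
  have hfe : ∀ y, f (e y) = f y := fun y => congrArg f₀ (hee y)
  have heg : ∀ y, e (g y) = g y := fun y => hee _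
  have hfg : ∀ y, f (g y) = y := fun y => by
    refine (hfe (g₀ (w y))).trans ?_
    exact LinearMap.congr_fun huw y
  have hgf : (g ∘ₗ f : Module.End TorAlg N.Mod) = e := by
    -- the difference of `e` and `g ∘ f` is idempotent and has no leading part
    have h1 : e - g ∘ₗ f = 0 := by
      refine eq_zero_of_isIdempotentElem_of_lead_eq_zero (LinearMap.ext fun y => ?_) ?_
      · change e (e y - g (f y)) - g (f (e y - g (f y))) = e y - g (f y)
        simp only [map_sub, hee, heg, hfe, hfg]
        abel
      · rw [lead_sub, lead_comp]
        change lead e - lead (e ∘ₗ g₀ ∘ₗ w) ∘ₗ lead (f₀ ∘ₗ e) = 0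
        rw [lead_comp, lead_comp, lead_comp, lead_tensorOne, lead_tensorOne, hle, hlw]
        refine LinearMap.ext fun x => ?_
        change P x - P (incl (π (P x))) = 0
        rw [hincl_π, hPx, hPx, sub_self]
    exact (sub_eq_zero.1 h1).symm
  have hgf' : ∀ y, g (f y) = e y := fun y => LinearMap.congr_fun hgf y
  have hDD' : ∀ y, D (D y) = 0 := fun y => LinearMap.congr_fun hDD y
  let D' : TorAlg ⊗[IdemRing] H →ₗ[TorAlg] TorAlg ⊗[IdemRing] H := f ∘ₗ D ∘ₗ g
  have hD' : D' ∘ₗ D' = 0 := LinearMap.ext fun y => by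
    change f (D (g (f (D (g y))))) = 0
    rw [hgf', heDy, hDD', map_zero]
  have hfD : f ∘ₗ D = D' ∘ₗ f := LinearMap.ext fun y => by
    change f (D y) = f (D (g (f y)))
    rw [hgf', ← heDy, hfe]
  have hgD : g ∘ₗ D' = D ∘ₗ g := LinearMap.ext fun y => by
    change g (f (D (g y))) = D (g y)
    rw [hgf', heDy, heg]
  have he1 : e - 1 = D * (-(K * p ^ m)) + -(K * p ^ m) * D := LinearMap.ext fun y => by
    have h : (p ^ (m + 1)) y = D ((K * p ^ m) y) + (K * p ^ m) (D y) :=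
      LinearMap.congr_fun hnull y
    change y - (p ^ (m + 1)) y - y = D (-((K * p ^ m) y)) + -((K * p ^ m) (D y))
    rw [h, map_neg]
    abel
  refine ⟨ofDifferential H D' hD', f, g, -(K * p ^ m), ?_, ?_, ?_, LinearMap.ext hfg, ?_⟩
  · rw [ofDifferential_d]
    change lead ((f₀ ∘ₗ e) ∘ₗ D ∘ₗ g) = 0
    rw [lead_comp, lead_comp, lead_comp, lead_tensorOne, hle]
    refine LinearMap.ext fun x => ?_
    change π (P (dV (lead g x))) = 0
    have h : P (dV (lead g x)) = 0 := LinearMap.congr_fun hPd (lead g x)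
    rw [h, map_zero]
  · rw [ofDifferential_d]
    exact hfD
  · rw [ofDifferential_d]
    exact hgD
  · exact (congrArg (· - LinearMap.id) hgf).trans he1

end TypeD

/-! ### Lifting bands to chains of a filtered complex -/

section Arc

variable {k V : Type*} [Field k] [AddCommGroup V] [Module k V]

lemma sum_smul_sum_smul_of_mul_eq_one {n : Type*} [Fintype n] [DecidableEq n] {Φ Ψ : Matrix n n k}
    (h : Φ * Ψ = 1) (y : n → V) (a : n) : ∑ b, Φ a b • ∑ c, Ψ b c • y c = y a := by
  simp only [Finset.smul_sum, smul_smul]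
  rw [Finset.sum_comm]
  simp only [← Finset.sum_smul]
  have h' : ∀ c, ∑ b, Φ a b * Ψ b c = (1 : Matrix n n k) a c := fun c => congrFun (congrFun h a) c
  simp only [h', Matrix.one_apply, ite_smul, one_smul, zero_smul, Finset.sum_ite_eq,
    Finset.mem_univ, if_true]

namespace FilteredComplex

variable (C : FilteredComplex k V)

/-- Vectors related by a matrix `Φ` and the differential, up to higher filtration, are the leading
terms of vectors which are exactly related. -/
lemma exists_lift_of_crossRel {n : Type*} [Fintype n] [DecidableEq n] {p q : Fin 4} (hpq : p ≠ q)
    (Φ : GL n k) {x y : n → V}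
    (h : ∀ a, (x a, ∑ b, (Φ : Matrix n n k) a b • y b) ∈ C.crossRel p q) :
    ∃ e f : n → Fin 4 → V, (∀ a, e a ∈ C.filt p.val ∧ e a p = x a) ∧
      (∀ b, f b ∈ C.filt q.val ∧ f b q = y b) ∧
      (∀ a, C.M (e a) = if p < q then ∑ b, (Φ : Matrix n n k) a b • f b else 0) ∧
      ∀ b, C.M (f b) = if q < p then ∑ a, (Φ : Matrix n n k)⁻¹ b a • e a else 0 := by
  have h1 : (Φ : Matrix n n k) * (Φ : Matrix n n k)⁻¹ = 1 := by
    rw [← Matrix.coe_units_inv, Units.mul_inv]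
  have h2 : (Φ : Matrix n n k)⁻¹ * (Φ : Matrix n n k) = 1 := by
    rw [← Matrix.coe_units_inv, Units.inv_mul]
  rcases lt_or_gt_of_ne hpq with hlt | hlt
  · simp only [C.crossRel_of_lt hlt, mem_lead] at h
    choose w hw hMw hx hy using h
    refine ⟨w, fun b => ∑ a, (Φ : Matrix n n k)⁻¹ b a • C.M (w a), fun a => ⟨hw a, hx a⟩,
      fun b => ⟨sum_mem fun a _ => Submodule.smul_mem _ _ (hMw a), ?_⟩, fun a => ?_, fun b => ?_⟩
    · simp only [Finset.sum_apply, Pi.smul_apply, hy]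
      exact sum_smul_sum_smul_of_mul_eq_one h2 y b
    · rw [if_pos hlt]
      exact (sum_smul_sum_smul_of_mul_eq_one h1 (fun a => C.M (w a)) a).symm
    · rw [if_neg (lt_asymm hlt), map_sum]
      exact Finset.sum_eq_zero fun a _ => by rw [map_smul, C.sq, smul_zero]
  · simp only [C.crossRel_of_gt hlt, mem_relInv, mem_lead] at h
    choose w hw hMw hy hx using h
    refine ⟨fun a => C.M (w a), fun b => ∑ a, (Φ : Matrix n n k)⁻¹ b a • w a,
      fun a => ⟨hMw a, hx a⟩, fun b => ⟨sum_mem fun a _ => Submodule.smul_mem _ _ (hw a), ?_⟩,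
      fun a => ?_, fun b => ?_⟩
    · simp only [Finset.sum_apply, Pi.smul_apply, hy]
      exact sum_smul_sum_smul_of_mul_eq_one h2 y b
    · rw [if_neg (lt_asymm hlt), C.sq]
    · rw [if_pos hlt, map_sum]
      exact Finset.sum_congr rfl fun a _ => map_smul _ _ _

end FilteredComplex

namespace SideSystem.Band

variable {X : SideSystem k V} (B : X.Band)

/-- Parallel transport along the arc which starts at crossing `s`. -/
def transport (s : ZMod B.len) : GL (Fin B.dim) k := if s + 1 = 0 then B.monodromy else 1

end SideSystem.Band

lemma FilteredComplex.exists_lift_band {C : FilteredComplex k V} (B : C.toSideSystem.Band) :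
    ∃ e f : ZMod B.len → Fin B.dim → Fin 4 → V,
      (∀ s a, e s a ∈ C.filt (B.side s + 2).val ∧ e s a (B.side s + 2) = B.vec s a) ∧
      (∀ s a, f s a ∈ C.filt (B.side s).val ∧ f s a (B.side s) = B.vec s a) ∧
      (∀ s a, C.M (e s a) = if B.side s + 2 < B.side (s + 1) then
        ∑ b, (B.transport s : Matrix _ _ k) a b • f (s + 1) b else 0) ∧
      ∀ s b, C.M (f (s + 1) b) = if B.side (s + 1) < B.side s + 2 then
        ∑ a, (B.transport s : Matrix _ _ k)⁻¹ b a • e s a else 0 := by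
  have h : ∀ s, _ := fun s =>
    C.exists_lift_of_crossRel (B.reduced s).symm (B.transport s) (x := B.vec s)
      (y := B.vec (s + 1)) (B.step s)
  choose e f he hf hMe hMf using h
  have hs : ∀ s : ZMod B.len, s - 1 + 1 = s := fun s => sub_add_cancel s 1
  have hff : ∀ s b, f (s + 1 - 1) b = f s b := fun s b => by rw [add_sub_cancel_right]
  refine ⟨e, fun s => f (s - 1), he, fun s a => ?_, fun s a => ?_, fun s b => ?_⟩
  · have h := hf (s - 1) a
    rwa [hs] at h
  · simp only [hff]
    exact hMe s a
  · simp only [hff]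
    exact hMf s b

end Arc

/-! ### Acyclicity -/

namespace TypeD

/-- The complex of rows of `A ⊗ V` is acyclic. -/
def Acyclic (N : TypeD.{u}) : Prop :=
  ∀ w, TorAlg.sideRep.IsRow w → TorAlg.sideRep.hat N.d w = 0 →
    ∃ u, TorAlg.sideRep.IsRow u ∧ TorAlg.sideRep.hat N.d u = w

lemma Acyclic.of_retract {N : TypeD.{u}} {N' : TypeD.{v}} (hN : N.Acyclic)
    (f : N.Mod →ₗ[TorAlg] N'.Mod) (g : N'.Mod →ₗ[TorAlg] N.Mod) (hf : f ∘ₗ N.d = N'.d ∘ₗ f)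
    (hg : g ∘ₗ N'.d = N.d ∘ₗ g) (hfg : f ∘ₗ g = LinearMap.id) : N'.Acyclic := by
  intro w hw hNw
  obtain ⟨u, -, hu⟩ := hN (TorAlg.sideRep.hat g w) (IdemRep.isRow_hat _ _ _) (by
    rw [← IdemRep.hat_comp, ← hg, IdemRep.hat_comp, hNw, map_zero])
  refine ⟨TorAlg.sideRep.hat f u, IdemRep.isRow_hat _ _ _, ?_⟩
  rw [← IdemRep.hat_comp, ← hf, IdemRep.hat_comp, hu, ← IdemRep.hat_comp, hfg,
    IdemRep.hat_id _ hw]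

end TypeD

section Underlying

variable {V : Type u} [AddCommGroup V] [Module IdemRing V]

lemma coord_doubleRep_inr_inr (p q : Fin 4) (y : ExtAlg ⊗[IdemRing] V) :
    ExtAlg.doubleRep.coord (Sum.inr p) (Sum.inr q) y =
      TorAlg.sideRep.coord p q (reduceMod V y) := by
  induction y using TensorProduct.induction_on with
  | zero => simp
  | tmul a x =>
    rw [IdemRep.coord_tmul, reduceMod_tmul, IdemRep.coord_tmul]
    obtain ⟨X, hX⟩ := ExtAlg.double_eq a
    change (Pi.single _ (ExtAlg.double a _ _) : IdemRing) • x = _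
    rw [hX]
    rfl
  | add y z hy hz => simp only [map_add, hy, hz]

lemma coord_doubleRep_inl_inl (p q : Fin 4) (y : ExtAlg ⊗[IdemRing] V) :
    ExtAlg.doubleRep.coord (Sum.inl p) (Sum.inl q) y =
      TorAlg.sideRep.coord p q (reduceMod V y) := by
  induction y using TensorProduct.induction_on with
  | zero => simp
  | tmul a x =>
    rw [IdemRep.coord_tmul, reduceMod_tmul, IdemRep.coord_tmul]
    obtain ⟨X, hX⟩ := ExtAlg.double_eq a
    change (Pi.single _ (ExtAlg.double a _ _) : IdemRing) • x = _
    rw [hX]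
    rfl
  | add y z hy hz => simp only [map_add, hy, hz]

lemma ExtTypeD.underlying_d_one_tmul (E : ExtTypeD.{u}) (x : E.V) :
    E.underlying.d (1 ⊗ₜ x) = reduceMod E.V (E.d (1 ⊗ₜ x)) :=
  (E.underlying.d_one_tmul x).trans (congrArg (reduceMod E.V) (E.d_one_tmul x).symm)

/-- The square of the differential of the extension is multiplication by `U`, which identifies the
two copies of the sides in the doubled representation. Hence the part of the differential which
passes the top right corner once is a contracting homotopy. -/
lemma ExtTypeD.acyclic_underlying (E : ExtTypeD.{u}) : E.underlying.Acyclic := by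
  intro (w : Fin 4 → E.V) hw hEw
  have hu : ∀ (w : Fin 4 → E.V) q, TorAlg.sideRep.hat E.underlying.d w q =
      ∑ r, TorAlg.sideRep.coord r q (reduceMod E.V (E.d (1 ⊗ₜ w r))) := fun w q =>
    (IdemRep.hat_apply TorAlg.sideRep E.underlying.d w q).trans <|
      Finset.sum_congr rfl fun r _ =>
        congrArg (TorAlg.sideRep.coord r q) (E.underlying_d_one_tmul (w r))
  let D : (Fin 4 ⊕ Fin 4 → E.V) →+ (Fin 4 ⊕ Fin 4 → E.V) := ExtAlg.doubleRep.hat E.d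
  let wl : Fin 4 ⊕ Fin 4 → E.V := Sum.elim w 0
  let c : Fin 4 → E.V := fun q => D wl (Sum.inr q)
  have hl : ∀ q, D wl (Sum.inl q) = 0 := fun q => by
    have h := (hu w q).symm.trans (congrFun hEw q)
    change ExtAlg.doubleRep.hat E.d wl (Sum.inl q) = 0
    rw [IdemRep.hat_apply, Fintype.sum_sum_type]
    simp only [wl, Sum.elim_inl, Sum.elim_inr, Pi.zero_apply, TensorProduct.tmul_zero, map_zero,
      Finset.sum_const_zero, add_zero, coord_doubleRep_inl_inl]
    exact h
  have hD : D wl = Sum.elim (0 : Fin 4 → E.V) c := by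
    ext q
    cases q with
    | inl q => exact hl q
    | inr q => rfl
  have hDD : ∀ q, D (D wl) (Sum.inr q) = w q := fun q => by
    change ExtAlg.doubleRep.hat E.d (ExtAlg.doubleRep.hat E.d wl) (Sum.inr q) = w q
    rw [← IdemRep.hat_comp, IdemRep.hat_of_smul (c := ExtAlg.U) _ E.sq, Fintype.sum_sum_type]
    have hU : ∀ p q, ExtAlg.doubleRep.toHom ExtAlg.U (Sum.inl p) (Sum.inr q) =
        (1 : Matrix (Fin 4) (Fin 4) (ZMod 2)) p q := fun p q => by
      change ExtAlg.double ExtAlg.U _ _ = _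
      rw [ExtAlg.double_U]
      rfl
    simp only [wl, Sum.elim_inl, Sum.elim_inr, Pi.zero_apply, smul_zero, Finset.sum_const_zero,
      add_zero, hU]
    rw [Finset.sum_eq_single q]
    · rw [Matrix.one_apply_eq]
      exact hw q
    · intro r _ hr
      rw [Matrix.one_apply_ne hr, Pi.single_zero, zero_smul]
    · simp
  refine ⟨c, fun q => IdemRep.isRow_hat ExtAlg.doubleRep E.d wl (Sum.inr q), funext fun q => ?_⟩
  refine (hu c q).trans ?_
  rw [← hDD q, hD]
  change _ = ExtAlg.doubleRep.hat E.d _ _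
  rw [IdemRep.hat_apply, Fintype.sum_sum_type]
  simp only [Sum.elim_inl, Sum.elim_inr, Pi.zero_apply, TensorProduct.tmul_zero, map_zero,
    Finset.sum_const_zero, zero_add, coord_doubleRep_inr_inr]

lemma TypeD.Extendable.acyclic {N : TypeD.{u}} (hN : N.Extendable) : N.Acyclic := by
  obtain ⟨E, e, he⟩ := hN
  refine E.acyclic_underlying.of_retract e.toLinearMap e.symm.toLinearMap (LinearMap.ext he)
    (LinearMap.ext fun y => ?_) (LinearMap.ext fun y => e.apply_symm_apply y)
  change e.symm (N.d y) = E.underlying.d (e.symm y)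
  rw [LinearEquiv.symm_apply_eq, he, LinearEquiv.apply_symm_apply]

end Underlying

/-! ### From bands to curves -/

open TorusAlg

/-- The immersed curve with local system of a band. -/
noncomputable def SideSystem.Band.toDecoratedCurve {V : Type*} [AddCommGroup V] [Module (ZMod 2) V]
    {X : SideSystem (ZMod 2) V} (B : X.Band) : DecoratedCurve :=
  let h := exists_immersedCurve B.len B.side B.reduced
  { curve := h.choose
    len := B.len
    time := h.choose_spec.choose
    time_strictMono := h.choose_spec.choose_spec.1
    time_periodic := h.choose_spec.choose_spec.2.1
    time_range := h.choose_spec.choose_spec.2.2.1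
    side := B.side
    leaves := h.choose_spec.choose_spec.2.2.2.1
    embedded := h.choose_spec.choose_spec.2.2.2.2
    reduced := B.reduced
    dim := B.dim
    dim_pos := B.dim_pos
    monodromy := B.monodromy }

/-- The vector space underlying a type D structure. -/
noncomputable instance CurvedTypeD.zmodModule {B : Type} [Ring B] [OverIdem B] {c : B}
    (N : CurvedTypeD.{u} B c) : Module (ZMod 2) N.V :=
  Module.compHom N.V (algebraMap (ZMod 2) IdemRing)

lemma TorAlg.algebraMap_eq_incl (c : ZMod 2) :
    algebraMap (ZMod 2) TorAlg c = OverIdem.incl (algebraMap (ZMod 2) IdemRing c) := by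
  rw [TorAlg.incl_eq]
  change _ = c • TorAlg.idem 0 + c • TorAlg.idem 1
  rw [← smul_add, TorAlg.idem_sum, Algebra.algebraMap_eq_smul_one]

lemma sideIdem_eq_iff : ∀ p q : Fin 4, sideIdem p = sideIdem q ↔ p = q ∨ p = q + 2 := by
  decide

lemma add_two_ne : ∀ p : Fin 4, p + 2 ≠ p := by decide

lemma DecoratedCurve.sum_coeff_smul (C : DecoratedCurve) {M : Type*} [AddCommGroup M]
    [Module TorAlg M] (X : C.Gens → M) (t : ZMod C.len) (a : Fin C.dim) :
    ∑ h, C.coeff (t + 1, a) h • X h =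
      (∑ b, ((C.transport (t + 1) : Matrix _ _ (ZMod 2)) a b •
        TorAlg.chord (C.enter (t + 1)) (C.exit (t + 1))) • X (t + 1 + 1, b)) +
      ∑ b, ((C.transport t : Matrix _ _ (ZMod 2))⁻¹ a b •
        TorAlg.chord (C.exit t) (C.enter t)) • X (t, b) := by
  simp only [coeff, add_smul, Finset.sum_add_distrib, ite_smul, zero_smul]
  congr 1
  · rw [Fintype.sum_prod_type, Finset.sum_eq_single (t + 1 + 1)]
    · simp only [if_true]
    · intro s _ hs
      exact Finset.sum_eq_zero fun b _ => if_neg hs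
    · simp
  · rw [Fintype.sum_prod_type, Finset.sum_eq_single t]
    · simp only [if_true]
    · intro s _ hs
      exact Finset.sum_eq_zero fun b _ => if_neg fun h => hs (add_right_cancel h).symm
    · simp

namespace TypeD

variable (N : TypeD.{u})

lemma coord_algebraMap_smul (c : ZMod 2) (p q : Fin 4) (y : N.Mod) :
    TorAlg.sideRep.coord p q (algebraMap (ZMod 2) TorAlg c • y) =
      c • TorAlg.sideRep.coord p q y := by
  rw [TorAlg.algebraMap_eq_incl, IdemRep.coord_incl_smul]
  rfl

lemma row_smul_chord (c : ZMod 2) (p' q' p : Fin 4) (y : N.Mod) :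
    TorAlg.sideRep.row p ((c • TorAlg.chord p' q') • y) =
      if p' < q' ∧ p = p' then c • TorAlg.sideRep.row q' y else 0 := by
  ext q
  change TorAlg.sideRep.coord p q _ = _
  rw [← mul_one (c • TorAlg.chord p' q'), smul_mul_assoc, mul_one, Algebra.smul_def, mul_smul,
    coord_algebraMap_smul, IdemRep.coord_smul]
  change c • ∑ r, algebraMap (ZMod 2) IdemRing (TorAlg.sides _ p r) • _ = _
  rw [TorAlg.sides_chord]
  by_cases hlt : p' < q'
  · rw [if_pos hlt]
    by_cases hp : p = p'
    · subst hp
      rw [if_pos ⟨hlt, rfl⟩, Finset.sum_eq_single q']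
      · rw [Matrix.single_apply_same, map_one, one_smul]
        rfl
      · intro r _ hr
        rw [Matrix.single_apply_of_ne _ _ _ _ _ (fun h => hr h.2.symm), map_zero, zero_smul]
      · simp
    · rw [if_neg fun h => hp h.2, Finset.sum_eq_zero, smul_zero]
      · rfl
      · intro r _
        rw [Matrix.single_apply_of_ne _ _ _ _ _ (fun h => hp h.1.symm), map_zero, zero_smul]
  · rw [if_neg hlt, if_neg fun h => hlt h.1, Finset.sum_eq_zero, smul_zero]
    · rfl
    · intro r _
      rw [Matrix.zero_apply, map_zero, zero_smul]

/-- The filtered complex of rows of a type D structure whose differential has no leading part. -/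
noncomputable def filteredComplex (h0 : lead N.d = 0) (hN : N.Acyclic) :
    FilteredComplex (ZMod 2) N.V where
  E p :=
    { carrier := {x | (Pi.single (sideIdem p) 1 : IdemRing) • x = x}
      zero_mem' := smul_zero _
      add_mem' := fun {x y} hx hy => by
        change (Pi.single (sideIdem p) 1 : IdemRing) • (x + y) = x + y
        rw [smul_add]
        exact congrArg₂ _ hx hy
      smul_mem' := fun c x hx => by
        change (Pi.single (sideIdem p) 1 : IdemRing) • (algebraMap (ZMod 2) IdemRing c • x) =
          algebraMap (ZMod 2) IdemRing c • x
        rw [smul_comm]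
        exact congrArg _ hx }
  E_add_two p := by simp only [DecoratedCurve.sideIdem_add_two]
  M := (TorAlg.sideRep.hat N.d).toZModLinearMap 2
  M_mem w q := IdemRep.isRow_hat TorAlg.sideRep N.d w q
  strict w q h := by
    refine (hat_apply_of_forall_lt N.d h).trans ?_
    rw [h0, LinearMap.zero_apply, smul_zero]
  sq w := by
    change TorAlg.sideRep.hat N.d (TorAlg.sideRep.hat N.d w) = 0
    rw [← IdemRep.hat_comp, N.d_comp_d, IdemRep.hat_eq_sum_row]
    refine Finset.sum_eq_zero fun r _ => funext fun q => ?_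
    change TorAlg.sideRep.coord r q 0 = 0
    rw [map_zero]
  acyclic w hw h := hN w hw h

variable {N}

/-- A local system of chains along a curve, whose consecutive terms are related by the
differential, defines elements of `A ⊗ V` on which the differential acts as it does on the
generators of the type D structure of the curve. The generator at crossing `s` collects the chains
at the end of arc `s - 1` and at the start of arc `s`. -/
lemma exists_curve_chains {h0 : lead N.d = 0} {hN : N.Acyclic} (C : DecoratedCurve)
    {vec : ZMod C.len → Fin C.dim → N.V} {e f : ZMod C.len → Fin C.dim → Fin 4 → N.V}
    (hvec : ∀ s a, vec s a ∈ (N.filteredComplex h0 hN).E (C.side s))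
    (he : ∀ s a, e s a ∈ (N.filteredComplex h0 hN).filt (C.side s + 2).val ∧
      e s a (C.side s + 2) = vec s a)
    (hf : ∀ s a, f s a ∈ (N.filteredComplex h0 hN).filt (C.side s).val ∧
      f s a (C.side s) = vec s a)
    (hMe : ∀ s a, (N.filteredComplex h0 hN).M (e s a) = if C.side s + 2 < C.side (s + 1) then
      ∑ b, (C.transport s : Matrix _ _ (ZMod 2)) a b • f (s + 1) b else 0)
    (hMf : ∀ s b, (N.filteredComplex h0 hN).M (f (s + 1) b) =
      if C.side (s + 1) < C.side s + 2 then
        ∑ a, (C.transport s : Matrix _ _ (ZMod 2))⁻¹ b a • e s a else 0) :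
    ∃ X : C.Gens → N.Mod, (∀ g, augV (X g) = vec g.1 g.2) ∧
      (∀ g (s : IdemRing), (OverIdem.incl s : TorAlg) • X g =
        algebraMap (ZMod 2) TorAlg (s (C.idem g)) • X g) ∧
      ∀ g, N.d (X g) = ∑ h, C.coeff g h • X h := by
  have hE : ∀ s a p, sideIdem p = sideIdem (C.side s) →
      (Pi.single (sideIdem p) 1 : IdemRing) • vec s a = vec s a := fun s a p hp => by
    rw [hp]
    exact hvec s a
  let rows : ZMod C.len → Fin C.dim → Fin 4 → Fin 4 → N.V := fun s a p =>
    if p = C.side s + 2 then e s a else if p = C.side s then f s a else 0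
  have hrows_enter : ∀ s a, rows s a (C.side s + 2) = e s a := fun s a => if_pos rfl
  have hrows_exit : ∀ s a, rows s a (C.side s) = f s a := fun s a =>
    (if_neg (add_two_ne _).symm).trans (if_pos rfl)
  have hrows_other : ∀ s a p, sideIdem p ≠ sideIdem (C.side s) → rows s a p = 0 := fun s a p h => by
    rw [Ne, sideIdem_eq_iff, not_or] at h
    exact (if_neg h.2).trans (if_neg h.1)
  have hcases : ∀ s (p : Fin 4), p = C.side s ∨ p = C.side s + 2 ∨
      sideIdem p ≠ sideIdem (C.side s) := fun s p => by
    rw [Ne, sideIdem_eq_iff]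
    tauto
  let X : C.Gens → N.Mod := fun g => ofRows (vec g.1 g.2) (rows g.1 g.2)
  have hfilt : ∀ s a (p : Fin 4), rows s a p ∈ (N.filteredComplex h0 hN).filt p.val := by
    intro s a p
    rcases hcases s p with rfl | rfl | h
    · rw [hrows_exit]
      exact (hf s a).1
    · rw [hrows_enter]
      exact (he s a).1
    · rw [hrows_other s a p h]
      exact zero_mem _
  have hX : ∀ s a p, TorAlg.sideRep.row p (X (s, a)) = rows s a p := by
    intro s a p
    refine row_ofRows _ (fun p => (hfilt s a p).1) (fun p q hq => (hfilt s a p).2 q hq)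
      (fun p => ?_) p
    rcases hcases s p with rfl | rfl | h
    · rw [hrows_exit, (hf s a).2]
      exact (hE s a _ rfl).symm
    · rw [hrows_enter, (he s a).2]
      exact (hE s a _ (DecoratedCurve.sideIdem_add_two _)).symm
    · rw [hrows_other s a p h]
      change (0 : N.V) = (Pi.single (sideIdem p) 1 : IdemRing) • vec s a
      rw [← hE s a _ rfl, smul_smul, ← Pi.single_mul_left, Pi.single_eq_of_ne h, mul_zero,
        Pi.single_zero, zero_smul]
  refine ⟨X, fun g => augV_ofRows _ _, ?_, ?_⟩
  · rintro ⟨t, a⟩ s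
    refine row_ext fun p => funext fun q => ?_
    change TorAlg.sideRep.coord p q _ = TorAlg.sideRep.coord p q _
    rw [IdemRep.coord_incl_smul, coord_algebraMap_smul]
    change algebraMap (ZMod 2) IdemRing (s (sideIdem p)) • TorAlg.sideRep.coord p q (X (t, a)) =
      algebraMap (ZMod 2) IdemRing (s (sideIdem (C.side t))) • TorAlg.sideRep.coord p q (X (t, a))
    by_cases h : sideIdem p = sideIdem (C.side t)
    · rw [h]
    · have h1 : TorAlg.sideRep.coord p q (X (t, a)) = 0 :=
        (congrFun (hX t a p) q).trans (congrFun (hrows_other t a p h) q)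
      rw [h1, smul_zero, smul_zero]
  · rintro ⟨s, a⟩
    obtain ⟨t, rfl⟩ : ∃ t, s = t + 1 := ⟨s - 1, (sub_add_cancel s 1).symm⟩
    refine Eq.trans ?_ (C.sum_coeff_smul X t a).symm
    refine row_ext fun p => ?_
    have hadd : ∀ y z : N.Mod, TorAlg.sideRep.row p (y + z) =
        TorAlg.sideRep.row p y + TorAlg.sideRep.row p z := fun y z =>
      funext fun q => map_add (TorAlg.sideRep.coord p q) y z
    have hsum : ∀ F : Fin C.dim → N.Mod, TorAlg.sideRep.row p (∑ b, F b) =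
        ∑ b, TorAlg.sideRep.row p (F b) := fun F => funext fun q => by
      rw [Finset.sum_apply]
      exact map_sum (TorAlg.sideRep.coord p q) F _
    rw [IdemRep.row_map, hX, hadd, hsum, hsum]
    simp only [row_smul_chord, hX]
    change (N.filteredComplex h0 hN).M _ = _
    rcases hcases (t + 1) p with rfl | rfl | h
    · have h1 : C.side (t + 1) ≠ C.enter (t + 1) := (add_two_ne _).symm
      simp only [h1, and_false, if_false, Finset.sum_const_zero, zero_add]
      rw [hrows_exit, hMf]
      by_cases hlt : C.side (t + 1) < C.side t + 2
      · rw [if_pos hlt]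
        refine Finset.sum_congr rfl fun b _ => ?_
        rw [if_pos ⟨hlt, rfl⟩]
        exact congrArg _ (hrows_enter t b).symm
      · rw [if_neg hlt]
        exact (Finset.sum_eq_zero fun b _ => if_neg fun h => hlt h.1).symm
    · have h1 : C.side (t + 1) + 2 ≠ C.exit t := add_two_ne _
      simp only [h1, and_false, if_false, Finset.sum_const_zero, add_zero]
      rw [hrows_enter, hMe]
      by_cases hlt : C.side (t + 1) + 2 < C.side (t + 1 + 1)
      · rw [if_pos hlt]
        refine Finset.sum_congr rfl fun b _ => ?_
        rw [if_pos ⟨hlt, rfl⟩]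
        exact congrArg _ (hrows_exit (t + 1 + 1) b).symm
      · rw [if_neg hlt]
        exact (Finset.sum_eq_zero fun b _ => if_neg fun h => hlt h.1).symm
    · have h1 : p ≠ C.enter (t + 1) := by
        rintro rfl
        exact h (DecoratedCurve.sideIdem_add_two _)
      have h2 : p ≠ C.exit t := by
        rintro rfl
        exact h rfl
      simp only [h1, h2, and_false, if_false, Finset.sum_const_zero, add_zero]
      rw [hrows_other _ _ _ h, map_zero]

/-- A type D structure whose differential has no leading part and whose complex of rows is acyclic
is isomorphic to the type D structure of a collection of curves. -/
theorem exists_curves (h0 : lead N.d = 0) (hN : N.Acyclic) :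
    ∃ (m : ℕ) (C : Fin m → DecoratedCurve) (F : (curvesTypeD C).Mod →ₗ[TorAlg] N.Mod),
      Function.Bijective F ∧ F ∘ₗ (curvesTypeD C).d = N.d ∘ₗ F := by
  have : Finite N.V := Module.finite_of_finite IdemRing
  let K := N.filteredComplex h0 hN
  obtain ⟨m, B, hli, hspan⟩ := K.toSideSystem.exists_bands
    (by
      rw [eq_top_iff]
      intro x _
      rw [eq_single_add_single x]
      refine Submodule.add_mem_sup ?_ ?_
      · change (Pi.single 0 1 : IdemRing) • (Pi.single 0 1 : IdemRing) • x = _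
        rw [smul_smul, ← Pi.single_mul, one_mul]
      · change (Pi.single 1 1 : IdemRing) • (Pi.single 1 1 : IdemRing) • x = _
        rw [smul_smul, ← Pi.single_mul, one_mul])
    (by
      rw [eq_bot_iff]
      rintro x ⟨hx0, hx1⟩
      change (Pi.single 0 1 : IdemRing) • x = x at hx0
      change (Pi.single 1 1 : IdemRing) • x = x at hx1
      rw [Submodule.mem_bot, ← hx0, ← hx1, smul_smul, ← Pi.single_mul_left,
        Pi.single_eq_of_ne (by decide), mul_zero, Pi.single_zero, zero_smul])
  let C : Fin m → DecoratedCurve := fun i => (B i).toDecoratedCurve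
  have hchains : ∀ i, ∃ X : (C i).Gens → N.Mod, (∀ g, augV (X g) = (B i).vec g.1 g.2) ∧
      (∀ g (s : IdemRing), (OverIdem.incl s : TorAlg) • X g =
        algebraMap (ZMod 2) TorAlg (s ((C i).idem g)) • X g) ∧
      ∀ g, N.d (X g) = ∑ h, (C i).coeff g h • X h := fun i => by
    obtain ⟨e, f, he, hf, hMe, hMf⟩ := FilteredComplex.exists_lift_band (B i)
    exact exists_curve_chains (h0 := h0) (hN := hN) (C i) (vec := (B i).vec) (e := e) (f := f)
      (B i).vec_mem he hf hMe hMf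
  choose X hvec hidem hd using hchains
  let G := Σ i, (C i).Gens
  let Y : G → N.Mod := fun g => X g.1 g.2
  let idem : G → Fin 2 := fun g => (C g.1).idem g.2
  let T : GenSpace idem →+ N.Mod := AddMonoidHom.mk'
    (fun x => ∑ g, algebraMap (ZMod 2) TorAlg (x g) • Y g) fun x y => by
      rw [← Finset.sum_add_distrib]
      refine Finset.sum_congr rfl fun g _ => ?_
      rw [← add_smul, ← map_add]
      rfl
  have hT : ∀ (s : IdemRing) (x : GenSpace idem), T (s • x) = (OverIdem.incl s : TorAlg) • T x := by
    intro s x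
    change ∑ g, algebraMap (ZMod 2) TorAlg (s (idem g) * x g) • Y g = _ • ∑ g, _ • Y g
    rw [Finset.smul_sum]
    refine Finset.sum_congr rfl fun g _ => ?_
    rw [smul_smul, ← Algebra.commutes (x g), mul_smul, hidem g.1 g.2 s, smul_smul, ← map_mul,
      mul_comm]
  let F : (curvesTypeD C).Mod →ₗ[TorAlg] N.Mod := extend T hT
  have hTb : ∀ g, T (GenSpace.basis idem g) = Y g := fun g => by
    change ∑ h, algebraMap (ZMod 2) TorAlg ((Pi.single g 1 : G → ZMod 2) h) • Y h = _
    rw [Finset.sum_eq_single g]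
    · rw [Pi.single_eq_same, map_one, one_smul]
    · intro h _ hh
      rw [Pi.single_eq_of_ne hh, map_zero, zero_smul]
    · simp
  have hlead : ∀ x : GenSpace idem, lead F x = ∑ g, x g • (B g.1).vec g.2.1 g.2.2 := fun x => by
    change augV (extend T hT (1 ⊗ₜ x)) = _
    rw [extend_one_tmul]
    change augV (∑ g, algebraMap (ZMod 2) TorAlg (x g) • Y g) = _
    rw [map_sum]
    refine Finset.sum_congr rfl fun g _ => ?_
    rw [augV_smul, AlgHom.commutes, hvec]
    rfl
  have hbij : Function.Bijective (lead F) := by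
    constructor
    · rw [injective_iff_map_eq_zero]
      intro x hx
      exact funext (Fintype.linearIndependent_iff.1 hli x ((hlead x).symm.trans hx))
    · intro y
      obtain ⟨x, hx⟩ := (Submodule.mem_span_range_iff_exists_fun (ZMod 2)).1
        (hspan.ge (Submodule.mem_top (x := y)))
      exact ⟨x, (hlead x).trans hx⟩
  refine ⟨m, C, F, bijective_of_lead F (LinearEquiv.ofBijective (lead F) hbij) rfl,
    linearMap_ext fun (x : GenSpace idem) => ?_⟩
  have hdY : ∀ g, N.d (Y g) = ∑ h, Matrix.blockDiagonal' (fun i => (C i).coeff) g h • Y h := by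
    rintro ⟨i, g⟩
    rw [Fintype.sum_sigma, Finset.sum_eq_single i]
    · simp only [Matrix.blockDiagonal'_apply_eq]
      exact hd i g
    · intro j _ hj
      exact Finset.sum_eq_zero fun h _ => by
        rw [Matrix.blockDiagonal'_apply_ne _ _ _ hj.symm, zero_smul]
    · simp
  refine (congrArg F ((curvesTypeD C).d_one_tmul x)).trans
    (Eq.trans ?_ (congrArg N.d (extend_one_tmul T hT x)).symm)
  change F (∑ g, ∑ h, (x g • Matrix.blockDiagonal' (fun i => (C i).coeff) g h) ⊗ₜ
    GenSpace.basis idem h) = N.d (∑ g, algebraMap (ZMod 2) TorAlg (x g) • Y g)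
  rw [map_sum, map_sum]
  refine Finset.sum_congr rfl fun g _ => ?_
  rw [map_sum, map_smul, hdY, Finset.smul_sum]
  refine Finset.sum_congr rfl fun h _ => ?_
  refine (extend_tmul T hT _ _).trans ?_
  rw [hTb, smul_smul]
  exact congrArg (· • Y h) (Algebra.smul_def _ _)

end TypeD

theorem theorem1p4 (N : TypeD.{u}) (hN : N.Extendable) :
    ∃ (m : ℕ) (C : Fin m → DecoratedCurve), N.HomotopyEquivalent (curvesTypeD C) := by
  obtain ⟨N', f, g, h, hlead, hf, hg, hfg, hh⟩ := N.exists_reduced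
  obtain ⟨m, C, F, hF, hFd⟩ := TypeD.exists_curves hlead (hN.acyclic.of_retract f g hf hg hfg)
  let e : (curvesTypeD C).Mod ≃ₗ[TorAlg] N'.Mod := LinearEquiv.ofBijective F hF
  have hFe : ∀ y, F (e.symm y) = y := e.apply_symm_apply
  have hd : ∀ y, e.symm (N'.d y) = (curvesTypeD C).d (e.symm y) := fun y => by
    rw [LinearEquiv.symm_apply_eq]
    exact ((LinearMap.congr_fun hFd (e.symm y)).trans (congrArg N'.d (hFe y))).symm
  refine ⟨m, C, e.symm.toLinearMap ∘ₗ f, g ∘ₗ F, h, 0, ?_, ?_, ?_, ?_⟩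
  · rw [LinearMap.comp_assoc, hf]
    exact LinearMap.ext fun y => hd (f y)
  · rw [LinearMap.comp_assoc, hFd, ← LinearMap.comp_assoc, hg, LinearMap.comp_assoc]
  · rw [← hh]
    exact congrArg (· - LinearMap.id) (LinearMap.ext fun y => congrArg g (hFe (f y)))
  · rw [LinearMap.comp_zero, LinearMap.zero_comp, add_zero]
    refine LinearMap.ext fun y => sub_eq_zero.2 ?_
    change e.symm (f (g (F y))) = y
    rw [LinearEquiv.symm_apply_eq]
    exact LinearMap.congr_fun hfg (F y)
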